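/- **Theorem 2.2.** Let $n,m\ge 1$, $\nu_1,\dots,\nu_m\in(0,1]$, $\lambda_1,\dots,\lambda_m>0$, $\beta\in(0,1]$ and $c>0$. On a probability space let $H_1,\dots,H_m$ be independent stable subordinators, $H_j$ of order $\nu_j$ (nondecreasing Lévy processes with $\mathbb E\,e^{-\mu H_j(t)}=e^{-t\mu^{\nu_j}}$ for $\mu>0$), and let $\boldsymbol S_n^{2\beta}$ be an isotropic $2\beta$-stable process in $\mathbb R^n$ (a Lévy process with $\mathbb E\,e^{i\xi\cdot \boldsymbol S_n^{2\beta}(t)}=e^{-t\|\xi\|^{2\beta}}$) that is independent of $(H_1,\dots,H_m)$. Put $$L(t)=\inf\Big\{s>0:\ \sum_{j=1}^m\lambda_j^{1/\nu_j}H_j(s)\ge t\Big\},\qquad \boldsymbol W(t)=\boldsymbol S_n^{2\beta}\big(c^2L(t)\big),\qquad t\ge 0 .$$ Then $\boldsymbol W(t)$ is a random vector for every $t\ge0$, and the family of its laws is a solution, and the only one, of the Cauchy problem $$\sum_{j=1}^m\lambda_j\,\frac{{}^C\partial^{\nu_j}}{\partial t^{\nu_j}}w=-c^2(-\Delta)^\beta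 w\quad\text{on }\mathbb R^n\times(0,\infty),\qquad w(\cdot,0)=\delta_0 ,$$ in the class of families $(w_t)_{t\ge0}$ of finite signed measures on $\mathbb R^n$ whose total variation grows at most exponentially in $t$. Moreover, for all $\mu>0$ and $\xi\in\mathbb R^n$, $$\int_0^\infty e^{-\mu t}\,\mathbb E\,e^{i\xi\cdot \boldsymbol W(t)}\,dt=\frac{\sum_{j=1}^m\lambda_j\mu^{\nu_j-1}}{\sum_{j=1}^m\lambda_j\mu^{\nu_j}+c^2\|\xi\|^{2\beta}},$$ the integral being absolutely convergent. Here ${}^C\partial^\nu u/\partial t^\nu\,(t)=\frac1{\Gamma(1-\nu)}\int_0^t(t-s)^{-\nu}u'(s)\,ds$ for $\nu<1$ and $u'(t)$ for $\nu=1$. That $(w_t)$ solves the problem means that $w_0=\delta_0$ and that, for every complex-valued Schwartz function $\varphi$ on $\mathbb R^n$, the function $u_\varphi(t)=\int\varphi\,dw_t$ is continuous on $[0,\infty)$ and differentiable on $(0,\infty)$, $u_\varphi'$ is integrable on bounded intervals $(0,T)$, the integrals in the Caputo derivatives of $u_\varphi$ converge absolutely for $t>0$, and $$\sum_{j=1}^m\lambda_j\frac{{}^C\partial^{\nu_j}u_\varphi}{\partial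 t^{\nu_j}}(t)=-c^2\int(-\Delta)^\beta\varphi\,dw_t\qquad(t>0),$$ where $(-\Delta)^\beta\varphi$ is the function with Fourier transform $\|\xi\|^{2\beta}\widehat\varphi(\xi)$. -/

import Mathlib

open MeasureTheory ProbabilityTheory Filter Topology Set
open scoped NNReal FourierTransform SchwartzMap

noncomputable section

/-! ### Stochastic processes -/

/-- A Lévy process: it starts at `0`, has independent and stationary increments and its paths are
almost surely right-continuous with left limits. -/
structure IsLevyProcess {Ω E : Type*} [MeasurableSpace Ω] [NormedAddCommGroup E]
    [MeasurableSpace E] (X : ℝ≥0 → Ω → E) (P : Measure Ω) : Prop where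
  measurable : ∀ t, Measurable (X t)
  zero : ∀ᵐ ω ∂P, X 0 ω = 0
  indep_increments : HasIndepIncrements X P
  stationary_increments : ∀ s h : ℝ≥0,
    IdentDistrib (fun ω => X (s + h) ω - X s ω) (X h) P P
  cadlag : ∀ᵐ ω ∂P, ∀ t : ℝ≥0, ContinuousWithinAt (fun s => X s ω) (Ici t) t ∧
    ∃ l : E, Tendsto (fun s => X s ω) (𝓝[<] t) (𝓝 l)

/-- A stable subordinator of order `ν ∈ (0, 1]` (totally positively skewed stable process): a Lévy
process with nondecreasing paths and `𝔼 exp (-μ H(t)) = exp (-t μ ^ ν)`. -/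
structure IsStableSubordinator {Ω : Type*} [MeasurableSpace Ω] (ν : ℝ) (H : ℝ≥0 → Ω → ℝ)
    (P : Measure Ω) : Prop where
  levy : IsLevyProcess H P
  monotone : ∀ᵐ ω ∂P, Monotone (fun t => H t ω)
  laplace : ∀ (t : ℝ≥0) (μ : ℝ), 0 < μ →
    ∫ ω, Real.exp (-μ * H t ω) ∂P = Real.exp (-(t : ℝ) * μ ^ ν)

/-- The isotropic `2β`-stable process on `ℝⁿ`, `β ∈ (0, 1]`: a Lévy process with
`𝔼 exp (i ξ · S(t)) = exp (-t ‖ξ‖ ^ (2β))`. -/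
structure IsIsotropicStableProcess {Ω : Type*} [MeasurableSpace Ω] {n : ℕ} (β : ℝ)
    (S : ℝ≥0 → Ω → EuclideanSpace ℝ (Fin n)) (P : Measure Ω) : Prop where
  levy : IsLevyProcess S P
  charFun_eq : ∀ (t : ℝ≥0) (ξ : EuclideanSpace ℝ (Fin n)),
    charFun (P.map (S t)) ξ = Real.exp (-(t : ℝ) * ‖ξ‖ ^ (2 * β))

/-- The linear combination `∑ⱼ λⱼ ^ (1 / νⱼ) Hⱼ(s)`. -/
def weightedSum {Ω : Type*} {m : ℕ} (ν lam : Fin m → ℝ) (H : Fin m → ℝ≥0 → Ω → ℝ)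
    (s : ℝ≥0) (ω : Ω) : ℝ :=
  ∑ j, lam j ^ (1 / ν j) * H j s ω

/-- The inverse (hitting time) process `L(t) = inf {s > 0 : ∑ⱼ λⱼ ^ (1 / νⱼ) Hⱼ(s) ≥ t}`. -/
def inverseProcess {Ω : Type*} {m : ℕ} (ν lam : Fin m → ℝ) (H : Fin m → ℝ≥0 → Ω → ℝ)
    (t : ℝ) (ω : Ω) : ℝ≥0 :=
  sInf {s : ℝ≥0 | 0 < s ∧ t ≤ weightedSum ν lam H s ω}

/-- The process `W(t) = S(c² L(t))`. -/
def timeChanged {Ω : Type*} {n m : ℕ} (ν lam : Fin m → ℝ) (c : ℝ)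
    (S : ℝ≥0 → Ω → EuclideanSpace ℝ (Fin n)) (H : Fin m → ℝ≥0 → Ω → ℝ)
    (t : ℝ) (ω : Ω) : EuclideanSpace ℝ (Fin n) :=
  S (Real.toNNReal (c ^ 2) * inverseProcess ν lam H t ω) ω

/-! ### The space-time fractional Cauchy problem -/

/-- The Dzerbayshan-Caputo derivative of order `ν ∈ (0, 1]` of `u : [0, ∞) → ℂ` at `t > 0`:
`(1 / Γ(1 - ν)) ∫₀ᵗ (t - s) ^ (-ν) u'(s) ds` for `ν < 1`, and the derivative `u'(t)` for `ν = 1`. -/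
def caputoDeriv (ν : ℝ) (u : ℝ → ℂ) (t : ℝ) : ℂ :=
  if ν = 1 then deriv u t
  else (Real.Gamma (1 - ν))⁻¹ • ∫ s in (0 : ℝ)..t, (t - s) ^ (-ν) • deriv u s

/-- The functions `u : [0, ∞) → ℂ` that have a classical Caputo derivative of order `ν ∈ (0, 1]` at
every `t > 0`: `u` is continuous on `[0, ∞)` and differentiable on `(0, ∞)`, `u'` is integrable on
bounded intervals (so that `u` is the integral of `u'`), and for `ν < 1` the integral that defines
the Caputo derivative converges absolutely. -/
structure CaputoDifferentiable (ν : ℝ) (u : ℝ → ℂ) : Prop where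
  continuousOn : ContinuousOn u (Ici 0)
  differentiableAt : ∀ t, 0 < t → DifferentiableAt ℝ u t
  integrable_deriv : ∀ t, 0 < t → IntervalIntegrable (deriv u) volume 0 t
  integrable_kernel : ν ≠ 1 → ∀ t, 0 < t →
    IntervalIntegrable (fun s => (t - s) ^ (-ν) • deriv u s) volume 0 t

/-- The fractional Laplacian `(-Δ)^β` of a Schwartz function, through the Fourier transform:
`(-Δ)^β φ` has Fourier transform `‖ξ‖ ^ (2β)` times that of `φ`. The factor `2 * π` comes from the
normalisation `exp (-2πi ξ · x)` of the Fourier transform `𝓕` used here. -/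
def fracLaplacian {n : ℕ} (β : ℝ) (φ : 𝓢(EuclideanSpace ℝ (Fin n), ℂ)) :
    EuclideanSpace ℝ (Fin n) → ℂ :=
  𝓕⁻ (fun ξ : EuclideanSpace ℝ (Fin n) =>
    (((2 * Real.pi * ‖ξ‖) ^ (2 * β) : ℝ) : ℂ) * (𝓕 φ) ξ)

/-- The integral of a function against a finite signed measure. -/
def signedIntegral {n : ℕ} (w : SignedMeasure (EuclideanSpace ℝ (Fin n)))
    (f : EuclideanSpace ℝ (Fin n) → ℂ) : ℂ :=
  (∫ x, f x ∂w.toJordanDecomposition.posPart) - ∫ x, f x ∂w.toJordanDecomposition.negPart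

/-- A family `(w t)`, `t ≥ 0`, of finite signed measures on `ℝⁿ` (of at most exponentially growing
total variation) is a solution of the Cauchy problem
`∑ⱼ λⱼ ∂_t^{νⱼ} w = - c² (-Δ)^β w` on `ℝⁿ × (0, ∞)`, `w(x, 0) = δ(x)`, with Caputo derivatives in
time. The derivatives in space are taken in the sense of distributions, that is, by testing against
Schwartz functions and moving the (symmetric) operator `(-Δ)^β` to the test function; the
derivatives in time are classical. -/
structure IsCauchySolution {n m : ℕ} (ν lam : Fin m → ℝ) (β c : ℝ)
    (w : ℝ → SignedMeasure (EuclideanSpace ℝ (Fin n))) : Prop where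
  initial : w 0 = (Measure.dirac (0 : EuclideanSpace ℝ (Fin n))).toSignedMeasure
  growth : ∃ C a : ℝ, ∀ t, 0 ≤ t →
    (w t).totalVariation univ ≤ ENNReal.ofReal (C * Real.exp (a * t))
  regular : ∀ (φ : 𝓢(EuclideanSpace ℝ (Fin n), ℂ)) (j : Fin m),
    CaputoDifferentiable (ν j) (fun t => signedIntegral (w t) φ)
  equation : ∀ (φ : 𝓢(EuclideanSpace ℝ (Fin n), ℂ)) (t : ℝ), 0 < t →
    ∑ j, (lam j : ℂ) * caputoDeriv (ν j) (fun s => signedIntegral (w s) φ) t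
      = -(c : ℂ) ^ 2 * signedIntegral (w t) (fracLaplacian β φ)

end

/-! # Fractional diffusion and time-changed stable processes

Write `f(μ) = ∑ⱼ λⱼ μ ^ νⱼ`, `A = ∑ⱼ λⱼ ^ (1 / νⱼ) Hⱼ` and `V(κ, t) = ∫₀^∞ exp (-κ s) P(A(s) < t)
ds` (`potential`). By independence and scaling, `𝔼 exp (-μ A(s)) = exp (-s f(μ))`
(`isSubordinatorWith_weightedSum`).

*Fourier-Laplace transform.* Since `s < L(t)` means `A(s) < t`, the Laplace transform of the hitting
time `L(t)` at `κ` is `1 - κ V(κ, t)` (`IsSubordinatorWith.integral_exp_hittingTime`). Conditioning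
on `L(t)`, which is independent of `S`, makes this, at `κ = c² ‖ξ‖ ^ (2β)`, the characteristic
function of `W(t)` (`charFun_timeChanged`). Fubini's theorem gives `1 / (μ (f(μ) + κ))` for the
Laplace transform of `V(κ, ·)` (`IsSubordinatorWith.hasLaplace_potential`), and with it the formula
of the theorem.

*Regularity.* The function `1 / (f(μ) + κ)` is the Laplace transform of a function that is
continuous on `(0, ∞)` with a power singularity at `0`, constructed by a Neumann series of power
functions around the leading term of `f` (`exists_resolvent`). By uniqueness of Laplace transforms
(`ae_eq_zero_of_hasLaplace`) this function is the density `∂V/∂t`, and the mode `u = 1 - κ V(κ, ·)`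
satisfies the relaxation equation `∑ⱼ λⱼ D^νⱼ u = -κ u`
(`IsSubordinatorWith.sum_caputoIntegral_potentialDensity`). The constants that the Neumann series
gives depend on `κ`; a bound uniform in `κ` comes from the probabilistic meaning of `V`, whose
increments decrease in `κ`, whence `0 ≤ ∂V/∂t (κ, t) ≤ ∂V/∂t (0, t)`
(`IsSubordinatorWith.potentialDensity_le`).

*Existence.* By Parseval's formula the integral of a Schwartz function `φ` against the law of `W(t)`
is a superposition over `ξ` of these modes, and the uniform bound allows to differentiate and to
interchange the integrals (`IsSubordinatorWith.superposition_solves`,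
`isCauchySolution_timeChanged`).

*Uniqueness.* The growth condition provides Fourier-Laplace transforms of all solutions, but not of
their time derivatives. The equation is therefore first integrated in time, where the Caputo
operator commutes with taking primitives (`integral_caputoIntegral`). Its Laplace transform then
reads `(f(μ) + c² ‖ξ‖ ^ (2β)) ŵ(μ, ξ) = f(μ) / μ` weakly in `ξ`
(`IsCauchySolution.fourierLaplace_equation`), which determines `ŵ`, hence all `∫ φ dw_t` by
uniqueness of Laplace transforms, and so `w_t` (`IsCauchySolution.unique`). -/

noncomputable section

/-! ### Laplace transforms -/

/-- `h` has, at `μ`, the absolutely convergent Laplace transform `∫₀^∞ exp (-μ t) h(t) dt = z`. -/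
def HasLaplace (h : ℝ → ℂ) (μ : ℝ) (z : ℂ) : Prop :=
  IntegrableOn (fun t => Real.exp (-μ * t) • h t) (Ioi 0) ∧
    ∫ t in Ioi (0 : ℝ), Real.exp (-μ * t) • h t = z

namespace HasLaplace

variable {h g : ℝ → ℂ} {μ : ℝ} {z y : ℂ}

lemma congr (hh : HasLaplace h μ z) (e : ∀ t, 0 < t → h t = g t) : HasLaplace g μ z := by
  have he : EqOn (fun t => Real.exp (-μ * t) • h t) (fun t => Real.exp (-μ * t) • g t) (Ioi 0) :=
    fun t ht => by simp only [e t ht]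
  exact ⟨hh.1.congr_fun he measurableSet_Ioi,
    by rw [← hh.2]; exact (setIntegral_congr_fun measurableSet_Ioi he).symm⟩

lemma sub (hh : HasLaplace h μ z) (hg : HasLaplace g μ y) :
    HasLaplace (fun t => h t - g t) μ (z - y) := by
  refine ⟨?_, ?_⟩
  · simp only [smul_sub]
    exact Integrable.sub hh.1 hg.1
  · simp only [smul_sub]
    rw [integral_sub hh.1 hg.1, hh.2, hg.2]

lemma const_mul (hh : HasLaplace h μ z) (k : ℂ) : HasLaplace (fun t => k * h t) μ (k * z) := by
  have e : ∀ t, Real.exp (-μ * t) • (k * h t) = k * (Real.exp (-μ * t) • h t) := fun t => by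
    rw [mul_smul_comm]
  refine ⟨?_, ?_⟩
  · simp only [e]; exact Integrable.const_mul hh.1 k
  · simp only [e]; rw [integral_const_mul, hh.2]

lemma sum {ι : Type*} (s : Finset ι) {h : ι → ℝ → ℂ} {z : ι → ℂ}
    (hh : ∀ i ∈ s, HasLaplace (h i) μ (z i)) :
    HasLaplace (fun t => ∑ i ∈ s, h i t) μ (∑ i ∈ s, z i) := by
  refine ⟨?_, ?_⟩
  · simp only [Finset.smul_sum]
    exact integrable_finsetSum s fun i hi => (hh i hi).1
  · simp only [Finset.smul_sum]
    rw [integral_finsetSum s fun i hi => (hh i hi).1]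
    exact Finset.sum_congr rfl fun i hi => (hh i hi).2

lemma of_const (hμ : 0 < μ) : HasLaplace (fun _ => z) μ (z / μ) := by
  refine ⟨?_, ?_⟩
  · exact (integrableOn_exp_mul_Ioi (by linarith) 0).smul_const z
  · rw [integral_smul_const, integral_exp_mul_Ioi (by linarith)]
    have : (μ : ℂ) ≠ 0 := by exact_mod_cast hμ.ne'
    simp
    field_simp

end HasLaplace

/-- The function `x ↦ g (-log x)` extends continuously by `0` to `x = 0`, if `g` has compact
support in `(0, ∞)`. -/
lemma continuous_comp_neg_log {g : ℝ → ℝ} (hg : Continuous g) (hc : HasCompactSupport g)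
    (hs : tsupport g ⊆ Ioi 0) : Continuous (fun x => g (-Real.log x)) := by
  rw [continuous_iff_continuousAt]
  intro x
  rcases eq_or_ne x 0 with rfl | hx
  · have h0 : g 0 = 0 := by
      by_contra hne
      exact lt_irrefl _ (mem_Ioi.1 (hs (subset_tsupport _ hne)))
    rw [continuousAt_iff_punctured_nhds]
    simp only [Real.log_zero, neg_zero, h0]
    have hz : ∀ᶠ y in atTop, g y = 0 := by
      obtain ⟨B, hB⟩ := hc.isCompact.isBounded.bddAbove
      filter_upwards [eventually_gt_atTop B] with y hy
      by_contra hne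
      exact absurd (hB (subset_tsupport _ hne)) (not_le.2 hy)
    have ht : Tendsto (fun x => -Real.log x) (𝓝[≠] 0) atTop :=
      tendsto_neg_atBot_atTop.comp Real.tendsto_log_nhdsNE_zero
    exact tendsto_const_nhds.congr' ((ht.eventually hz).mono fun x hx => hx.symm)
  · exact hg.continuousAt.comp (Real.continuousAt_log hx).neg

/-- **Uniqueness of Laplace transforms**: after the substitution `x = exp (-t)` the transforms at
`a, a + 1, a + 2, …` are moments on `[0, 1]`, and polynomials are dense there. -/
theorem ae_eq_zero_of_hasLaplace {h : ℝ → ℂ} {a : ℝ} (hh : ∀ μ, a ≤ μ → HasLaplace h μ 0) :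
    ∀ᵐ t : ℝ, t ∈ Ioi (0 : ℝ) → h t = 0 := by
  set G : ℝ → ℂ := fun t => Real.exp (-a * t) • h t with hG
  have hGi : IntegrableOn G (Ioi 0) := (hh a le_rfl).1
  have key : ∀ᵐ t : ℝ, t ∈ Ioi (0 : ℝ) → G t = 0 := by
    refine isOpen_Ioi.ae_eq_zero_of_integral_contDiff_smul_eq_zero hGi.locallyIntegrableOn ?_
    intro g hg hgc hgs
    have hmono : ∀ k : ℕ, ∀ t, Real.exp (-t) ^ k • G t = Real.exp (-(a + k) * t) • h t := by
      intro k t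
      rw [hG, smul_smul, ← Real.exp_nat_mul, ← Real.exp_add]
      congr 2; ring
    have hpoly : ∀ p : Polynomial ℝ, IntegrableOn (fun t => p.eval (Real.exp (-t)) • G t) (Ioi 0) ∧
        ∫ t in Ioi (0 : ℝ), p.eval (Real.exp (-t)) • G t = 0 := by
      intro p
      have hk : ∀ k : ℕ, HasLaplace h (a + k) 0 := fun k => hh _ (by simp)
      simp only [Polynomial.eval_eq_sum_range, Finset.sum_smul, mul_smul, hmono]
      have hi : ∀ k ∈ Finset.range (p.natDegree + 1), IntegrableOn
          (fun t => p.coeff k • Real.exp (-(a + k) * t) • h t) (Ioi 0) :=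
        fun k _ => Integrable.smul (p.coeff k) (hk k).1
      refine ⟨integrable_finsetSum _ hi, ?_⟩
      rw [integral_finsetSum _ hi]
      refine Finset.sum_eq_zero fun k _ => ?_
      rw [integral_smul, (hk k).2, smul_zero]
    have hgI : IntegrableOn (fun t => g t • G t) (Ioi 0) := by
      obtain ⟨B, hB⟩ := hgc.exists_bound_of_continuous hg.continuous
      exact hGi.bdd_smul B hg.continuous.aestronglyMeasurable (ae_of_all _ hB)
    have hset : ∫ t, g t • G t = ∫ t in Ioi (0 : ℝ), g t • G t := by
      refine (setIntegral_eq_integral_of_forall_compl_eq_zero fun t ht => ?_).symm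
      rw [image_eq_zero_of_notMem_tsupport fun hmem => ht (hgs hmem), zero_smul]
    rw [hset]
    set N := ∫ t in Ioi (0 : ℝ), ‖G t‖ with hN
    have hN0 : 0 ≤ N := integral_nonneg fun _ => norm_nonneg _
    refine norm_le_zero_iff.1 (le_of_forall_pos_le_add fun ε hε => ?_)
    obtain ⟨p, hp⟩ := exists_polynomial_near_of_continuousOn 0 1 (fun x => g (-Real.log x))
      (continuous_comp_neg_log hg.continuous hgc hgs).continuousOn (ε / (N + 1)) (by positivity)
    have e : ∫ t in Ioi (0 : ℝ), g t • G t
        = ∫ t in Ioi (0 : ℝ), (g t - p.eval (Real.exp (-t))) • G t := by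
      simp only [sub_smul]
      rw [integral_sub hgI (hpoly p).1, (hpoly p).2, sub_zero]
    rw [e, zero_add]
    calc ‖∫ t in Ioi (0 : ℝ), (g t - p.eval (Real.exp (-t))) • G t‖
        ≤ ∫ t in Ioi (0 : ℝ), ε / (N + 1) * ‖G t‖ := by
          refine norm_integral_le_of_norm_le (hGi.norm.const_mul _) ?_
          filter_upwards [ae_restrict_mem measurableSet_Ioi] with t ht
          rw [norm_smul, Real.norm_eq_abs, abs_sub_comm]
          have := hp (Real.exp (-t)) ⟨(Real.exp_pos _).le, by
            rw [Real.exp_le_one_iff]; linarith [mem_Ioi.1 ht]⟩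
          simp only [Real.log_exp, neg_neg] at this
          gcongr
      _ = ε * (N / (N + 1)) := by rw [integral_const_mul]; ring
      _ ≤ ε := mul_le_of_le_one_right hε.le (by rw [div_le_one (by positivity)]; linarith)
  filter_upwards [key] with t ht h0
  have := ht h0
  rwa [hG, smul_eq_zero_iff_right (Real.exp_pos _).ne'] at this

lemma ae_eq_of_hasLaplace {h g : ℝ → ℂ} {a : ℝ} {z : ℝ → ℂ}
    (hh : ∀ μ, a ≤ μ → HasLaplace h μ (z μ)) (hg : ∀ μ, a ≤ μ → HasLaplace g μ (z μ)) :
    ∀ᵐ t : ℝ, t ∈ Ioi (0 : ℝ) → h t = g t := by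
  have := ae_eq_zero_of_hasLaplace (h := fun t => h t - g t) (a := a)
    (fun μ hμ => by simpa using (hh μ hμ).sub (hg μ hμ))
  filter_upwards [this] with t ht h0 using sub_eq_zero.1 (ht h0)

lemma eqOn_of_hasLaplace {h g : ℝ → ℂ} {a : ℝ} {z : ℝ → ℂ}
    (hh : ∀ μ, a ≤ μ → HasLaplace h μ (z μ)) (hg : ∀ μ, a ≤ μ → HasLaplace g μ (z μ))
    (hc : ContinuousOn h (Ioi 0)) (hc' : ContinuousOn g (Ioi 0)) : EqOn h g (Ioi 0) :=
  Measure.eqOn_open_of_ae_eq ((ae_restrict_iff' measurableSet_Ioi).2 (ae_eq_of_hasLaplace hh hg))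
    isOpen_Ioi hc hc'

/-! ### The resolvent kernel: inverse Laplace transform of `1 / (∑ⱼ λⱼ μ ^ νⱼ + κ)` -/

lemma HasLaplace.of_real {r : ℝ → ℝ} {μ z : ℝ}
    (hi : IntegrableOn (fun t => Real.exp (-μ * t) * r t) (Ioi 0))
    (hz : ∫ t in Ioi (0 : ℝ), Real.exp (-μ * t) * r t = z) :
    HasLaplace (fun t => (r t : ℂ)) μ (z : ℂ) := by
  have e : ∀ t, Real.exp (-μ * t) • (r t : ℂ) = ((Real.exp (-μ * t) * r t : ℝ) : ℂ) := fun t => by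
    push_cast
    rw [Complex.real_smul]
    push_cast
    rfl
  refine ⟨?_, ?_⟩
  · simp only [e]
    exact Integrable.ofReal hi
  · simp only [e]
    rw [← hz]
    exact integral_ofReal

/-- The part of `Γ(a + 1) = ∫₀^∞ exp (-y) y ^ a dy` over `y > x` is at least `x ^ a exp (-x)`. -/
lemma rpow_le_Gamma_mul_exp {a x : ℝ} (ha : 0 ≤ a) (hx : 0 < x) :
    x ^ a ≤ Real.Gamma (a + 1) * Real.exp x := by
  have hint : IntegrableOn (fun y : ℝ => Real.exp (-y) * y ^ a) (Ioi 0) := by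
    simpa using Real.GammaIntegral_convergent (s := a + 1) (by linarith)
  have h1 : ∫ y in Ioi x, Real.exp (-y) * x ^ a ≤ Real.Gamma (a + 1) := by
    rw [Real.Gamma_eq_integral (by linarith), add_sub_cancel_right]
    calc ∫ y in Ioi x, Real.exp (-y) * x ^ a
        ≤ ∫ y in Ioi x, Real.exp (-y) * y ^ a := by
          refine setIntegral_mono_on ((integrableOn_exp_neg_Ioi x).mul_const _)
            (hint.mono_set (Ioi_subset_Ioi hx.le)) measurableSet_Ioi fun y hy => ?_
          have : x ≤ y := (mem_Ioi.1 hy).le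
          gcongr
      _ ≤ ∫ y in Ioi 0, Real.exp (-y) * y ^ a := by
          refine setIntegral_mono_set hint ?_ (Ioi_subset_Ioi hx.le).eventuallyLE
          filter_upwards [ae_restrict_mem measurableSet_Ioi] with y hy
          have : 0 < y := hy
          positivity
  rw [integral_mul_const, integral_exp_neg_Ioi] at h1
  calc x ^ a = (Real.exp (-x) * x ^ a) * Real.exp x := by
        rw [mul_comm (Real.exp (-x)), mul_assoc, ← Real.exp_add]; simp
    _ ≤ _ := by gcongr

/-- The kernel `t ^ (a - 1) / Γ(a)`, whose Laplace transform is `μ ^ (-a)`. -/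
def powerKernel (a t : ℝ) : ℝ := t ^ (a - 1) / Real.Gamma a

lemma powerKernel_nonneg {a t : ℝ} (ha : 0 < a) (ht : 0 < t) : 0 ≤ powerKernel a t :=
  div_nonneg (Real.rpow_nonneg ht.le _) (Real.Gamma_pos_of_pos ha).le

lemma continuousOn_powerKernel (a : ℝ) : ContinuousOn (powerKernel a) (Ioi 0) :=
  (continuousOn_id.rpow_const fun _ hx => Or.inl (ne_of_gt hx)).div_const _

lemma integrableOn_exp_mul_powerKernel {a μ : ℝ} (ha : 0 < a) (hμ : 0 < μ) :
    IntegrableOn (fun t => Real.exp (-μ * t) * powerKernel a t) (Ioi 0) := by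
  have h := (integrableOn_rpow_mul_exp_neg_mul_rpow (p := 1) (s := a - 1) (b := μ) (by linarith)
    one_pos hμ).div_const (Real.Gamma a)
  refine IntegrableOn.congr_fun (show IntegrableOn _ (Ioi 0) volume from h) (fun t _ => ?_)
    measurableSet_Ioi
  simp only [Real.rpow_one, powerKernel]
  ring

lemma integral_exp_mul_powerKernel {a μ : ℝ} (ha : 0 < a) (hμ : 0 < μ) :
    ∫ t in Ioi (0 : ℝ), Real.exp (-μ * t) * powerKernel a t = μ ^ (-a) := by
  have h := Real.integral_rpow_mul_exp_neg_mul_Ioi ha hμ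
  have e : ∀ t, Real.exp (-μ * t) * powerKernel a t
      = t ^ (a - 1) * Real.exp (-(μ * t)) * (Real.Gamma a)⁻¹ := fun t => by
    rw [powerKernel, neg_mul]; ring
  simp only [e]
  rw [integral_mul_const, h, mul_assoc, mul_inv_cancel₀ (Real.Gamma_pos_of_pos ha).ne', mul_one,
    one_div, Real.inv_rpow hμ.le, Real.rpow_neg hμ.le]

lemma inv_Gamma_le {a : ℝ} (ha : 0 < a) : (Real.Gamma a)⁻¹ ≤ Real.exp 1 := by
  have hG := Real.Gamma_pos_of_pos ha
  rw [inv_le_iff_one_le_mul₀ hG, mul_comm]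
  rcases le_total 1 a with h | h
  · simpa using rpow_le_Gamma_mul_exp (a := a - 1) (x := 1) (by linarith) one_pos
  · have h1 := rpow_le_Gamma_mul_exp (a := a) (x := 1) ha.le one_pos
    rw [Real.one_rpow, Real.Gamma_add_one ha.ne'] at h1
    refine h1.trans ?_
    have : a * Real.Gamma a ≤ Real.Gamma a := mul_le_of_le_one_left hG.le h
    gcongr

/-- A bound on the power kernels that is uniform in the exponent `a ≥ α`. -/
lemma powerKernel_le {a α x : ℝ} (hα : 0 < α) (ha : α ≤ a) (hx : 0 < x) :
    powerKernel a x ≤ Real.exp (x + 1) * (1 + x ^ (α - 1)) := by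
  have ha0 := hα.trans_le ha
  have hG := Real.Gamma_pos_of_pos ha0
  have hxa := Real.rpow_pos_of_pos hx (α - 1)
  have hE := inv_Gamma_le ha0
  have hE0 : 0 < (Real.Gamma a)⁻¹ := inv_pos.2 hG
  have h1 : Real.exp 1 ≤ Real.exp (x + 1) := Real.exp_le_exp.2 (by linarith)
  rw [powerKernel, div_eq_mul_inv]
  rcases le_total x 1 with h | h
  · have h2 : x ^ (a - 1) ≤ x ^ (α - 1) := Real.rpow_le_rpow_of_exponent_ge hx h (by linarith)
    calc x ^ (a - 1) * (Real.Gamma a)⁻¹ ≤ x ^ (α - 1) * Real.exp (x + 1) :=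
          mul_le_mul h2 (hE.trans h1) hE0.le hxa.le
      _ ≤ _ := by rw [mul_comm]; gcongr; linarith
  · rcases le_total 1 a with h' | h'
    · have h3 := rpow_le_Gamma_mul_exp (a := a - 1) (x := x) (by linarith) hx
      rw [sub_add_cancel] at h3
      calc x ^ (a - 1) * (Real.Gamma a)⁻¹ ≤ Real.exp x := by
            rw [← div_eq_mul_inv, div_le_iff₀ hG, mul_comm]; exact h3
        _ ≤ Real.exp (x + 1) * 1 := by rw [mul_one]; exact Real.exp_le_exp.2 (by linarith)
        _ ≤ _ := by gcongr; linarith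
    · have h2 : x ^ (a - 1) ≤ 1 := Real.rpow_le_one_of_one_le_of_nonpos h (by linarith)
      calc x ^ (a - 1) * (Real.Gamma a)⁻¹ ≤ 1 * Real.exp (x + 1) :=
            mul_le_mul h2 (hE.trans h1) hE0.le zero_le_one
        _ ≤ _ := by rw [mul_comm]; gcongr; linarith

/-- The bound `powerKernel_le` at `μ t`: by scaling it gains the factor `μ ^ (-a)`, which makes the
Neumann series below converge for large `μ`. -/
lemma powerKernel_le_exp {a α μ t : ℝ} (hα : 0 < α) (hα1 : α ≤ 1) (ha : α ≤ a) (hμ : 1 ≤ μ)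
    (ht : 0 < t) :
    powerKernel a t ≤ μ * μ ^ (-a) * (Real.exp (μ * t + 1) * (1 + t ^ (α - 1))) := by
  have hμ0 : 0 < μ := by linarith
  have h := powerKernel_le hα ha (mul_pos hμ0 ht)
  have e : powerKernel a t = μ * μ ^ (-a) * powerKernel a (μ * t) := by
    have h1 : μ ^ (a - 1) ≠ 0 := (Real.rpow_pos_of_pos hμ0 _).ne'
    have h2 : μ * μ ^ (-a) = (μ ^ (a - 1))⁻¹ := by
      rw [← Real.rpow_neg hμ0.le, neg_sub, sub_eq_add_neg, Real.rpow_add hμ0, Real.rpow_one]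
    rw [powerKernel, powerKernel, Real.mul_rpow hμ0.le ht.le, h2]
    field_simp
  rw [e]
  have h3 : (μ * t) ^ (α - 1) ≤ t ^ (α - 1) :=
    Real.rpow_le_rpow_of_nonpos ht (le_mul_of_one_le_left ht.le hμ) (by linarith)
  have : 0 ≤ μ * μ ^ (-a) := by positivity
  refine mul_le_mul_of_nonneg_left (h.trans ?_) this
  gcongr

section Word

variable {ι : Type*} [Fintype ι] {α μ : ℝ} {c δ : ι → ℝ}

/-- The `n`-th term, up to sign, of the Neumann series that inverts
`μ ^ α (1 + ∑ᵢ cᵢ μ ^ (-δᵢ))`: its Laplace transform is `μ ^ (-α) (∑ᵢ cᵢ μ ^ (-δᵢ)) ^ n`, expanded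
over the words `w` of length `n` in the index set. -/
def wordKernel (α : ℝ) (c δ : ι → ℝ) (n : ℕ) (t : ℝ) : ℝ :=
  ∑ w : Fin n → ι, (∏ i, c (w i)) * powerKernel (α + ∑ i, δ (w i)) t

lemma sum_words (hμ : 0 < μ) (n : ℕ) :
    ∑ w : Fin n → ι, (∏ i, c (w i)) * μ ^ (-(α + ∑ i, δ (w i)))
      = μ ^ (-α) * (∑ i, c i * μ ^ (-δ i)) ^ n := by
  rw [Fintype.sum_pow, Finset.mul_sum]
  refine Finset.sum_congr rfl fun w _ => ?_
  rw [Finset.prod_mul_distrib, neg_add, Real.rpow_add hμ, ← Finset.sum_neg_distrib,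
    Real.rpow_sum_of_pos hμ]
  ring

lemma wordKernel_nonneg (hα : 0 < α) (hc : ∀ i, 0 ≤ c i) (hδ : ∀ i, 0 < δ i) (n : ℕ) {t : ℝ}
    (ht : 0 < t) : 0 ≤ wordKernel α c δ n t :=
  Finset.sum_nonneg fun _ _ => mul_nonneg (Finset.prod_nonneg fun _ _ => hc _)
    (powerKernel_nonneg (add_pos_of_pos_of_nonneg hα (Finset.sum_nonneg fun _ _ => (hδ _).le)) ht)

lemma continuousOn_wordKernel (n : ℕ) : ContinuousOn (wordKernel α c δ n) (Ioi 0) :=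
  continuousOn_finsetSum _ fun _ _ => continuousOn_const.mul (continuousOn_powerKernel _)

lemma wordKernel_le (hα : 0 < α) (hα1 : α ≤ 1) (hc : ∀ i, 0 ≤ c i) (hδ : ∀ i, 0 < δ i)
    (hμ : 1 ≤ μ) (n : ℕ) {t : ℝ} (ht : 0 < t) :
    wordKernel α c δ n t ≤ μ * (Real.exp (μ * t + 1) * (1 + t ^ (α - 1))) *
      (μ ^ (-α) * (∑ i, c i * μ ^ (-δ i)) ^ n) := by
  rw [← sum_words (by linarith), Finset.mul_sum]
  refine Finset.sum_le_sum fun w _ => ?_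
  have h := powerKernel_le_exp hα hα1 (a := α + ∑ i, δ (w i))
    (by linarith [Finset.sum_nonneg (fun i (_ : i ∈ Finset.univ) => (hδ (w i)).le)]) hμ ht
  calc _ ≤ (∏ i, c (w i)) * _ := mul_le_mul_of_nonneg_left h (Finset.prod_nonneg fun i _ => hc _)
    _ = _ := by ring

lemma wordKernel_laplace (hα : 0 < α) (hδ : ∀ i, 0 < δ i) (hμ : 0 < μ) (n : ℕ) :
    IntegrableOn (fun t => Real.exp (-μ * t) * wordKernel α c δ n t) (Ioi 0) ∧
    ∫ t in Ioi (0 : ℝ), Real.exp (-μ * t) * wordKernel α c δ n t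
      = μ ^ (-α) * (∑ i, c i * μ ^ (-δ i)) ^ n := by
  have hpos : ∀ w : Fin n → ι, 0 < α + ∑ i, δ (w i) := fun w =>
    add_pos_of_pos_of_nonneg hα (Finset.sum_nonneg fun i _ => (hδ _).le)
  have hi : ∀ w ∈ (Finset.univ : Finset (Fin n → ι)), IntegrableOn (fun t => (∏ i, c (w i)) *
      (Real.exp (-μ * t) * powerKernel (α + ∑ i, δ (w i)) t)) (Ioi 0) := fun w _ =>
    (integrableOn_exp_mul_powerKernel (hpos w) hμ).const_mul _
  have e : ∀ t, Real.exp (-μ * t) * wordKernel α c δ n t = ∑ w : Fin n → ι, (∏ i, c (w i)) *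
      (Real.exp (-μ * t) * powerKernel (α + ∑ i, δ (w i)) t) := fun t => by
    rw [wordKernel, Finset.mul_sum]
    exact Finset.sum_congr rfl fun w _ => by ring
  simp only [e]
  refine ⟨integrable_finsetSum _ hi, ?_⟩
  rw [integral_finsetSum _ hi, ← sum_words hμ]
  refine Finset.sum_congr rfl fun w _ => ?_
  rw [integral_const_mul, integral_exp_mul_powerKernel (hpos w) hμ]

/-- Inversion of the Laplace transform `1 / (μ ^ α (1 + ∑ᵢ cᵢ μ ^ (-δᵢ)))` by a Neumann series. -/
lemma exists_inverse_laplace (hα : 0 < α) (hα1 : α ≤ 1) (hc : ∀ i, 0 ≤ c i) (hδ : ∀ i, 0 < δ i) :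
    ∃ (r : ℝ → ℝ) (C M : ℝ), 0 ≤ C ∧ 1 ≤ M ∧ ContinuousOn r (Ioi 0) ∧
      (∀ t, 0 < t → |r t| ≤ C * Real.exp (M * t) * (1 + t ^ (α - 1))) ∧
      ∀ μ, M < μ → HasLaplace (fun t => (r t : ℂ)) μ
        ((μ ^ (-α) * (1 + ∑ i, c i * μ ^ (-δ i))⁻¹ : ℝ) : ℂ) := by
  have hq : Tendsto (fun μ : ℝ => ∑ i, c i * μ ^ (-δ i)) atTop (𝓝 0) := by
    have : Tendsto (fun μ : ℝ => ∑ i, c i * μ ^ (-δ i)) atTop (𝓝 (∑ i, c i * 0)) :=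
      tendsto_finsetSum _ fun i _ => (tendsto_rpow_neg_atTop (hδ i)).const_mul _
    simpa using this
  obtain ⟨M₀, hM₀⟩ := eventually_atTop.1
    (hq.eventually (gt_mem_nhds (show (0 : ℝ) < 1 / 2 by norm_num)))
  set M := max M₀ 1
  have hM1 : 1 ≤ M := le_max_right _ _
  have hqM : ∀ μ, M ≤ μ → ∑ i, c i * μ ^ (-δ i) < 1 / 2 := fun μ h =>
    hM₀ μ ((le_max_left _ _).trans h)
  have hq0 : ∀ μ : ℝ, M ≤ μ → 0 ≤ ∑ i, c i * μ ^ (-δ i) := fun μ h =>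
    Finset.sum_nonneg fun i _ => mul_nonneg (hc i) (Real.rpow_nonneg (by linarith) _)
  set Q := ∑ i, c i * M ^ (-δ i) with hQ
  have hgeo : Summable (fun n => Q ^ n) :=
    summable_geometric_of_lt_one (hq0 M le_rfl) ((hqM M le_rfl).trans (by norm_num))
  have hnorm : ∀ n t, 0 < t → ‖(-1 : ℝ) ^ n * wordKernel α c δ n t‖ = wordKernel α c δ n t :=
    fun n t ht => by
      rw [norm_mul, norm_pow, norm_neg, norm_one, one_pow, one_mul,
        Real.norm_of_nonneg (wordKernel_nonneg hα hc hδ n ht)]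
  have hbd : ∀ n t, 0 < t → ‖(-1 : ℝ) ^ n * wordKernel α c δ n t‖
      ≤ M * (Real.exp (M * t + 1) * (1 + t ^ (α - 1))) * (M ^ (-α) * Q ^ n) := fun n t ht =>
    (hnorm n t ht).trans_le (wordKernel_le hα hα1 hc hδ hM1 n ht)
  have hbds : ∀ t : ℝ, Summable fun n =>
      M * (Real.exp (M * t + 1) * (1 + t ^ (α - 1))) * (M ^ (-α) * Q ^ n) := fun t =>
    (hgeo.mul_left _).mul_left _
  set r : ℝ → ℝ := fun t => ∑' n, (-1) ^ n * wordKernel α c δ n t with hr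
  have hcont : ContinuousOn r (Ioi 0) := by
    intro x hx
    have hx : 0 < x := hx
    -- on a compact interval around `x` the bounds are uniform
    have hcx : ContinuousOn r (Icc (x / 2) (2 * x)) := by
      refine continuousOn_tsum (u := fun n => M * (Real.exp (M * (2 * x) + 1) *
        (1 + (x / 2) ^ (α - 1))) * (M ^ (-α) * Q ^ n)) (fun n => ?_)
        ((hgeo.mul_left _).mul_left _) fun n t ht => ?_
      · exact (continuousOn_const.mul (continuousOn_wordKernel n)).mono fun t ht =>
          lt_of_lt_of_le (by positivity) ht.1
      · have ht0 : 0 < t := lt_of_lt_of_le (by positivity) ht.1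
        refine (hbd n t ht0).trans ?_
        have h1 : t ^ (α - 1) ≤ (x / 2) ^ (α - 1) :=
          Real.rpow_le_rpow_of_nonpos (by positivity) ht.1 (by linarith)
        have h2 := ht.2
        have h3 : 0 ≤ Q ^ n := pow_nonneg (hq0 M le_rfl) n
        gcongr
    exact (hcx.continuousAt (Icc_mem_nhds (by linarith) (by linarith))).continuousWithinAt
  have hrb : ∀ t, 0 < t → |r t| ≤
      (M * Real.exp 1 * M ^ (-α) * (∑' n, Q ^ n)) * Real.exp (M * t) * (1 + t ^ (α - 1)) := by
    intro t ht
    have h1 : |r t| ≤ ∑' n, M * (Real.exp (M * t + 1) * (1 + t ^ (α - 1))) * (M ^ (-α) * Q ^ n) :=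
      tsum_of_norm_bounded (hbds t).hasSum fun n => hbd n t ht
    refine h1.trans_eq ?_
    rw [tsum_mul_left, tsum_mul_left, Real.exp_add]
    ring
  have hmeas : AEStronglyMeasurable r (volume.restrict (Ioi 0)) :=
    hcont.aestronglyMeasurable measurableSet_Ioi
  refine ⟨r, _, M, ?_, hM1, hcont, hrb, fun μ hμ => HasLaplace.of_real ?_ ?_⟩
  · have : 0 ≤ ∑' n, Q ^ n := tsum_nonneg fun n => pow_nonneg (hq0 M le_rfl) n
    positivity
  · set C := M * Real.exp 1 * M ^ (-α) * (∑' n, Q ^ n)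
    have hG1 := (integrableOn_exp_mul_powerKernel (a := 1) (μ := μ - M) one_pos
      (by linarith)).const_mul C
    have hG2 := (integrableOn_exp_mul_powerKernel (a := α) (μ := μ - M) hα (by linarith)).const_mul
      (C * Real.Gamma α)
    refine Integrable.mono' (hG1.add hG2)
      ((Continuous.aestronglyMeasurable (by fun_prop)).mul hmeas) ?_
    filter_upwards [ae_restrict_mem measurableSet_Ioi] with t ht
    have hb := hrb t ht
    rw [norm_mul, Real.norm_of_nonneg (Real.exp_pos _).le, Real.norm_eq_abs]
    refine (mul_le_mul_of_nonneg_left hb (Real.exp_pos _).le).trans_eq ?_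
    have hE : Real.exp (-(μ - M) * t) = Real.exp (-μ * t) * Real.exp (M * t) := by
      rw [← Real.exp_add]; congr 1; ring
    have := (Real.Gamma_pos_of_pos hα).ne'
    simp only [Pi.add_apply, powerKernel, Real.Gamma_one, sub_self, Real.rpow_zero, hE]
    field_simp
  · have hμ0 : 0 < μ := by linarith
    set q := ∑ i, c i * μ ^ (-δ i)
    have hqq : q < 1 / 2 := hqM μ hμ.le
    have hqq0 : 0 ≤ q := hq0 μ hμ.le
    have hL := fun n => wordKernel_laplace (c := c) hα hδ hμ0 n
    have hs := hasSum_integral_of_summable_integral_norm (μ := volume.restrict (Ioi (0 : ℝ)))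
      (F := fun n t => (-1 : ℝ) ^ n * (Real.exp (-μ * t) * wordKernel α c δ n t))
      (fun n => (hL n).1.const_mul _) (by
        have : ∀ n : ℕ,
            ∫ t in Ioi (0 : ℝ), ‖(-1 : ℝ) ^ n * (Real.exp (-μ * t) * wordKernel α c δ n t)‖
            = μ ^ (-α) * q ^ n := fun n => by
          rw [← (hL n).2]
          refine setIntegral_congr_fun measurableSet_Ioi fun t ht => ?_
          rw [norm_mul, norm_pow, norm_neg, norm_one, one_pow, one_mul, Real.norm_of_nonneg
            (mul_nonneg (Real.exp_pos _).le (wordKernel_nonneg hα hc hδ n ht))]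
        simp only [this]
        exact (summable_geometric_of_lt_one hqq0 (by linarith)).mul_left _)
    have e1 : ∀ t, ∑' n, (-1 : ℝ) ^ n * (Real.exp (-μ * t) * wordKernel α c δ n t)
        = Real.exp (-μ * t) * r t := fun t => by
      rw [hr, ← tsum_mul_left]
      exact tsum_congr fun n => by ring
    simp only [e1] at hs
    have hs2 : HasSum (fun n : ℕ => μ ^ (-α) * (-q) ^ n) (μ ^ (-α) * (1 - -q)⁻¹) :=
      (hasSum_geometric_of_abs_lt_one (by rw [abs_neg, abs_of_nonneg hqq0]; linarith)).mul_left _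
    rw [sub_neg_eq_add] at hs2
    refine hs.unique (hs2.congr_fun fun n => ?_)
    rw [integral_const_mul, (hL n).2, neg_pow]
    ring

end Word

/-- The Laplace exponent `∑ⱼ λⱼ μ ^ νⱼ` of the subordinator `∑ⱼ λⱼ ^ (1 / νⱼ) Hⱼ`. -/
def laplaceExponent {m : ℕ} (ν lam : Fin m → ℝ) (μ : ℝ) : ℝ := ∑ j, lam j * μ ^ ν j

lemma laplaceExponent_pos {m : ℕ} (hm : 0 < m) {ν lam : Fin m → ℝ} (hlam : ∀ j, 0 < lam j)
    {μ : ℝ} (hμ : 0 < μ) : 0 < laplaceExponent ν lam μ :=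
  have : Nonempty (Fin m) := ⟨⟨0, hm⟩⟩
  Finset.sum_pos (fun j _ => mul_pos (hlam j) (Real.rpow_pos_of_pos hμ _)) Finset.univ_nonempty

/-- The function with Laplace transform `1 / (∑ⱼ λⱼ μ ^ νⱼ + κ)`; the largest `νⱼ` governs its
singularity at `0`. -/
theorem exists_resolvent {m : ℕ} (hm : 0 < m) {ν lam : Fin m → ℝ} (hν : ∀ j, 0 < ν j ∧ ν j ≤ 1)
    (hlam : ∀ j, 0 < lam j) {κ : ℝ} (hκ : 0 ≤ κ) :
    ∃ (r : ℝ → ℝ) (α C M : ℝ), 0 < α ∧ α ≤ 1 ∧ 0 ≤ C ∧ 1 ≤ M ∧ ContinuousOn r (Ioi 0) ∧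
      (∀ t, 0 < t → |r t| ≤ C * Real.exp (M * t) * (1 + t ^ (α - 1))) ∧
      ∀ μ, M < μ → HasLaplace (fun t => (r t : ℂ)) μ
        (((laplaceExponent ν lam μ + κ)⁻¹ : ℝ) : ℂ) := by
  have : Nonempty (Fin m) := ⟨⟨0, hm⟩⟩
  obtain ⟨j₀, hj₀⟩ := Finite.exists_max ν
  set α := ν j₀
  have hα := (hν j₀).1
  have hα1 := (hν j₀).2
  classical
  set Λ := ∑ j, if ν j = α then lam j else 0 with hΛ
  have hΛ0 : 0 < Λ := by
    refine Finset.sum_pos' (fun j _ => ?_) ⟨j₀, Finset.mem_univ _, ?_⟩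
    · split_ifs
      exacts [(hlam j).le, le_rfl]
    · rw [if_pos rfl]; exact hlam j₀
  -- the index `none` carries `κ`; the terms of order `α` are collected in `Λ`
  let c : Option (Fin m) → ℝ := fun o =>
    o.elim (κ / Λ) fun j => if ν j = α then 0 else lam j / Λ
  let δ : Option (Fin m) → ℝ := fun o => o.elim α fun j => if ν j = α then 1 else α - ν j
  have hc : ∀ i, 0 ≤ c i := by
    rintro (_ | j)
    · exact div_nonneg hκ hΛ0.le
    · simp only [c, Option.elim_some]
      split_ifs
      exacts [le_rfl, div_nonneg (hlam j).le hΛ0.le]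
  have hδ : ∀ i, 0 < δ i := by
    rintro (_ | j)
    · exact hα
    · simp only [δ, Option.elim_some]
      split_ifs with h
      exacts [one_pos, sub_pos.2 (lt_of_le_of_ne (hj₀ j) h)]
  obtain ⟨r, C, M, hC, hM, hcont, hb, hL⟩ := exists_inverse_laplace hα hα1 hc hδ
  refine ⟨fun t => Λ⁻¹ * r t, α, Λ⁻¹ * C, M, hα, hα1, by positivity, hM,
    continuousOn_const.mul hcont, fun t ht => ?_, fun μ hμ => ?_⟩
  · rw [abs_mul, abs_of_pos (inv_pos.2 hΛ0), mul_assoc, mul_assoc, ← mul_assoc C]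
    exact mul_le_mul_of_nonneg_left (hb t ht) (inv_pos.2 hΛ0).le
  · have hμ0 : 0 < μ := by linarith
    have h := (hL μ hμ).const_mul (Λ⁻¹ : ℂ)
    have hz : (laplaceExponent ν lam μ + κ)⁻¹
        = Λ⁻¹ * (μ ^ (-α) * (1 + ∑ i, c i * μ ^ (-δ i))⁻¹) := by
      have hp : 0 < μ ^ α := Real.rpow_pos_of_pos hμ0 _
      rw [Real.rpow_neg hμ0.le, ← mul_inv, ← mul_inv]
      congr 1
      rw [Fintype.sum_option, mul_add, mul_one, mul_add, mul_add, Finset.mul_sum, mul_add,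
        Finset.mul_sum]
      have e1 : Λ * (μ ^ α * (c none * μ ^ (-δ none))) = κ := by
        simp only [c, δ, Option.elim_none]
        rw [Real.rpow_neg hμ0.le]
        field_simp
      rw [e1, laplaceExponent, hΛ, Finset.sum_mul]
      have e2 : ∀ j, lam j * μ ^ ν j = (if ν j = α then lam j else 0) * μ ^ α +
          Λ * (μ ^ α * (c (some j) * μ ^ (-δ (some j)))) := fun j => by
        simp only [c, δ, Option.elim_some]
        split_ifs with h
        · rw [h]; simp
        · rw [neg_sub, Real.rpow_sub hμ0]
          field_simp
          ring
      rw [Finset.sum_congr rfl fun j _ => e2 j, Finset.sum_add_distrib]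
      ring
    rw [hz]
    simpa using h

/-! ### The operator that turns a derivative into a Caputo derivative -/

/-- The convolution of `v` with the kernel `t ^ (-ν) / Γ(1 - ν)` on `(0, t)`, and `v` itself for
`ν = 1`; the Caputo derivative of order `ν` of `u` is this operator applied to `u'`, and for `ν = 0`
it is the primitive that vanishes at `0`. -/
def caputoIntegral (ν : ℝ) (v : ℝ → ℂ) (t : ℝ) : ℂ :=
  if ν = 1 then v t
  else (Real.Gamma (1 - ν))⁻¹ • ∫ s in (0 : ℝ)..t, (t - s) ^ (-ν) • v s

lemma caputoDeriv_eq (ν : ℝ) (u : ℝ → ℂ) : caputoDeriv ν u = caputoIntegral ν (deriv u) := rfl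

lemma caputoIntegral_zero (v : ℝ → ℂ) (t : ℝ) :
    caputoIntegral 0 v t = ∫ s in (0 : ℝ)..t, v s := by
  simp [caputoIntegral]

@[simp]
lemma caputoIntegral_one (v : ℝ → ℂ) : caputoIntegral 1 v = v := by
  ext t
  simp [caputoIntegral]

lemma caputoIntegral_congr {ν t : ℝ} (ht : 0 < t) {v w : ℝ → ℂ}
    (h : ∀ s, 0 < s → s ≤ t → v s = w s) : caputoIntegral ν v t = caputoIntegral ν w t := by
  unfold caputoIntegral
  split_ifs
  · exact h t ht le_rfl
  · congr 1
    refine intervalIntegral.integral_congr_uIoo fun s hs => ?_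
    rw [uIoo_of_le ht.le] at hs
    simp only [h s hs.1 hs.2.le]

/-- `caputoIntegral ν` multiplies Laplace transforms by `μ ^ (ν - 1)`. -/
lemma HasLaplace.caputoIntegral {ν μ : ℝ} (hν : ν ≤ 1) (hμ : 0 < μ) {v : ℝ → ℂ} {z : ℂ}
    (hv : HasLaplace v μ z) :
    HasLaplace (caputoIntegral ν v) μ (((μ ^ (ν - 1) : ℝ) : ℂ) * z) := by
  rcases eq_or_ne ν 1 with rfl | h1
  · simpa using hv
  have hν0 : 0 < 1 - ν := by
    have := lt_of_le_of_ne hν h1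
    linarith
  set f : ℝ → ℂ := fun t => Real.exp (-μ * t) • v t
  set g : ℝ → ℝ := fun t => Real.exp (-μ * t) * powerKernel (1 - ν) t
  have hg : IntegrableOn g (Ioi 0) := integrableOn_exp_mul_powerKernel hν0 hμ
  have hgz : ∫ t in Ioi (0 : ℝ), g t = μ ^ (ν - 1) := by
    rw [integral_exp_mul_powerKernel hν0 hμ, neg_sub]
  let Lc : ℂ →L[ℝ] ℝ →L[ℝ] ℂ := (ContinuousLinearMap.lsmul ℝ ℝ).flip
  have hL : ∀ (z : ℂ) (x : ℝ), Lc z x = x • z := fun z x => rfl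
  have e : ∀ x : ℝ, ∫ t in (0 : ℝ)..x, Lc (f t) (g (x - t))
      = Real.exp (-μ * x) • _root_.caputoIntegral ν v x := by
    intro x
    rw [_root_.caputoIntegral, if_neg h1, ← intervalIntegral.integral_smul,
      ← intervalIntegral.integral_smul]
    refine intervalIntegral.integral_congr fun t _ => ?_
    simp only [hL, f, g, powerKernel, smul_smul]
    congr 1
    have : Real.exp (-μ * x) = Real.exp (-μ * (x - t)) * Real.exp (-μ * t) := by
      rw [← Real.exp_add]; congr 1; ring
    rw [this, sub_sub_cancel_left]
    ring
  have h2 := integral_posConvolution hv.1 hg Lc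
  have h3 : IntegrableOn (posConvolution f g Lc) (Ioi 0) :=
    (integrable_posConvolution hv.1 hg Lc).integrableOn
  refine ⟨h3.congr_fun (fun x hx => ?_) measurableSet_Ioi, ?_⟩
  · rw [posConvolution, indicator_of_mem hx, e]
  · simp only [← e]
    rw [h2, hL, hv.2, hgz, Complex.real_smul]

/-- `v` is continuous on `(0, ∞)` with at most a power singularity of exponent `α - 1` at `0`. -/
structure PowerBounded (α : ℝ) (v : ℝ → ℂ) : Prop where
  continuousOn : ContinuousOn v (Ioi 0)
  bound : ∀ T, 0 < T → ∃ B, 0 ≤ B ∧ ∀ t, 0 < t → t ≤ T → ‖v t‖ ≤ B * t ^ (α - 1)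

lemma intervalIntegrable_beta {α ν t : ℝ} (hα : 0 < α) (hα1 : α ≤ 1) (hν : 0 ≤ ν) (hν1 : ν < 1)
    (ht : 0 < t) :
    IntervalIntegrable (fun s : ℝ => (t - s) ^ (-ν) * s ^ (α - 1)) volume 0 t := by
  have h1 : IntervalIntegrable (fun s : ℝ => s ^ (α - 1)) volume 0 t :=
    intervalIntegral.intervalIntegrable_rpow' (by linarith)
  have h2 : IntervalIntegrable (fun s : ℝ => (t - s) ^ (-ν)) volume 0 t := by
    have := (intervalIntegral.intervalIntegrable_rpow' (a := 0) (b := t) (r := -ν)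
      (by linarith)).comp_sub_left t
    simpa using this.symm
  refine ((h1.const_mul ((t / 2) ^ (-ν))).add (h2.const_mul ((t / 2) ^ (α - 1)))).mono_fun'
    (Measurable.aestronglyMeasurable (by fun_prop)) ?_
  rw [uIoc_of_le ht.le, ← restrict_Ioo_eq_restrict_Ioc]
  filter_upwards [ae_restrict_mem measurableSet_Ioo] with s hs
  have hs0 : 0 < s := hs.1
  have hs1 : 0 < t - s := sub_pos.2 hs.2
  rw [Real.norm_of_nonneg (by positivity)]
  have p1 : 0 ≤ (t - s) ^ (-ν) := by positivity
  have p2 : 0 ≤ s ^ (α - 1) := by positivity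
  rcases le_total s (t / 2) with h | h
  · have : (t - s) ^ (-ν) ≤ (t / 2) ^ (-ν) :=
      Real.rpow_le_rpow_of_nonpos (by linarith) (by linarith) (by linarith)
    have h4 : 0 ≤ (t / 2) ^ (α - 1) * (t - s) ^ (-ν) := by positivity
    nlinarith [mul_le_mul_of_nonneg_right this p2]
  · have : s ^ (α - 1) ≤ (t / 2) ^ (α - 1) :=
      Real.rpow_le_rpow_of_nonpos (by linarith) h (by linarith)
    have h4 : 0 ≤ (t / 2) ^ (-ν) * s ^ (α - 1) := by positivity
    nlinarith [mul_le_mul_of_nonneg_right this p1]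

namespace PowerBounded

variable {α ν : ℝ} {v : ℝ → ℂ}

lemma aestronglyMeasurable (hv : PowerBounded α v) (t : ℝ) :
    AEStronglyMeasurable v (volume.restrict (Ioo 0 t)) :=
  (hv.continuousOn.aestronglyMeasurable measurableSet_Ioi).mono_measure
    (Measure.restrict_mono Ioo_subset_Ioi_self le_rfl)

lemma intervalIntegrable_kernel (hα : 0 < α) (hα1 : α ≤ 1) (hν : 0 ≤ ν) (hν1 : ν < 1)
    (hv : PowerBounded α v) {t : ℝ} (ht : 0 < t) :
    IntervalIntegrable (fun s => (t - s) ^ (-ν) • v s) volume 0 t := by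
  obtain ⟨B, hB0, hB⟩ := hv.bound t ht
  refine ((intervalIntegrable_beta hα hα1 hν hν1 ht).const_mul B).mono_fun' ?_ ?_
  · rw [uIoc_of_le ht.le, ← restrict_Ioo_eq_restrict_Ioc]
    have hk : Measurable fun s : ℝ => (t - s) ^ (-ν) := by fun_prop
    exact hk.aestronglyMeasurable.smul (hv.aestronglyMeasurable t)
  · rw [uIoc_of_le ht.le, ← restrict_Ioo_eq_restrict_Ioc]
    filter_upwards [ae_restrict_mem measurableSet_Ioo] with s hs
    have p : 0 ≤ (t - s) ^ (-ν) := Real.rpow_nonneg (sub_nonneg.2 hs.2.le) _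
    rw [norm_smul, Real.norm_of_nonneg p]
    calc _ ≤ (t - s) ^ (-ν) * (B * s ^ (α - 1)) :=
          mul_le_mul_of_nonneg_left (hB s hs.1 hs.2.le) p
      _ = _ := by ring

lemma intervalIntegrable (hα : 0 < α) (hα1 : α ≤ 1) (hv : PowerBounded α v) {t : ℝ} (ht : 0 < t) :
    IntervalIntegrable v volume 0 t := by
  simpa using hv.intervalIntegrable_kernel hα hα1 le_rfl one_pos ht

/-- The substitution `s = t x` moves the dependence on `t` from the limits of integration into the
integrand, which a beta density dominates. -/
lemma continuousOn_caputoIntegral (hα : 0 < α) (hα1 : α ≤ 1) (hν : 0 ≤ ν) (hν1 : ν ≤ 1)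
    (hv : PowerBounded α v) : ContinuousOn (caputoIntegral ν v) (Ioi 0) := by
  rcases eq_or_ne ν 1 with rfl | h1
  · simpa using hv.continuousOn
  have hν1 : ν < 1 := lt_of_le_of_ne hν1 h1
  have e : ∀ t ∈ Ioi (0 : ℝ), caputoIntegral ν v t = (Real.Gamma (1 - ν))⁻¹ •
      t • ∫ x in (0 : ℝ)..1, (t - t * x) ^ (-ν) • v (t * x) := by
    intro t _
    have := intervalIntegral.smul_integral_comp_mul_left (a := 0) (b := 1)
      (fun s => (t - s) ^ (-ν) • v s) t
    rw [mul_zero, mul_one] at this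
    rw [caputoIntegral, if_neg h1, this]
  refine ContinuousOn.congr ?_ e
  suffices hI : ContinuousOn
      (fun t => ∫ x in (0 : ℝ)..1, (t - t * x) ^ (-ν) • v (t * x)) (Ioi 0) from
    (continuousOn_id.smul hI).const_smul (Real.Gamma (1 - ν))⁻¹
  intro t₀ ht₀
  have ht₀ : 0 < t₀ := ht₀
  refine ContinuousAt.continuousWithinAt ?_
  obtain ⟨B, hB0, hB⟩ := hv.bound (2 * t₀) (by linarith)
  have hnear : ∀ᶠ t in 𝓝 t₀, t ∈ Ioo (t₀ / 2) (2 * t₀) :=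
    Ioo_mem_nhds (by linarith) (by linarith)
  refine intervalIntegral.continuousAt_of_dominated_interval
    (bound := fun x => (t₀ / 2) ^ (-ν) * (B * (t₀ / 2) ^ (α - 1)) *
      ((1 - x) ^ (-ν) * x ^ (α - 1))) ?_ ?_
    ((intervalIntegrable_beta hα hα1 hν hν1 one_pos).const_mul _) ?_
  · filter_upwards [hnear] with t ht
    have ht0 : 0 < t := lt_trans (by linarith) ht.1
    rw [uIoc_of_le zero_le_one, ← restrict_Ioo_eq_restrict_Ioc]
    have hk : Measurable fun x : ℝ => (t - t * x) ^ (-ν) := by fun_prop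
    refine hk.aestronglyMeasurable.smul ?_
    refine ContinuousOn.aestronglyMeasurable ?_ measurableSet_Ioo
    exact hv.continuousOn.comp (by fun_prop) fun x hx => mul_pos ht0 hx.1
  · filter_upwards [hnear] with t ht
    have ht0 : 0 < t := lt_trans (by linarith) ht.1
    rw [uIoc_of_le zero_le_one]
    filter_upwards [Measure.ae_ne volume (1 : ℝ)] with x hx1 hx
    have hx0 : 0 < x := hx.1
    have hx2 : 0 < 1 - x := sub_pos.2 (lt_of_le_of_ne hx.2 hx1)
    have q1 : t - t * x = t * (1 - x) := by ring
    rw [q1, Real.mul_rpow ht0.le hx2.le, norm_smul, Real.norm_of_nonneg (by positivity)]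
    have q2 : t ^ (-ν) ≤ (t₀ / 2) ^ (-ν) :=
      Real.rpow_le_rpow_of_nonpos (by linarith) ht.1.le (by linarith)
    have q3 : ‖v (t * x)‖ ≤ B * ((t₀ / 2) ^ (α - 1) * x ^ (α - 1)) := by
      refine (hB (t * x) (by positivity)
        ((mul_le_of_le_one_right ht0.le hx.2).trans ht.2.le)).trans ?_
      rw [Real.mul_rpow ht0.le hx0.le]
      have : t ^ (α - 1) ≤ (t₀ / 2) ^ (α - 1) :=
        Real.rpow_le_rpow_of_nonpos (by linarith) ht.1.le (by linarith)
      gcongr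
    calc _ ≤ (t₀ / 2) ^ (-ν) * (1 - x) ^ (-ν) * (B * ((t₀ / 2) ^ (α - 1) * x ^ (α - 1))) := by
          gcongr
      _ = _ := by ring
  · rw [uIoc_of_le zero_le_one]
    filter_upwards [Measure.ae_ne volume (1 : ℝ)] with x hx1 hx
    have hx0 : 0 < x := hx.1
    have hx2 : 0 < 1 - x := sub_pos.2 (lt_of_le_of_ne hx.2 hx1)
    have q1 : t₀ - t₀ * x ≠ 0 := by
      have : 0 < t₀ * (1 - x) := by positivity
      have e : t₀ - t₀ * x = t₀ * (1 - x) := by ring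
      rw [e]; exact this.ne'
    have c1 : ContinuousAt (fun t : ℝ => (t - t * x) ^ (-ν)) t₀ :=
      ContinuousAt.rpow_const (by fun_prop) (Or.inl q1)
    have c2 : ContinuousAt (fun t : ℝ => v (t * x)) t₀ :=
      ContinuousAt.comp (f := fun t => t * x)
        (hv.continuousOn.continuousAt (Ioi_mem_nhds (show 0 < t₀ * x by positivity)))
        (by fun_prop)
    exact c1.smul c2

end PowerBounded

lemma PowerBounded.of_bounded {v : ℝ → ℂ} (hc : ContinuousOn v (Ioi 0))
    (hb : ∀ T, 0 < T → ∃ B, ∀ t, 0 < t → t ≤ T → ‖v t‖ ≤ B) : PowerBounded 1 v := by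
  refine ⟨hc, fun T hT => ?_⟩
  obtain ⟨B, hB⟩ := hb T hT
  refine ⟨B, (norm_nonneg _).trans (hB T hT le_rfl), fun t ht htT => ?_⟩
  simpa using hB t ht htT

lemma continuousOn_primitive_Ici {E : Type*} [NormedAddCommGroup E] [NormedSpace ℝ E] {v : ℝ → E}
    (hv : ∀ T, 0 < T → IntervalIntegrable v volume 0 T) :
    ContinuousOn (fun t => ∫ s in (0 : ℝ)..t, v s) (Ici 0) := by
  intro t ht
  have ht : 0 ≤ t := ht
  have h := intervalIntegral.continuousOn_primitive_interval (μ := volume)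
    ((intervalIntegrable_iff' (by simp)).1 (hv (t + 1) (by linarith)))
  rw [uIcc_of_le (by linarith)] at h
  exact (h t ⟨ht, by linarith⟩).mono_of_mem_nhdsWithin
    (mem_nhdsWithin.2 ⟨Iio (t + 1), isOpen_Iio, by simp, fun x hx => ⟨hx.2, le_of_lt hx.1⟩⟩)

lemma PowerBounded.primitive {v : ℝ → ℂ} (hv : ∀ T, 0 < T → IntervalIntegrable v volume 0 T) :
    PowerBounded 1 (fun t => ∫ s in (0 : ℝ)..t, v s) := by
  have hcont := continuousOn_primitive_Ici hv
  refine PowerBounded.of_bounded (hcont.mono Ioi_subset_Ici_self) fun T hT => ?_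
  obtain ⟨B, hB⟩ := isCompact_Icc.exists_bound_of_continuousOn
    (hcont.mono fun x (hx : x ∈ Icc 0 T) => hx.1)
  exact ⟨B, fun t h0 h1 => hB t ⟨h0.le, h1⟩⟩

/-- `caputoIntegral ν` preserves local integrability and commutes with taking primitives. Since
everything on `(0, T)` only depends on `v` on `(0, T)`, truncated functions, which have Laplace
transforms, may be considered; then it suffices to compare these. -/
lemma integral_caputoIntegral {ν : ℝ} (hν : 0 ≤ ν) (hν1 : ν ≤ 1) {v : ℝ → ℂ}
    (hv : ∀ T, 0 < T → IntervalIntegrable v volume 0 T) {T : ℝ} (hT : 0 < T) :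
    IntervalIntegrable (caputoIntegral ν v) volume 0 T ∧
    ∫ t in (0 : ℝ)..T, caputoIntegral ν v t
      = caputoIntegral ν (fun t => ∫ s in (0 : ℝ)..t, v s) T := by
  set w : ℝ → ℂ := (Ioc 0 T).indicator v with hw
  have hwv : ∀ s, 0 < s → s ≤ T → v s = w s := fun s h0 h1 => by
    rw [hw, indicator_of_mem (show s ∈ Ioc 0 T from ⟨h0, h1⟩)]
  have hwi : Integrable w := by
    rw [hw, integrable_indicator_iff measurableSet_Ioc,
      ← intervalIntegrable_iff_integrableOn_Ioc_of_le hT.le]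
    exact hv T hT
  have hwL : ∀ μ : ℝ, 1 ≤ μ → HasLaplace w μ (∫ t in Ioi (0 : ℝ), Real.exp (-μ * t) • w t) := by
    refine fun μ hμ => ⟨?_, rfl⟩
    have hE : Continuous fun t : ℝ => Real.exp (-μ * t) := by fun_prop
    refine hwi.integrableOn.bdd_smul 1 hE.aestronglyMeasurable ?_
    filter_upwards [ae_restrict_mem measurableSet_Ioi] with t ht
    rw [Real.norm_of_nonneg (Real.exp_pos _).le, Real.exp_le_one_iff]
    have : 0 < t := ht
    nlinarith
  have hK : ∀ S, 0 < S → IntervalIntegrable (caputoIntegral ν w) volume 0 S := by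
    intro S hS
    have h1 := ((hwL 1 le_rfl).caputoIntegral hν1 one_pos).1
    have h2 : IntervalIntegrable (fun t => Real.exp (-1 * t) • caputoIntegral ν w t)
        volume 0 S := by
      rw [intervalIntegrable_iff_integrableOn_Ioc_of_le hS.le]
      exact h1.mono_set Ioc_subset_Ioi_self
    have h3 := h2.continuousOn_smul (f := fun t => Real.exp t) (by fun_prop)
    refine h3.congr fun t _ => ?_
    simp only [smul_smul, ← Real.exp_add]
    simp
  have hLeft : ∀ μ : ℝ, 1 ≤ μ → HasLaplace (fun t => ∫ s in (0 : ℝ)..t, caputoIntegral ν w s) μ _ :=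
    fun μ hμ => (((hwL μ hμ).caputoIntegral hν1 (by linarith)).caputoIntegral (ν := 0)
      zero_le_one (by linarith)).congr fun t _ => caputoIntegral_zero _ _
  have hRight : ∀ μ : ℝ, 1 ≤ μ →
      HasLaplace (caputoIntegral ν (fun t => ∫ s in (0 : ℝ)..t, w s)) μ _ :=
    fun μ hμ => (((hwL μ hμ).caputoIntegral (ν := 0) zero_le_one (by linarith)).congr
      fun t _ => caputoIntegral_zero _ _).caputoIntegral hν1 (by linarith)
  have h := eqOn_of_hasLaplace hLeft
    (fun μ hμ => by
      have := hRight μ hμ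
      rwa [mul_left_comm] at this)
    (PowerBounded.primitive hK).continuousOn
    ((PowerBounded.primitive fun S _ => hwi.intervalIntegrable).continuousOn_caputoIntegral
      one_pos le_rfl hν hν1) hT
  simp only at h
  have e0 : ∀ t, 0 < t → t ≤ T → caputoIntegral ν v t = caputoIntegral ν w t := fun t ht htT =>
    caputoIntegral_congr ht fun s h0 h1 => hwv s h0 (h1.trans htT)
  have e1 : ∫ t in (0 : ℝ)..T, caputoIntegral ν v t = ∫ t in (0 : ℝ)..T, caputoIntegral ν w t := by
    refine intervalIntegral.integral_congr_uIoo fun t ht => ?_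
    rw [uIoo_of_le hT.le] at ht
    exact e0 t ht.1 ht.2.le
  refine ⟨(hK T hT).congr fun t ht => ?_, ?_⟩
  · rw [uIoc_of_le hT.le] at ht
    exact (e0 t ht.1 ht.2).symm
  rw [e1, h]
  refine caputoIntegral_congr hT fun t h0 h1 => ?_
  refine intervalIntegral.integral_congr_uIoo fun s hs => ?_
  rw [uIoo_of_le h0.le] at hs
  exact (hwv s hs.1 (hs.2.le.trans h1)).symm

/-! ### Right-continuous processes at random times -/

/-- The point of the grid of mesh `1 / (k + 1)` that lies strictly to the right of `s`. -/
def rightApprox (k : ℕ) (s : ℝ≥0) : ℝ≥0 := ((⌊s * (k + 1)⌋₊ : ℝ≥0) + 1) / (k + 1)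

lemma le_rightApprox (k : ℕ) (s : ℝ≥0) : s ≤ rightApprox k s := by
  rw [rightApprox, le_div_iff₀ (by positivity)]
  exact (Nat.lt_floor_add_one _).le

lemma rightApprox_le (k : ℕ) (s : ℝ≥0) : rightApprox k s ≤ s + 1 / (k + 1) := by
  have h : (⌊s * (k + 1)⌋₊ : ℝ≥0) ≤ s * (k + 1) := Nat.floor_le (by positivity)
  rw [rightApprox, add_div]
  gcongr
  rwa [div_le_iff₀ (by positivity)]

lemma tendsto_rightApprox (s : ℝ≥0) : Tendsto (fun k => rightApprox k s) atTop (𝓝 s) := by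
  have h : Tendsto (fun k : ℕ => s + 1 / ((k : ℝ≥0) + 1)) atTop (𝓝 (s + 0)) :=
    tendsto_const_nhds.add tendsto_one_div_add_atTop_nhds_zero_nat
  rw [add_zero] at h
  exact tendsto_of_tendsto_of_tendsto_of_le_of_le tendsto_const_nhds h
    (fun k => le_rightApprox k s) fun k => rightApprox_le k s

lemma measurable_rightApprox (k : ℕ) : Measurable (rightApprox k) := by
  unfold rightApprox
  have : Measurable fun s : ℝ≥0 => ((⌊s * (k + 1)⌋₊ : ℕ) : ℝ≥0) :=
    measurable_from_nat.comp (Nat.measurable_floor.comp (by fun_prop))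
  fun_prop

/-- The right approximations of the time take countably many values, whence the measurability. -/
lemma measurable_comp_rightApprox {Ω E : Type*} [MeasurableSpace Ω] [MeasurableSpace E]
    {X : ℝ≥0 → Ω → E} (hX : ∀ t, Measurable (X t)) (k : ℕ) :
    Measurable fun p : ℝ≥0 × Ω => X (rightApprox k p.1) p.2 := by
  obtain ⟨g, hg⟩ : ∃ g : ℕ → ℝ≥0, ∀ s, rightApprox k s = g ⌊s * (k + 1)⌋₊ :=
    ⟨fun n => (n + 1) / (k + 1), fun s => rfl⟩
  simp only [hg]
  have h1 : Measurable fun q : ℕ × Ω => X (g q.1) q.2 :=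
    measurable_from_prod_countable_right fun n => hX (g n)
  have h2 : Measurable fun p : ℝ≥0 × Ω => (⌊p.1 * (k + 1)⌋₊, p.2) :=
    (Nat.measurable_floor.comp (by fun_prop)).prodMk measurable_snd
  exact h1.comp h2

lemma tendsto_comp_rightApprox {E : Type*} [TopologicalSpace E] {x : ℝ≥0 → E} {s : ℝ≥0}
    (h : ContinuousWithinAt x (Ici s) s) :
    Tendsto (fun k => x (rightApprox k s)) atTop (𝓝 (x s)) :=
  h.tendsto.comp (tendsto_nhdsWithin_iff.2
    ⟨tendsto_rightApprox s, Eventually.of_forall fun k => le_rightApprox k s⟩)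

section Subordination

variable {Ω : Type*} [MeasurableSpace Ω] {P : Measure Ω}
  {n : ℕ} {S : ℝ≥0 → Ω → EuclideanSpace ℝ (Fin n)} {T : Ω → ℝ≥0}

/-- A process with right-continuous paths, evaluated at a random time. -/
lemma aemeasurable_comp_time (hX : ∀ t, Measurable (S t))
    (hc : ∀ᵐ ω ∂P, ∀ t, ContinuousWithinAt (fun s => S s ω) (Ici t) t) (hT : Measurable T) :
    AEMeasurable (fun ω => S (T ω) ω) P := by
  refine aemeasurable_of_tendsto_metrizable_ae' (f := fun k ω => S (rightApprox k (T ω)) ω)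
    (fun k => ((measurable_comp_rightApprox hX k).comp (hT.prodMk measurable_id)).aemeasurable) ?_
  filter_upwards [hc] with ω h using tendsto_comp_rightApprox (h (T ω))

/-- Conditioning on an independent random time: the characteristic function of `S(T)` is the mean
of that of `S` at the time `T`. -/
lemma charFun_comp_time [IsProbabilityMeasure P] (hX : ∀ t, Measurable (S t))
    (hc : ∀ᵐ ω ∂P, ∀ t, ContinuousWithinAt (fun s => S s ω) (Ici t) t) (hT : Measurable T)
    (hi : IndepFun (fun ω s => S s ω) T P) {ξ : EuclideanSpace ℝ (Fin n)} {a : ℝ} (ha : 0 ≤ a)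
    (hchar : ∀ t : ℝ≥0, charFun (P.map (S t)) ξ = Real.exp (-(t : ℝ) * a)) :
    charFun (P.map (fun ω => S (T ω) ω)) ξ = ((∫ ω, Real.exp (-(T ω : ℝ) * a) ∂P : ℝ) : ℂ) := by
  set e : EuclideanSpace ℝ (Fin n) → ℂ := fun x => Complex.exp (inner ℝ x ξ * Complex.I)
  have he : Continuous e := by fun_prop
  have hen : ∀ x, ‖e x‖ = 1 := fun x => Complex.norm_exp_ofReal_mul_I _
  have hpath : Measurable fun ω s => S s ω := measurable_pi_lambda _ hX
  have hstep : ∀ k, ∫ ω, e (S (rightApprox k (T ω)) ω) ∂P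
      = ∫ ω, (Real.exp (-(rightApprox k (T ω) : ℝ) * a) : ℂ) ∂P := by
    intro k
    set G : (ℝ≥0 → EuclideanSpace ℝ (Fin n)) × ℝ≥0 → ℂ := fun p => e (p.1 (rightApprox k p.2))
    have hG : Measurable G := by
      have := (measurable_comp_rightApprox (X := fun s (x : ℝ≥0 → EuclideanSpace ℝ (Fin n)) => x s)
        (fun s => measurable_pi_apply s) k).comp measurable_swap
      exact he.measurable.comp this
    have hpair : Measurable fun ω => ((fun s => S s ω), T ω) := hpath.prodMk hT
    have h1 : ∫ ω, e (S (rightApprox k (T ω)) ω) ∂P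
        = ∫ p, G p ∂(P.map fun ω => ((fun s => S s ω), T ω)) := by
      rw [integral_map hpair.aemeasurable hG.aestronglyMeasurable]
    have := Measure.isProbabilityMeasure_map (μ := P) hpath.aemeasurable
    have := Measure.isProbabilityMeasure_map (μ := P) hT.aemeasurable
    rw [h1, (indepFun_iff_map_prod_eq_prod_map_map hpath.aemeasurable hT.aemeasurable).1 hi,
      integral_prod_symm]
    · have h2 : ∀ t : ℝ≥0, ∫ x, G (x, t) ∂(P.map fun ω s => S s ω)
          = (Real.exp (-(rightApprox k t : ℝ) * a) : ℂ) := by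
        intro t
        have hGt : Measurable fun x => G (x, t) := hG.comp measurable_prodMk_right
        rw [← hchar, charFun_apply, integral_map hpath.aemeasurable hGt.aestronglyMeasurable,
          integral_map (hX _).aemeasurable he.aestronglyMeasurable]
      simp only [h2]
      rw [integral_map hT.aemeasurable]
      have := measurable_rightApprox k
      exact Measurable.aestronglyMeasurable (by fun_prop)
    · exact Integrable.of_bound hG.aestronglyMeasurable 1 (ae_of_all _ fun p => (hen _).le)
  have hl : Tendsto (fun k => ∫ ω, e (S (rightApprox k (T ω)) ω) ∂P) atTop
      (𝓝 (∫ ω, e (S (T ω) ω) ∂P)) := by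
    refine tendsto_integral_of_dominated_convergence (fun _ => 1) (fun k => ?_)
      (integrable_const _) (fun k => ae_of_all _ fun ω => (hen _).le) ?_
    · exact (he.measurable.comp ((measurable_comp_rightApprox hX k).comp
        (hT.prodMk measurable_id))).aestronglyMeasurable
    · filter_upwards [hc] with ω h
      exact (he.tendsto _).comp (tendsto_comp_rightApprox (h (T ω)))
  have hr : Tendsto (fun k => ∫ ω, (Real.exp (-(rightApprox k (T ω) : ℝ) * a) : ℂ) ∂P) atTop
      (𝓝 (∫ ω, (Real.exp (-(T ω : ℝ) * a) : ℂ) ∂P)) := by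
    refine tendsto_integral_of_dominated_convergence (fun _ => 1) (fun k => ?_)
      (integrable_const _) (fun k => ae_of_all _ fun ω => ?_) (ae_of_all _ fun ω => ?_)
    · have := (measurable_rightApprox k).comp hT
      have h2 : Measurable fun ω => rightApprox k (T ω) := this
      exact Measurable.aestronglyMeasurable (by fun_prop)
    · rw [Complex.norm_real, Real.norm_of_nonneg (Real.exp_pos _).le, Real.exp_le_one_iff]
      have := (rightApprox k (T ω)).2
      exact mul_nonpos_of_nonpos_of_nonneg (neg_nonpos.2 this) ha
    · have : Continuous fun s : ℝ≥0 => (Real.exp (-(s : ℝ) * a) : ℂ) := by fun_prop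
      exact (this.tendsto _).comp (tendsto_rightApprox (T ω))
  simp only [hstep] at hl
  have := tendsto_nhds_unique hl hr
  rw [charFun_apply, integral_map (aemeasurable_comp_time hX hc hT) he.aestronglyMeasurable]
  exact this.trans integral_ofReal

end Subordination

/-! ### Subordinators and their hitting times -/

/-- `A` has nondecreasing, right-continuous paths from `0` and the Laplace exponent `f`, that is
`𝔼 exp (-μ A(s)) = exp (-s f(μ))`. Since `f > 0`, the paths are unbounded. Independence of the
increments is not required: the law of a hitting time only involves the one-dimensional laws. -/
structure IsSubordinatorWith {Ω : Type*} [MeasurableSpace Ω] (f : ℝ → ℝ) (A : ℝ≥0 → Ω → ℝ)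
    (P : Measure Ω) : Prop where
  measurable : ∀ s, Measurable (A s)
  path : ∀ᵐ ω ∂P, Monotone (fun s => A s ω) ∧ A 0 ω = 0 ∧
    ∀ s, ContinuousWithinAt (fun s => A s ω) (Ici s) s
  exponent_pos : ∀ μ, 0 < μ → 0 < f μ
  laplace : ∀ (s : ℝ≥0) (μ : ℝ), 0 < μ →
    ∫ ω, Real.exp (-μ * A s ω) ∂P = Real.exp (-(s : ℝ) * f μ)

/-- The first positive time from which on the path `a` is at least `t`. It is the infimum `0` of the
empty set if `a` stays below `t`. -/
def hittingTime (t : ℝ) (a : ℝ≥0 → ℝ) : ℝ≥0 := sInf {s : ℝ≥0 | 0 < s ∧ t ≤ a s}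

/-- The hitting time computed along rational times only, a measurable function of the path. -/
def ratHittingTime (t : ℝ) (a : ℝ≥0 → ℝ) : ℝ≥0 :=
  (⨅ q : ℚ, if 0 < Real.toNNReal q ∧ t ≤ a (Real.toNNReal q) then (Real.toNNReal q : ENNReal)
    else ⊤).toNNReal

lemma measurable_ratHittingTime (t : ℝ) : Measurable (ratHittingTime t) := by
  refine ENNReal.measurable_toNNReal.comp (Measurable.iInf fun q => ?_)
  refine Measurable.ite ?_ measurable_const measurable_const
  exact (MeasurableSet.const _).inter (measurableSet_le measurable_const (measurable_pi_apply _))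

lemma ratHittingTime_eq {t : ℝ} {a : ℝ≥0 → ℝ} (ha : Monotone a) (hne : ∃ s, 0 < s ∧ t ≤ a s) :
    ratHittingTime t a = hittingTime t a := by
  have : (⨅ q : ℚ, if 0 < Real.toNNReal q ∧ t ≤ a (Real.toNNReal q)
      then (Real.toNNReal q : ENNReal) else ⊤) = (hittingTime t a : ENNReal) := by
    refine le_antisymm (ENNReal.le_of_forall_pos_le_add fun ε hε _ => ?_) (le_iInf fun q => ?_)
    · obtain ⟨s, hs, hsl⟩ := exists_lt_of_csInf_lt (s := {s : ℝ≥0 | 0 < s ∧ t ≤ a s}) hne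
        (show hittingTime t a < hittingTime t a + ε from lt_add_of_pos_right _ hε)
      obtain ⟨q, -, hq1, hq2⟩ := (NNReal.lt_iff_exists_rat_btwn _ _).1 hsl
      refine iInf_le_of_le q ?_
      rw [if_pos ⟨hs.1.trans hq1, hs.2.trans (ha hq1.le)⟩]
      exact_mod_cast hq2.le
    · split_ifs with h
      · exact ENNReal.coe_le_coe.2 (csInf_le (OrderBot.bddBelow _) h)
      · exact le_top
  rw [ratHittingTime, this, ENNReal.toNNReal_coe]

/-- Right-continuity excludes that `a` is below `t` at the hitting time itself. -/
lemma lt_hittingTime_iff {t : ℝ} {a : ℝ≥0 → ℝ} (ha : Monotone a)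
    (hc : ∀ s, ContinuousWithinAt a (Ici s) s) (hne : ∃ s, 0 < s ∧ t ≤ a s) {s : ℝ≥0}
    (hs : 0 < s) : s < hittingTime t a ↔ a s < t := by
  constructor
  · intro h
    by_contra! h'
    exact absurd (csInf_le (OrderBot.bddBelow _) 
      (show s ∈ {s : ℝ≥0 | 0 < s ∧ t ≤ a s} from ⟨hs, h'⟩)) (not_le.2 h)
  · intro h
    have h1 : ∀ᶠ k in atTop, a (s + 1 / ((k : ℕ) + 1)) < t := by
      have ht : Tendsto (fun k : ℕ => s + 1 / ((k : ℝ≥0) + 1)) atTop (𝓝[≥] s) := by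
        refine tendsto_nhdsWithin_iff.2 ⟨?_, Eventually.of_forall fun k => by simp⟩
        simpa using (tendsto_const_nhds (x := s)).add
          (tendsto_one_div_add_atTop_nhds_zero_nat (𝕜 := ℝ≥0))
      exact ((hc s).tendsto.comp ht).eventually (gt_mem_nhds h)
    obtain ⟨k, hk⟩ := h1.exists
    have hlt : s < s + 1 / ((k : ℝ≥0) + 1) := lt_add_of_pos_right _ (by positivity)
    refine hlt.trans_le (le_csInf hne fun b hb => ?_)
    by_contra! hlt'
    exact absurd (hb.2.trans (ha hlt'.le)) (not_le.2 hk)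

namespace IsSubordinatorWith

variable {Ω : Type*} [MeasurableSpace Ω] {f : ℝ → ℝ} {A : ℝ≥0 → Ω → ℝ} {P : Measure Ω}

lemma measurableSet_lt (hA : IsSubordinatorWith f A P) (s : ℝ≥0) (t : ℝ) :
    MeasurableSet {ω | A s ω < t} := _root_.measurableSet_lt (hA.measurable s) measurable_const

lemma measurable_rat (hA : IsSubordinatorWith f A P) (t : ℝ) :
    Measurable fun ω => ratHittingTime t (fun s => A s ω) :=
  (measurable_ratHittingTime t).comp (measurable_pi_lambda _ hA.measurable)

lemma monotone_real_lt [IsFiniteMeasure P] (s : ℝ≥0) : Monotone fun t => P.real {ω | A s ω < t} :=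
  fun _ _ h => measureReal_mono fun _ (h' : _ < _) => h'.trans_le h

lemma nonneg (hA : IsSubordinatorWith f A P) : ∀ᵐ ω ∂P, ∀ s, 0 ≤ A s ω := by
  filter_upwards [hA.path] with ω h s
  rw [← h.2.1]
  exact h.1 zero_le

variable [IsProbabilityMeasure P]

lemma integrable_exp (hA : IsSubordinatorWith f A P) {μ : ℝ} (hμ : 0 ≤ μ) (s : ℝ≥0) :
    Integrable (fun ω => Real.exp (-μ * A s ω)) P := by
  have := hA.measurable s
  have hm : Measurable fun ω => Real.exp (-μ * A s ω) := by fun_prop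
  refine Integrable.of_bound hm.aestronglyMeasurable 1 ?_
  filter_upwards [hA.nonneg] with ω h
  rw [Real.norm_of_nonneg (Real.exp_pos _).le, Real.exp_le_one_iff]
  have := mul_nonneg hμ (h s)
  linarith

/-- The Chernoff bound for the distribution function. -/
lemma real_lt_le (hA : IsSubordinatorWith f A P) (s : ℝ≥0) (t : ℝ) :
    P.real {ω | A s ω < t} ≤ Real.exp t * Real.exp (-(s : ℝ) * f 1) := by
  rw [← hA.laplace s 1 one_pos, ← integral_const_mul,
    ← integral_indicator_one (hA.measurableSet_lt s t)]
  refine integral_mono ((integrable_const (1 : ℝ)).indicator (hA.measurableSet_lt s t))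
    ((hA.integrable_exp zero_le_one s).const_mul _) fun ω => ?_
  simp only [← Real.exp_add]
  by_cases h : A s ω < t
  · rw [indicator_of_mem (show ω ∈ {ω | A s ω < t} from h), Pi.one_apply, Real.one_le_exp_iff]
    linarith
  · rw [indicator_of_notMem (show ω ∉ {ω | A s ω < t} from h)]
    exact (Real.exp_pos _).le

/-- The paths are unbounded, as their distribution functions tend to `0` by the Chernoff bound. -/
lemma ae_exists_le (hA : IsSubordinatorWith f A P) : ∀ᵐ ω ∂P, ∀ t : ℝ, ∃ s, 0 < s ∧ t ≤ A s ω := by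
  have h : ∀ N : ℕ, ∀ᵐ ω ∂P, ∃ k : ℕ, (N : ℝ) ≤ A (k + 1) ω := by
    intro N
    rw [ae_iff]
    push Not
    rw [← measureReal_eq_zero_iff]
    refine le_antisymm (ge_of_tendsto' (f := fun k : ℕ => Real.exp N *
      Real.exp (-((k : ℝ) + 1) * f 1)) (x := atTop) ?_ fun k => ?_) measureReal_nonneg
    · rw [← mul_zero (Real.exp N)]
      refine Tendsto.const_mul _ (Real.tendsto_exp_atBot.comp ?_)
      have h1 : Tendsto (fun k : ℕ => (k : ℝ) + 1) atTop atTop :=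
        tendsto_atTop_add_const_right _ _ tendsto_natCast_atTop_atTop
      have h2 := (tendsto_neg_atTop_atBot.comp h1).atBot_mul_const (hA.exponent_pos 1 one_pos)
      exact h2
    · have h1 := hA.real_lt_le ((k : ℝ≥0) + 1) N
      push_cast at h1
      exact (measureReal_mono (fun ω (hω : ∀ k : ℕ, A (k + 1) ω < N) => hω k)).trans h1
  filter_upwards [ae_all_iff.2 h] with ω hω t
  obtain ⟨N, hN⟩ := exists_nat_ge t
  obtain ⟨k, hk⟩ := hω N
  exact ⟨k + 1, by positivity, hN.trans hk⟩

lemma ae_ratHittingTime_eq (hA : IsSubordinatorWith f A P) (t : ℝ) :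
    ∀ᵐ ω ∂P, ratHittingTime t (fun s => A s ω) = hittingTime t (fun s => A s ω) := by
  filter_upwards [hA.path, hA.ae_exists_le] with ω h h' using ratHittingTime_eq h.1 (h' t)

lemma real_lt_eq (hA : IsSubordinatorWith f A P) (t : ℝ) {s : ℝ≥0} (hs : 0 < s) :
    P.real {ω | s < ratHittingTime t (fun s => A s ω)} = P.real {ω | A s ω < t} := by
  refine measureReal_congr ?_
  filter_upwards [hA.path, hA.ae_exists_le, hA.ae_ratHittingTime_eq t] with ω h h' h''
  refine propext ?_
  change s < ratHittingTime t (fun s => A s ω) ↔ A s ω < t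
  rw [h'']
  exact lt_hittingTime_iff h.1 h.2.2 (h' t) hs

/-- Right-continuity of the paths makes the distribution functions jointly measurable. -/
lemma measurable_real_lt (hA : IsSubordinatorWith f A P) :
    Measurable fun p : ℝ≥0 × ℝ => P.real {ω | A p.1 ω < p.2} := by
  refine measurable_of_tendsto_metrizable (f := fun (k : ℕ) (p : ℝ≥0 × ℝ) =>
    P.real {ω | A (rightApprox k p.1) ω < p.2}) (fun k => ?_) (tendsto_pi_nhds.2 fun p => ?_)
  · exact measurable_comp_rightApprox (X := fun s t => P.real {ω | A s ω < t})
      (fun s => (monotone_real_lt s).measurable) k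
  · refine (ENNReal.tendsto_toReal (measure_ne_top _ _)).comp
      (tendsto_measure_of_ae_tendsto_indicator_of_isFiniteMeasure _ (hA.measurableSet_lt _ _)
        (fun k => hA.measurableSet_lt _ _) ?_)
    filter_upwards [hA.path] with ω h
    by_cases hlt : A p.1 ω < p.2
    · filter_upwards [(tendsto_comp_rightApprox (h.2.2 p.1)).eventually (gt_mem_nhds hlt)] with k hk
      exact ⟨fun _ => hlt, fun _ => hk⟩
    · refine Eventually.of_forall fun k => ⟨fun hk => ?_, fun h' => absurd h' hlt⟩
      exact (h.1 (le_rightApprox k p.1)).trans_lt hk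

end IsSubordinatorWith

/-- The discounted time that `A` spends below the level `t`, in the mean:
`∫₀^∞ exp (-κ s) P(A(s) < t) ds`. -/
def potential {Ω : Type*} [MeasurableSpace Ω] (P : Measure Ω) (A : ℝ≥0 → Ω → ℝ) (κ t : ℝ) : ℝ :=
  ∫ s in Ioi (0 : ℝ), Real.exp (-κ * s) * P.real {ω | A s.toNNReal ω < t}

namespace IsSubordinatorWith

variable {Ω : Type*} [MeasurableSpace Ω] {f : ℝ → ℝ} {A : ℝ≥0 → Ω → ℝ} {P : Measure Ω}
  [IsProbabilityMeasure P]

lemma measurable_integrand (hA : IsSubordinatorWith f A P) :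
    Measurable fun q : ℝ × ℝ × ℝ => Real.exp (-q.1 * q.2.1) *
      P.real {ω | A q.2.1.toNNReal ω < q.2.2} := by
  have := hA.measurable_real_lt.comp
    (f := fun q : ℝ × ℝ × ℝ => (q.2.1.toNNReal, q.2.2)) (by fun_prop)
  exact (by fun_prop : Measurable fun q : ℝ × ℝ × ℝ => Real.exp (-q.1 * q.2.1)).mul this

lemma integrableOn_potential (hA : IsSubordinatorWith f A P) {κ : ℝ} (hκ : 0 ≤ κ) (t : ℝ) :
    IntegrableOn (fun s => Real.exp (-κ * s) * P.real {ω | A s.toNNReal ω < t}) (Ioi 0) := by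
  have h1 := (integrableOn_exp_mul_Ioi (a := -f 1)
    (by linarith [hA.exponent_pos 1 one_pos]) 0).const_mul (Real.exp t)
  refine Integrable.mono' h1 ?_ ?_
  · exact (hA.measurable_integrand.comp
      (f := fun s : ℝ => (κ, s, t)) (by fun_prop)).aestronglyMeasurable
  · filter_upwards [ae_restrict_mem measurableSet_Ioi] with s hs
    have hs : 0 < s := hs
    rw [norm_mul, Real.norm_of_nonneg (Real.exp_pos _).le, Real.norm_of_nonneg measureReal_nonneg]
    have h2 := hA.real_lt_le s.toNNReal t
    rw [Real.coe_toNNReal _ hs.le] at h2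
    have h3 : Real.exp (-κ * s) ≤ 1 := by
      rw [Real.exp_le_one_iff]
      nlinarith
    calc _ ≤ 1 * (Real.exp t * Real.exp (-s * f 1)) :=
          mul_le_mul h3 h2 measureReal_nonneg zero_le_one
      _ = _ := by rw [one_mul]; congr 2; ring

lemma potential_of_nonpos (hA : IsSubordinatorWith f A P) (κ : ℝ) {t : ℝ} (ht : t ≤ 0) :
    potential P A κ t = 0 := by
  have h : ∀ s, P.real {ω | A s ω < t} = 0 := fun s => by
    have h0 : ∀ᵐ ω ∂P, ω ∉ {ω | A s ω < t} := by
      filter_upwards [hA.nonneg] with ω h (h' : A s ω < t)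
      linarith [h s]
    rw [measureReal_eq_zero_iff]
    exact measure_eq_zero_iff_ae_notMem.2 h0
  simp [potential, h]

/-- The potential is nondecreasing in `t`, and its increments are largest for `κ = 0`. -/
lemma potential_increment (hA : IsSubordinatorWith f A P) {κ : ℝ} (hκ : 0 ≤ κ) {s t : ℝ}
    (hst : s ≤ t) : 0 ≤ potential P A κ t - potential P A κ s ∧
      potential P A κ t - potential P A κ s ≤ potential P A 0 t - potential P A 0 s := by
  have hF : ∀ x : ℝ, 0 ≤ P.real {ω | A x.toNNReal ω < t} - P.real {ω | A x.toNNReal ω < s} :=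
    fun x => sub_nonneg.2 (monotone_real_lt (P := P) (A := A) x.toNNReal hst)
  unfold potential
  rw [← integral_sub (hA.integrableOn_potential hκ t) (hA.integrableOn_potential hκ s),
    ← integral_sub (hA.integrableOn_potential le_rfl t) (hA.integrableOn_potential le_rfl s)]
  simp only [← mul_sub]
  constructor
  · exact integral_nonneg fun x => mul_nonneg (Real.exp_pos _).le (hF x)
  · refine setIntegral_mono_on ?_ ?_ measurableSet_Ioi fun x hx => ?_
    · simp only [mul_sub]
      exact Integrable.sub (hA.integrableOn_potential hκ t) (hA.integrableOn_potential hκ s)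
    · simp only [mul_sub]
      exact Integrable.sub (hA.integrableOn_potential le_rfl t) (hA.integrableOn_potential le_rfl s)
    · refine mul_le_mul_of_nonneg_right (Real.exp_le_exp.2 ?_) (hF x)
      have hx : 0 < x := hx
      nlinarith

lemma integral_exp_indicator {μ a : ℝ} (hμ : 0 < μ) (ha : 0 ≤ a) :
    ∫ t in Ioi (0 : ℝ), Real.exp (-μ * t) * (Ioi a).indicator 1 t = Real.exp (-μ * a) / μ := by
  have : ∀ t : ℝ, Real.exp (-μ * t) * (Ioi a).indicator 1 t
      = (Ioi a).indicator (fun t => Real.exp (-μ * t)) t := fun t => by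
    by_cases h : t ∈ Ioi a
    · simp [indicator_of_mem h]
    · simp [indicator_of_notMem h]
  simp only [this]
  rw [setIntegral_indicator measurableSet_Ioi, inter_eq_right.2 (Ioi_subset_Ioi ha),
    integral_exp_mul_Ioi (by linarith)]
  field_simp

lemma integral_exp_indicator_Iio {μ a : ℝ} (hμ : 0 < μ) (ha : 0 ≤ a) :
    ∫ t in Ioi (0 : ℝ), Real.exp (-μ * t) * (Iio a).indicator 1 t
      = (1 - Real.exp (-μ * a)) / μ := by
  have h1 : IntegrableOn (fun t => Real.exp (-μ * t)) (Ioi 0) :=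
    integrableOn_exp_mul_Ioi (by linarith) 0
  have e : ∫ t in Ioi (0 : ℝ), Real.exp (-μ * t) * (Iio a).indicator 1 t
      = ∫ t in Ioi (0 : ℝ), (Real.exp (-μ * t) - Real.exp (-μ * t) * (Ioi a).indicator 1 t) := by
    refine integral_congr_ae (ae_restrict_of_ae ?_)
    filter_upwards [Measure.ae_ne volume a] with t hta
    rcases lt_or_gt_of_ne hta with h | h
    · simp [h, h.le]
    · simp [h, h.le]
  have h2 : IntegrableOn (fun t => Real.exp (-μ * t) * (Ioi a).indicator 1 t) (Ioi 0) := by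
    refine (h1.indicator (measurableSet_Ioi (a := a))).congr (ae_of_all _ fun t => ?_)
    by_cases h : t ∈ Ioi a
    · simp [indicator_of_mem h]
    · simp [indicator_of_notMem h]
  rw [e, integral_sub h1 h2, integral_exp_indicator hμ ha, integral_exp_mul_Ioi (by linarith)]
  simp
  field_simp

lemma integral_exp_mul_real {B : Set (ℝ × Ω)} (hB : MeasurableSet B) {μ : ℝ}
    (hμ : 0 < μ) :
    ∫ t in Ioi (0 : ℝ), Real.exp (-μ * t) * P.real {ω | (t, ω) ∈ B}
      = ∫ ω, (∫ t in Ioi (0 : ℝ), Real.exp (-μ * t) * {t | (t, ω) ∈ B}.indicator 1 t) ∂P := by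
  have e : ∀ t : ℝ, Real.exp (-μ * t) * P.real {ω | (t, ω) ∈ B}
      = ∫ ω, Real.exp (-μ * t) * B.indicator 1 (t, ω) ∂P := fun t => by
    rw [integral_const_mul,
      ← integral_indicator_one (s := {ω | (t, ω) ∈ B}) (measurable_prodMk_left hB)]
    rfl
  simp only [e]
  rw [integral_integral_swap (f := fun (t : ℝ) (ω : Ω) => Real.exp (-μ * t) * B.indicator 1 (t, ω))]
  · rfl
  · have h1 : Integrable (fun p : ℝ × Ω => Real.exp (-μ * p.1) * 1)
        ((volume.restrict (Ioi 0)).prod P) :=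
      Integrable.mul_prod (integrableOn_exp_mul_Ioi (by linarith) 0) (integrable_const 1)
    refine h1.mono' ?_ (ae_of_all _ fun p => ?_)
    · have hm : Measurable fun p : ℝ × Ω => Real.exp (-μ * p.1) := by fun_prop
      exact (hm.mul (measurable_one.indicator hB)).aestronglyMeasurable
    · simp only [Function.uncurry]
      rw [norm_mul, Real.norm_of_nonneg (Real.exp_pos _).le]
      gcongr
      by_cases h : p ∈ B
      · simp [h]
      · simp [h]

lemma laplace_real_lt (hA : IsSubordinatorWith f A P) {μ : ℝ} (hμ : 0 < μ) (s : ℝ≥0) :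
    ∫ t in Ioi (0 : ℝ), Real.exp (-μ * t) * P.real {ω | A s ω < t}
      = Real.exp (-(s : ℝ) * f μ) / μ := by
  have hAs := hA.measurable s
  have h := integral_exp_mul_real (P := P) (B := {p : ℝ × Ω | A s p.2 < p.1})
    (_root_.measurableSet_lt (by fun_prop) (by fun_prop)) hμ
  refine h.trans ?_
  rw [← hA.laplace s μ hμ, ← integral_div]
  refine integral_congr_ae ?_
  filter_upwards [hA.nonneg] with ω h using integral_exp_indicator hμ (h s)

/-- The Laplace transform of the potential, by Fubini's theorem. -/
lemma hasLaplace_potential (hA : IsSubordinatorWith f A P) {κ μ : ℝ} (hκ : 0 ≤ κ) (hμ : 0 < μ) :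
    HasLaplace (fun t => (potential P A κ t : ℂ)) μ ((μ⁻¹ * (f μ + κ)⁻¹ : ℝ) : ℂ) := by
  have hfμ := hA.exponent_pos μ hμ
  have e : ∀ t : ℝ, Real.exp (-μ * t) * potential P A κ t = ∫ s in Ioi (0 : ℝ),
      Real.exp (-κ * s) * (Real.exp (-μ * t) * P.real {ω | A s.toNNReal ω < t}) := fun t => by
    rw [potential, ← integral_const_mul]
    congr 1; ext s; ring
  have e2 : ∀ s ∈ Ioi (0 : ℝ), ∫ t in Ioi (0 : ℝ),
      Real.exp (-κ * s) * (Real.exp (-μ * t) * P.real {ω | A s.toNNReal ω < t})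
        = μ⁻¹ * Real.exp (-(f μ + κ) * s) := fun s hs => by
    rw [integral_const_mul, hA.laplace_real_lt hμ, Real.coe_toNNReal _ (le_of_lt hs),
      mul_div_assoc', ← Real.exp_add, div_eq_inv_mul]
    congr 2; ring
  have hint : Integrable (Function.uncurry fun t s : ℝ => Real.exp (-κ * s) * (Real.exp (-μ * t) *
      P.real {ω | A s.toNNReal ω < t}))
        ((volume.restrict (Ioi 0)).prod (volume.restrict (Ioi 0))) := by
    have hmeas : Measurable (Function.uncurry fun t s : ℝ =>
        Real.exp (-κ * s) * (Real.exp (-μ * t) * P.real {ω | A s.toNNReal ω < t})) := by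
      have h1 := hA.measurable_integrand.comp (f := fun p : ℝ × ℝ => (κ, p.2, p.1)) (by fun_prop)
      have h2 : Measurable fun p : ℝ × ℝ => Real.exp (-μ * p.1) * (Real.exp (-κ * p.2) *
          P.real {ω | A p.2.toNNReal ω < p.1}) :=
        (by fun_prop : Measurable fun p : ℝ × ℝ => Real.exp (-μ * p.1)).mul h1
      have e3 : (Function.uncurry fun t s : ℝ => Real.exp (-κ * s) * (Real.exp (-μ * t) *
          P.real {ω | A s.toNNReal ω < t})) = fun p : ℝ × ℝ => Real.exp (-μ * p.1) *
            (Real.exp (-κ * p.2) * P.real {ω | A p.2.toNNReal ω < p.1}) := by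
        ext p
        simp only [Function.uncurry]
        ring
      rwa [e3]
    have hnn : ∀ s t : ℝ, 0 ≤ Real.exp (-κ * s) * (Real.exp (-μ * t) *
        P.real {ω | A s.toNNReal ω < t}) := fun s t => by positivity
    rw [integrable_prod_iff' hmeas.aestronglyMeasurable]
    constructor
    · refine ae_of_all _ fun s => ?_
      have h1 : IntegrableOn (fun t => Real.exp (-μ * t)) (Ioi 0) :=
        integrableOn_exp_mul_Ioi (by linarith) 0
      refine (h1.const_mul (Real.exp (-κ * s))).mono'
        (hmeas.comp measurable_prodMk_right).aestronglyMeasurable (ae_of_all _ fun t => ?_)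
      simp only [Function.uncurry]
      rw [Real.norm_of_nonneg (hnn s t)]
      gcongr
      exact mul_le_of_le_one_right (Real.exp_pos _).le measureReal_le_one
    · simp only [Function.uncurry, Real.norm_of_nonneg (hnn _ _)]
      have h1 : IntegrableOn (fun s => μ⁻¹ * Real.exp (-(f μ + κ) * s)) (Ioi 0) :=
        (integrableOn_exp_mul_Ioi (by linarith) 0).const_mul _
      exact h1.congr_fun (fun s hs => (e2 s hs).symm) measurableSet_Ioi
  refine HasLaplace.of_real ?_ ?_
  · simp only [e]
    exact hint.integral_prod_left
  · simp only [e]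
    rw [integral_integral_swap hint, setIntegral_congr_fun measurableSet_Ioi e2, integral_const_mul,
      integral_exp_mul_Ioi (by linarith)]
    have : f μ + κ ≠ 0 := by positivity
    rw [mul_zero, Real.exp_zero]
    field_simp

/-- The Laplace transform of the hitting time, as `s < L(t)` means `A(s) < t`. -/
lemma integral_exp_hittingTime (hA : IsSubordinatorWith f A P) {κ : ℝ} (hκ : 0 ≤ κ) (t : ℝ) :
    ∫ ω, Real.exp (-(ratHittingTime t (fun s => A s ω) : ℝ) * κ) ∂P
      = 1 - κ * potential P A κ t := by
  rcases hκ.eq_or_lt with rfl | hκ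
  · simp
  obtain ⟨T, hTdef⟩ : ∃ T : Ω → ℝ≥0, T = fun ω => ratHittingTime t (fun s => A s ω) := ⟨_, rfl⟩
  have hT : Measurable T := hTdef ▸ hA.measurable_rat t
  have h := integral_exp_mul_real (P := P) (B := {p : ℝ × Ω | p.1 < T p.2})
    (_root_.measurableSet_lt (by fun_prop) (by fun_prop)) hκ
  have e : potential P A κ t = ∫ s in Ioi (0 : ℝ), Real.exp (-κ * s) *
      P.real {ω | (s, ω) ∈ {p : ℝ × Ω | p.1 < T p.2}} := by
    refine setIntegral_congr_fun measurableSet_Ioi fun s hs => ?_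
    have hs : 0 < s := hs
    have h1 := hA.real_lt_eq t (Real.toNNReal_pos.2 hs)
    simp only [← NNReal.coe_lt_coe, Real.coe_toNNReal _ hs.le] at h1
    simp only [← h1, hTdef, mem_ofPred_eq]
  have e2 : ∫ ω, (∫ s in Ioi (0 : ℝ), Real.exp (-κ * s) * (Iio (T ω : ℝ)).indicator 1 s) ∂P
      = ∫ ω, (1 - Real.exp (-κ * (T ω : ℝ))) / κ ∂P :=
    integral_congr_ae (ae_of_all _ fun ω => integral_exp_indicator_Iio hκ (T ω).2)
  have e3 : ∀ ω, Real.exp (-(ratHittingTime t (fun s => A s ω) : ℝ) * κ)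
      = Real.exp (-κ * (T ω : ℝ)) := fun ω => by
    rw [hTdef]; congr 1; ring
  simp only [e3]
  rw [e, h.trans e2, integral_div, integral_sub (integrable_const _)]
  · simp only [integral_const, probReal_univ, one_smul]
    field_simp
    ring
  · have hm : Measurable fun ω => Real.exp (-κ * (T ω : ℝ)) := by fun_prop
    refine Integrable.of_bound hm.aestronglyMeasurable 1 (ae_of_all _ fun ω => ?_)
    rw [Real.norm_of_nonneg (Real.exp_pos _).le, Real.exp_le_one_iff, neg_mul]
    exact neg_nonpos.2 (mul_nonneg hκ.le (T ω).2)

end IsSubordinatorWith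

/-! ### The law of the time-changed process -/

section Law

variable {Ω : Type*} [MeasurableSpace Ω] {P : Measure Ω} {n m : ℕ} {ν lam : Fin m → ℝ}
  {β c : ℝ} {S : ℝ≥0 → Ω → EuclideanSpace ℝ (Fin n)} {H : Fin m → ℝ≥0 → Ω → ℝ}

lemma isSubordinatorWith_weightedSum (hm : 0 < m) (hν : ∀ j, 0 < ν j ∧ ν j ≤ 1)
    (hlam : ∀ j, 0 < lam j) (hH : ∀ j, IsStableSubordinator (ν j) (H j) P)
    (hHindep : iIndepFun (fun (j : Fin m) (ω : Ω) (s : ℝ≥0) => H j s ω) P) :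
    IsSubordinatorWith (laplaceExponent ν lam) (weightedSum ν lam H) P := by
  have hpos : ∀ j, 0 < lam j ^ (1 / ν j) := fun j => Real.rpow_pos_of_pos (hlam j) _
  refine ⟨fun s => ?_, ?_, fun μ hμ => laplaceExponent_pos hm hlam hμ, fun s μ hμ => ?_⟩
  · exact Finset.measurable_sum _ fun j _ => ((hH j).levy.measurable s).const_mul _
  · filter_upwards [ae_all_iff.2 fun j => (hH j).monotone, ae_all_iff.2 fun j => (hH j).levy.zero,
      ae_all_iff.2 fun j => (hH j).levy.cadlag] with ω h1 h2 h3
    refine ⟨fun s t hst => ?_, ?_, fun s => ?_⟩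
    · exact Finset.sum_le_sum fun j _ => mul_le_mul_of_nonneg_left (h1 j hst) (hpos j).le
    · simp [weightedSum, h2]
    · exact tendsto_finsetSum _ fun j _ => ((h3 j s).1).const_mul _
  · have hX : ∀ j, Measurable fun ω => lam j ^ (1 / ν j) * H j s ω := fun j =>
      ((hH j).levy.measurable s).const_mul _
    have hi : iIndepFun (fun (j : Fin m) (ω : Ω) => lam j ^ (1 / ν j) * H j s ω) P :=
      hHindep.comp (fun j x => lam j ^ (1 / ν j) * x s) fun j => by fun_prop
    have h := hi.mgf_sum (t := -μ) hX Finset.univ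
    have e : ∀ ω, weightedSum ν lam H s ω
        = (∑ j, fun ω => lam j ^ (1 / ν j) * H j s ω) ω := fun ω => by
      rw [Finset.sum_apply]; rfl
    simp only [e]
    refine h.trans ?_
    rw [laplaceExponent, Finset.mul_sum, Real.exp_sum]
    refine Finset.prod_congr rfl fun j _ => ?_
    have h1 := (hH j).laplace s (μ * lam j ^ (1 / ν j)) (mul_pos hμ (hpos j))
    rw [Real.mul_rpow hμ.le (hpos j).le, ← Real.rpow_mul (hlam j).le, one_div,
      inv_mul_cancel₀ (hν j).1.ne', Real.rpow_one] at h1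
    rw [mgf, mul_comm (lam j), ← h1]
    refine integral_congr_ae (ae_of_all _ fun ω => ?_)
    simp only [one_div]
    congr 1; ring

variable [IsProbabilityMeasure P]

lemma timeChanged_ae_eq (hA : IsSubordinatorWith (laplaceExponent ν lam) (weightedSum ν lam H) P)
    (t : ℝ) : timeChanged ν lam c S H t =ᵐ[P] fun ω =>
      S (Real.toNNReal (c ^ 2) * ratHittingTime t (fun s => weightedSum ν lam H s ω)) ω := by
  filter_upwards [hA.ae_ratHittingTime_eq t] with ω h
  rw [h]
  rfl

lemma aemeasurable_timeChanged
    (hA : IsSubordinatorWith (laplaceExponent ν lam) (weightedSum ν lam H) P)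
    (hS : IsIsotropicStableProcess β S P) (t : ℝ) :
    AEMeasurable (timeChanged ν lam c S H t) P := by
  refine AEMeasurable.congr ?_ (timeChanged_ae_eq hA t).symm
  refine aemeasurable_comp_time hS.levy.measurable ?_ ((hA.measurable_rat t).const_mul _)
  filter_upwards [hS.levy.cadlag] with ω h t using (h t).1

lemma charFun_timeChanged
    (hA : IsSubordinatorWith (laplaceExponent ν lam) (weightedSum ν lam H) P)
    (hS : IsIsotropicStableProcess β S P)
    (hSH : IndepFun (fun (ω : Ω) (s : ℝ≥0) => S s ω)
      (fun (ω : Ω) (j : Fin m) (s : ℝ≥0) => H j s ω) P) (t : ℝ) (ξ : EuclideanSpace ℝ (Fin n)) :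
    charFun (P.map (timeChanged ν lam c S H t)) ξ
      = ((1 - (c ^ 2 * ‖ξ‖ ^ (2 * β)) *
        potential P (weightedSum ν lam H) (c ^ 2 * ‖ξ‖ ^ (2 * β)) t : ℝ) : ℂ) := by
  have hξ : 0 ≤ ‖ξ‖ ^ (2 * β) := by positivity
  rw [Measure.map_congr (timeChanged_ae_eq hA t), charFun_comp_time hS.levy.measurable ?_
    ((hA.measurable_rat t).const_mul _) ?_ hξ (hS.charFun_eq · ξ),
    ← hA.integral_exp_hittingTime (by positivity)]
  · congr 1
    refine integral_congr_ae (ae_of_all _ fun ω => ?_)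
    simp only [NNReal.coe_mul, Real.coe_toNNReal _ (sq_nonneg c)]
    congr 1; ring
  · filter_upwards [hS.levy.cadlag] with ω h t using (h t).1
  · have hφ : Measurable fun h : Fin m → ℝ≥0 → ℝ => Real.toNNReal (c ^ 2) *
        ratHittingTime t (fun s => ∑ j, lam j ^ (1 / ν j) * h j s) := by
      refine Measurable.const_mul ((measurable_ratHittingTime t).comp ?_) _
      exact measurable_pi_lambda _ fun s => by fun_prop
    exact hSH.comp measurable_id hφ

/-- The Fourier-Laplace transform of the law of `W`. -/
lemma hasLaplace_charFun_timeChanged (hm : 0 < m) (hlam : ∀ j, 0 < lam j)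
    (hA : IsSubordinatorWith (laplaceExponent ν lam) (weightedSum ν lam H) P)
    (hS : IsIsotropicStableProcess β S P)
    (hSH : IndepFun (fun (ω : Ω) (s : ℝ≥0) => S s ω)
      (fun (ω : Ω) (j : Fin m) (s : ℝ≥0) => H j s ω) P) {μ : ℝ} (hμ : 0 < μ)
    (ξ : EuclideanSpace ℝ (Fin n)) :
    HasLaplace (fun t => charFun (P.map (timeChanged ν lam c S H t)) ξ) μ
      (((∑ j, lam j * μ ^ (ν j - 1)) /
          (∑ j, lam j * μ ^ ν j + c ^ 2 * ‖ξ‖ ^ (2 * β)) : ℝ) : ℂ) := by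
  set κ := c ^ 2 * ‖ξ‖ ^ (2 * β)
  have hκ : 0 ≤ κ := by positivity
  have h := (HasLaplace.of_const (z := 1) hμ).sub ((hA.hasLaplace_potential hκ hμ).const_mul κ)
  have hf := laplaceExponent_pos hm (ν := ν) hlam hμ
  have hz : (∑ j, lam j * μ ^ (ν j - 1)) / (∑ j, lam j * μ ^ ν j + κ)
      = 1 / μ - κ * (μ⁻¹ * (laplaceExponent ν lam μ + κ)⁻¹) := by
    have h1 : ∑ j, lam j * μ ^ (ν j - 1) = laplaceExponent ν lam μ / μ := by
      rw [laplaceExponent, Finset.sum_div]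
      exact Finset.sum_congr rfl fun j _ => by rw [Real.rpow_sub_one hμ.ne', mul_div_assoc]
    have h2 : laplaceExponent ν lam μ + κ ≠ 0 := by positivity
    rw [h1]
    change laplaceExponent ν lam μ / μ / (laplaceExponent ν lam μ + κ) = _
    field_simp
    ring
  rw [hz]
  have h3 := h.congr (g := fun t => charFun (P.map (timeChanged ν lam c S H t)) ξ) fun t _ => by
    rw [charFun_timeChanged hA hS hSH]
    change _ = ((1 - κ * potential P (weightedSum ν lam H) κ t : ℝ) : ℂ)
    push_cast
    rfl
  push_cast at h3 ⊢
  exact h3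

end Law

/-! ### Regularity of the potentials in time -/

/-- A monotone function that agrees almost everywhere with a continuous one agrees everywhere: it is
squeezed between values at nearby points of agreement. -/
lemma Monotone.eq_of_ae_eq_continuousOn {F G : ℝ → ℝ} (hF : Monotone F)
    (hG : ContinuousOn G (Ioi 0)) (h : ∀ᵐ t : ℝ, t ∈ Ioi (0 : ℝ) → F t = G t) {t : ℝ}
    (ht : 0 < t) : F t = G t := by
  have hd := Measure.dense_of_ae h
  have hc : ContinuousAt G t := hG.continuousAt (Ioi_mem_nhds ht)
  refine le_antisymm (le_of_forall_pos_lt_add fun ε hε => ?_)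
    (le_of_forall_pos_lt_add fun ε hε => ?_)
  · obtain ⟨u, hu, hu2⟩ := exists_Ico_subset_of_mem_nhds
      (hc.eventually (gt_mem_nhds (show G t < G t + ε by linarith))) ⟨t + 1, by linarith⟩
    obtain ⟨s, hs, hs1, hs2⟩ := hd.exists_between hu
    calc F t ≤ F s := hF hs1.le
      _ = G s := hs (ht.trans hs1)
      _ < G t + ε := hu2 ⟨hs1.le, hs2⟩
  · obtain ⟨l, hl, hl2⟩ := exists_Ioc_subset_of_mem_nhds
      (hc.eventually (lt_mem_nhds (show G t - ε < G t by linarith))) ⟨t - 1, by linarith⟩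
    obtain ⟨s, hs, hs1, hs2⟩ := hd.exists_between (max_lt hl ht)
    have h1 : G t - ε < G s := hl2 ⟨(le_max_left _ _).trans_lt hs1, hs2.le⟩
    have h2 : F s = G s := hs ((le_max_right _ _).trans_lt hs1)
    have h3 := hF hs2.le
    linarith

section PowerBound

variable {r : ℝ → ℝ} {α C M : ℝ}

/-- An exponential bound with a power singularity at `0` is a local power bound. -/
lemma PowerBounded.of_le_exp (hα1 : α ≤ 1) (hC : 0 ≤ C) (hM : 1 ≤ M)
    (hc : ContinuousOn r (Ioi 0))
    (hb : ∀ t, 0 < t → |r t| ≤ C * Real.exp (M * t) * (1 + t ^ (α - 1))) :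
    PowerBounded α (fun t => (r t : ℂ)) := by
  refine ⟨Complex.continuous_ofReal.comp_continuousOn hc, fun T hT => ?_⟩
  have hT0 : 0 < T ^ (α - 1) := Real.rpow_pos_of_pos hT _
  refine ⟨C * Real.exp (M * T) * ((T ^ (α - 1))⁻¹ + 1), by positivity, fun t ht htT => ?_⟩
  rw [Complex.norm_real]
  refine (hb t ht).trans ?_
  have h1 : T ^ (α - 1) ≤ t ^ (α - 1) := Real.rpow_le_rpow_of_nonpos ht htT (by linarith)
  have h2 : 1 + t ^ (α - 1) ≤ ((T ^ (α - 1))⁻¹ + 1) * t ^ (α - 1) := by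
    rw [add_mul, one_mul]
    gcongr
    rwa [inv_mul_eq_div, one_le_div hT0]
  rw [mul_assoc (C * Real.exp (M * T))]
  have h3 : C * Real.exp (M * t) ≤ C * Real.exp (M * T) := by gcongr
  exact mul_le_mul h3 h2 (by positivity) (by positivity)

end PowerBound

/-- The derivative in `t` of the potential, which exists for `t > 0` if the Laplace exponent is
`∑ⱼ λⱼ μ ^ νⱼ`. -/
def potentialDensity {Ω : Type*} [MeasurableSpace Ω] (P : Measure Ω) (A : ℝ≥0 → Ω → ℝ)
    (κ t : ℝ) : ℝ := deriv (potential P A κ) t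

namespace IsSubordinatorWith

section General

variable {Ω : Type*} [MeasurableSpace Ω] {f : ℝ → ℝ} {A : ℝ≥0 → Ω → ℝ} {P : Measure Ω}
  [IsProbabilityMeasure P]

lemma monotone_potential (hA : IsSubordinatorWith f A P) {κ : ℝ} (hκ : 0 ≤ κ) :
    Monotone (potential P A κ) := fun _ _ h => sub_nonneg.1 (hA.potential_increment hκ h).1

lemma mul_potential_mem_Icc (hA : IsSubordinatorWith f A P) {κ : ℝ} (hκ : 0 ≤ κ) (t : ℝ) :
    1 - κ * potential P A κ t ∈ Icc (0 : ℝ) 1 := by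
  refine ⟨?_, ?_⟩
  · rw [← hA.integral_exp_hittingTime hκ t]
    exact integral_nonneg fun ω => (Real.exp_pos _).le
  · have h : 0 ≤ potential P A κ t :=
      integral_nonneg fun s => mul_nonneg (Real.exp_pos _).le measureReal_nonneg
    have := mul_nonneg hκ h
    linarith

lemma potentialDensity_nonneg (hA : IsSubordinatorWith f A P) {κ : ℝ} (hκ : 0 ≤ κ) (t : ℝ) :
    0 ≤ potentialDensity P A κ t := by
  rw [potentialDensity, ← derivWithin_univ]
  exact ((hA.monotone_potential hκ).monotoneOn _).derivWithin_nonneg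

lemma measurable_potential_uncurry (hA : IsSubordinatorWith f A P) :
    Measurable fun p : ℝ × ℝ => potential P A p.1 p.2 := by
  refine (StronglyMeasurable.integral_prod_right (f := fun (p : ℝ × ℝ) (s : ℝ) =>
    Real.exp (-p.1 * s) * P.real {ω | A s.toNNReal ω < p.2}) ?_).measurable
  exact (hA.measurable_integrand.comp
    (f := fun q : (ℝ × ℝ) × ℝ => (q.1.1, q.2, q.1.2)) (by fun_prop)).stronglyMeasurable

end General

variable {Ω : Type*} [MeasurableSpace Ω] {A : ℝ≥0 → Ω → ℝ} {P : Measure Ω}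
  [IsProbabilityMeasure P] {m : ℕ} {ν lam : Fin m → ℝ}

/-- The potential is the primitive of the resolvent kernel, as their Laplace transforms agree. -/
lemma exists_potential_eq (hA : IsSubordinatorWith (laplaceExponent ν lam) A P) (hm : 0 < m)
    (hν : ∀ j, 0 < ν j ∧ ν j ≤ 1) (hlam : ∀ j, 0 < lam j) {κ : ℝ} (hκ : 0 ≤ κ) :
    ∃ α M : ℝ, 0 < α ∧ α ≤ 1 ∧ 1 ≤ M ∧
      PowerBounded α (fun t => (potentialDensity P A κ t : ℂ)) ∧
      (∀ t, 0 < t → HasDerivAt (potential P A κ) (potentialDensity P A κ t) t) ∧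
      ContinuousOn (potential P A κ) (Ici 0) ∧
      ∀ μ, M < μ → HasLaplace (fun t => (potentialDensity P A κ t : ℂ)) μ
        (((laplaceExponent ν lam μ + κ)⁻¹ : ℝ) : ℂ) := by
  obtain ⟨r, α, C, M, hα, hα1, hC, hM, hrc, hrb, hrL⟩ := exists_resolvent hm hν hlam hκ
  have hpb := PowerBounded.of_le_exp hα1 hC hM hrc hrb
  have hri : ∀ T, 0 < T → IntervalIntegrable r volume 0 T := fun T hT => by
    have := (hpb.intervalIntegrable hα hα1 hT)
    exact ⟨this.1.re, this.2.re⟩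
  set R : ℝ → ℝ := fun t => ∫ s in (0 : ℝ)..t, r s
  have hRc : ContinuousOn R (Ici 0) := continuousOn_primitive_Ici hri
  have hVR : ∀ t, 0 < t → potential P A κ t = R t := by
    refine fun t ht => (hA.monotone_potential hκ).eq_of_ae_eq_continuousOn
      (hRc.mono Ioi_subset_Ici_self) ?_ ht
    have h1 : ∀ μ, M + 1 ≤ μ → HasLaplace (fun t => (R t : ℂ)) μ
        ((μ⁻¹ * (laplaceExponent ν lam μ + κ)⁻¹ : ℝ) : ℂ) := by
      intro μ hμ
      have h := (hrL μ (by linarith)).caputoIntegral (ν := 0) zero_le_one (by linarith)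
      rw [zero_sub, Real.rpow_neg_one, ← Complex.ofReal_mul] at h
      refine h.congr fun t _ => ?_
      rw [caputoIntegral_zero, intervalIntegral.integral_ofReal]
    have h2 := ae_eq_of_hasLaplace (a := M + 1)
      (fun μ hμ => hA.hasLaplace_potential hκ (μ := μ) (by linarith)) h1
    filter_upwards [h2] with t ht h0 using Complex.ofReal_injective (ht h0)
  have hder : ∀ t, 0 < t → HasDerivAt (potential P A κ) (r t) t := by
    intro t ht
    have h1 : HasDerivAt R (r t) t := by
      refine intervalIntegral.integral_hasDerivAt_right (hri t ht) ?_
        (hrc.continuousAt (Ioi_mem_nhds ht))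
      exact hrc.stronglyMeasurableAtFilter isOpen_Ioi t ht
    refine h1.congr_of_eventuallyEq ?_
    filter_upwards [Ioi_mem_nhds ht] with s hs using hVR s hs
  have hrd : ∀ t, 0 < t → r t = potentialDensity P A κ t := fun t ht => (hder t ht).deriv.symm
  refine ⟨α, M, hα, hα1, hM, ⟨?_, fun T hT => ?_⟩, fun t ht => hrd t ht ▸ hder t ht, ?_,
    fun μ hμ => (hrL μ hμ).congr fun t ht => by rw [hrd t ht]⟩
  · exact hpb.continuousOn.congr fun t ht => by simp only [hrd t ht]
  · obtain ⟨B, hB0, hB⟩ := hpb.bound T hT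
    exact ⟨B, hB0, fun t ht htT => by rw [← hrd t ht]; exact hB t ht htT⟩
  · refine hRc.congr fun t ht => ?_
    rcases (show 0 ≤ t from ht).eq_or_lt with rfl | h
    · simp [R, hA.potential_of_nonpos κ le_rfl]
    · exact hVR t h

/-- The densities decrease in `κ`, since the increments of the potential do. -/
lemma potentialDensity_le (hA : IsSubordinatorWith (laplaceExponent ν lam) A P) (hm : 0 < m)
    (hν : ∀ j, 0 < ν j ∧ ν j ≤ 1) (hlam : ∀ j, 0 < lam j) {κ : ℝ} (hκ : 0 ≤ κ) {t : ℝ}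
    (ht : 0 < t) : potentialDensity P A κ t ≤ potentialDensity P A 0 t := by
  obtain ⟨-, -, -, -, -, -, h1, -⟩ := hA.exists_potential_eq hm hν hlam hκ
  obtain ⟨-, -, -, -, -, -, h2, -⟩ := hA.exists_potential_eq hm hν hlam le_rfl
  have hmono : Monotone fun t => potential P A 0 t - potential P A κ t := fun s t hst => by
    have := (hA.potential_increment hκ hst).2
    simp only
    linarith
  have h := (hmono.monotoneOn univ).derivWithin_nonneg (x := t)
  rw [derivWithin_univ, ((h2 t ht).fun_sub (h1 t ht)).deriv] at h
  linarith

/-- The mode `1 - κ V(κ, t)` solves the relaxation equation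
`∑ⱼ λⱼ D^νⱼ u = - κ u`; the factor `- κ` has been divided out. -/
lemma sum_caputoIntegral_potentialDensity
    (hA : IsSubordinatorWith (laplaceExponent ν lam) A P) (hm : 0 < m)
    (hν : ∀ j, 0 < ν j ∧ ν j ≤ 1) (hlam : ∀ j, 0 < lam j) {κ : ℝ} (hκ : 0 ≤ κ) {t : ℝ}
    (ht : 0 < t) :
    ∑ j, (lam j : ℂ) * caputoIntegral (ν j) (fun t => (potentialDensity P A κ t : ℂ)) t
      = ((1 - κ * potential P A κ t : ℝ) : ℂ) := by
  obtain ⟨α, M, hα, hα1, hM, hpb, -, hVc, hL⟩ := hA.exists_potential_eq hm hν hlam hκ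
  have hleft : ∀ μ, M + 1 ≤ μ → HasLaplace (fun t => ∑ j, (lam j : ℂ) *
      caputoIntegral (ν j) (fun t => (potentialDensity P A κ t : ℂ)) t) μ
      ((laplaceExponent ν lam μ * μ⁻¹ * (laplaceExponent ν lam μ + κ)⁻¹ : ℝ) : ℂ) := by
    intro μ hμ
    have hμ0 : 0 < μ := by linarith
    have h := HasLaplace.sum Finset.univ fun j _ =>
      ((hL μ (by linarith)).caputoIntegral (hν j).2 hμ0).const_mul (lam j : ℂ)
    convert h using 1
    rw [laplaceExponent, Finset.sum_mul, Finset.sum_mul]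
    push_cast
    refine Finset.sum_congr rfl fun j _ => ?_
    rw [Real.rpow_sub_one hμ0.ne']
    push_cast
    ring
  have hright : ∀ μ, M + 1 ≤ μ → HasLaplace (fun t => ((1 - κ * potential P A κ t : ℝ) : ℂ)) μ
      ((laplaceExponent ν lam μ * μ⁻¹ * (laplaceExponent ν lam μ + κ)⁻¹ : ℝ) : ℂ) := by
    intro μ hμ
    have hμ0 : 0 < μ := by linarith
    have hf := laplaceExponent_pos hm (ν := ν) hlam hμ0
    have h := (HasLaplace.of_const (z := 1) hμ0).sub ((hA.hasLaplace_potential hκ hμ0).const_mul κ)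
    have hz : laplaceExponent ν lam μ * μ⁻¹ * (laplaceExponent ν lam μ + κ)⁻¹
        = 1 / μ - κ * (μ⁻¹ * (laplaceExponent ν lam μ + κ)⁻¹) := by
      have h2 : laplaceExponent ν lam μ + κ ≠ 0 := by positivity
      field_simp
      ring
    rw [hz]
    push_cast at h ⊢
    exact h
  refine eqOn_of_hasLaplace hleft hright ?_ ?_ ht
  · exact continuousOn_finsetSum _ fun j _ => continuousOn_const.mul
      (hpb.continuousOn_caputoIntegral hα hα1 (hν j).1.le (hν j).2)
  · exact Complex.continuous_ofReal.comp_continuousOn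
      (continuousOn_const.sub (continuousOn_const.mul (hVc.mono Ioi_subset_Ici_self)))

/-- Measurability of the density in time and parameter, as a limit of difference quotients. -/
lemma aestronglyMeasurable_potentialDensity
    (hA : IsSubordinatorWith (laplaceExponent ν lam) A P) (hm : 0 < m)
    (hν : ∀ j, 0 < ν j ∧ ν j ≤ 1) (hlam : ∀ j, 0 < lam j) {Y : Type*} [MeasurableSpace Y]
    {ρ : Measure Y} {k τ : Y → ℝ} (hk : Measurable k) (hk0 : ∀ y, 0 ≤ k y) (hτ : Measurable τ)
    (hτ0 : ∀ᵐ y ∂ρ, 0 < τ y) :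
    AEStronglyMeasurable (fun y => potentialDensity P A (k y) (τ y)) ρ := by
  have hV := hA.measurable_potential_uncurry
  refine aestronglyMeasurable_of_tendsto_ae atTop (f := fun (i : ℕ) y => ((1 : ℝ) / (i + 1))⁻¹ •
    (potential P A (k y) (τ y + 1 / (i + 1)) - potential P A (k y) (τ y))) (fun i => ?_) ?_
  · have h1 : Measurable fun y => potential P A (k y) (τ y + 1 / (i + 1)) :=
      hV.comp (f := fun y => (k y, τ y + 1 / (i + 1))) (by fun_prop)
    have h2 : Measurable fun y => potential P A (k y) (τ y) :=
      hV.comp (f := fun y => (k y, τ y)) (by fun_prop)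
    exact ((h1.sub h2).const_smul ((1 : ℝ) / (i + 1))⁻¹).aestronglyMeasurable
  · filter_upwards [hτ0] with y hy
    obtain ⟨-, -, -, -, -, -, h1, -⟩ := hA.exists_potential_eq hm hν hlam (hk0 y)
    have h2 : Tendsto (fun i : ℕ => (1 : ℝ) / (i + 1)) atTop (𝓝[≠] 0) :=
      tendsto_nhdsWithin_iff.2 ⟨tendsto_one_div_add_atTop_nhds_zero_nat,
        Eventually.of_forall fun i => (by positivity : (1 : ℝ) / (i + 1) ≠ 0)⟩
    exact (h1 (τ y) hy).tendsto_slope_zero.comp h2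

end IsSubordinatorWith

/-! ### Superposition of the modes -/

namespace IsSubordinatorWith

variable {Ω : Type*} [MeasurableSpace Ω] {A : ℝ≥0 → Ω → ℝ} {P : Measure Ω}
  [IsProbabilityMeasure P] {m : ℕ} {ν lam : Fin m → ℝ}
  {Y : Type*} [MeasurableSpace Y] {ρ : Measure Y} {g : Y → ℂ} {k : Y → ℝ}

lemma continuousOn_superposition (hA : IsSubordinatorWith (laplaceExponent ν lam) A P) (hm : 0 < m)
    (hν : ∀ j, 0 < ν j ∧ ν j ≤ 1) (hlam : ∀ j, 0 < lam j) (hk : Measurable k)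
    (hk0 : ∀ y, 0 ≤ k y) (hg : Integrable g ρ) :
    ContinuousOn (fun t => ∫ y, g y * ((1 - k y * potential P A (k y) t : ℝ) : ℂ) ∂ρ) (Ici 0) := by
  have hV := hA.measurable_potential_uncurry
  intro t ht
  refine continuousWithinAt_of_dominated (bound := fun y => ‖g y‖)
    (Eventually.of_forall fun s => ?_) (Eventually.of_forall fun s => ae_of_all _ fun y => ?_)
    hg.norm (ae_of_all _ fun y => ?_)
  · have h1 : Measurable fun y => potential P A (k y) s :=
      hV.comp (f := fun y => (k y, s)) (by fun_prop)
    have h2 : Measurable fun y => ((1 - k y * potential P A (k y) s : ℝ) : ℂ) := by fun_prop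
    exact hg.aestronglyMeasurable.mul h2.aestronglyMeasurable
  · have h := hA.mul_potential_mem_Icc (hk0 y) s
    rw [norm_mul, Complex.norm_real, Real.norm_of_nonneg h.1]
    exact mul_le_of_le_one_right (norm_nonneg _) h.2
  · obtain ⟨-, -, -, -, -, -, -, hc, -⟩ := hA.exists_potential_eq hm hν hlam (hk0 y)
    exact continuousWithinAt_const.mul
      (Complex.continuous_ofReal.continuousAt.comp_continuousWithinAt
        (continuousWithinAt_const.sub (continuousWithinAt_const.mul (hc t ht))))

/-- The densities are bounded uniformly in `κ`, by the one for `κ = 0`. -/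
lemma exists_bound_potentialDensity (hA : IsSubordinatorWith (laplaceExponent ν lam) A P)
    (hm : 0 < m) (hν : ∀ j, 0 < ν j ∧ ν j ≤ 1) (hlam : ∀ j, 0 < lam j) :
    ∃ α : ℝ, 0 < α ∧ α ≤ 1 ∧ ∀ T, 0 < T → ∃ B, 0 ≤ B ∧ ∀ κ, 0 ≤ κ → ∀ t, 0 < t → t ≤ T →
      |potentialDensity P A κ t| ≤ B * t ^ (α - 1) := by
  obtain ⟨α, -, hα, hα1, -, hpb, -⟩ := hA.exists_potential_eq hm hν hlam le_rfl
  refine ⟨α, hα, hα1, fun T hT => ?_⟩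
  obtain ⟨B, hB0, hB⟩ := hpb.bound T hT
  refine ⟨B, hB0, fun κ hκ t ht htT => ?_⟩
  have h1 := hB t ht htT
  rw [Complex.norm_real, Real.norm_of_nonneg (hA.potentialDensity_nonneg le_rfl t)] at h1
  rw [abs_of_nonneg (hA.potentialDensity_nonneg hκ t)]
  exact (hA.potentialDensity_le hm hν hlam hκ ht).trans h1

lemma hasDerivAt_superposition (hA : IsSubordinatorWith (laplaceExponent ν lam) A P) (hm : 0 < m)
    (hν : ∀ j, 0 < ν j ∧ ν j ≤ 1) (hlam : ∀ j, 0 < lam j) (hk : Measurable k)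
    (hk0 : ∀ y, 0 ≤ k y) (hg : Integrable g ρ) (hkg : Integrable (fun y => (k y : ℂ) * g y) ρ)
    {t : ℝ} (ht : 0 < t) :
    HasDerivAt (fun t => ∫ y, g y * ((1 - k y * potential P A (k y) t : ℝ) : ℂ) ∂ρ)
      (∫ y, -((k y : ℂ) * g y) * (potentialDensity P A (k y) t : ℂ) ∂ρ) t := by
  have hV := hA.measurable_potential_uncurry
  have hm1 : ∀ s, AEStronglyMeasurable
      (fun y => g y * ((1 - k y * potential P A (k y) s : ℝ) : ℂ)) ρ := fun s => by
    have h1 : Measurable fun y => potential P A (k y) s :=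
      hV.comp (f := fun y => (k y, s)) (by fun_prop)
    have h2 : Measurable fun y => ((1 - k y * potential P A (k y) s : ℝ) : ℂ) := by fun_prop
    exact hg.aestronglyMeasurable.mul h2.aestronglyMeasurable
  obtain ⟨α, hα, hα1, hbd⟩ := hA.exists_bound_potentialDensity hm hν hlam
  obtain ⟨B, hB0, hB⟩ := hbd (2 * t) (by linarith)
  refine (hasDerivAt_integral_of_dominated_loc_of_deriv_le
    (bound := fun y => ‖(k y : ℂ) * g y‖ * (B * (t / 2) ^ (α - 1)))
    (F' := fun t y => -((k y : ℂ) * g y) * (potentialDensity P A (k y) t : ℂ))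
    (Ioo_mem_nhds (show t / 2 < t by linarith) (show t < 2 * t by linarith))
    (Eventually.of_forall hm1) ?_ ?_ (ae_of_all _ fun y s hs => ?_) ?_
    (ae_of_all _ fun y s hs => ?_)).2
  · refine hg.norm.mono' (hm1 t) (ae_of_all _ fun y => ?_)
    have h := hA.mul_potential_mem_Icc (hk0 y) t
    rw [norm_mul, Complex.norm_real, Real.norm_of_nonneg h.1]
    exact mul_le_of_le_one_right (norm_nonneg _) h.2
  · exact hkg.aestronglyMeasurable.neg.mul (Complex.continuous_ofReal.comp_aestronglyMeasurable
      (hA.aestronglyMeasurable_potentialDensity hm hν hlam hk hk0 measurable_const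
        (ae_of_all _ fun _ => ht)))
  · have hs0 : 0 < s := lt_trans (by linarith) hs.1
    rw [norm_mul, norm_neg, Complex.norm_real]
    have h1 : s ^ (α - 1) ≤ (t / 2) ^ (α - 1) :=
      Real.rpow_le_rpow_of_nonpos (by linarith) hs.1.le (by linarith)
    have h2 := hB (k y) (hk0 y) s hs0 hs.2.le
    gcongr
    exact h2.trans (by gcongr)
  · exact hkg.norm.mul_const _
  · have hs0 : 0 < s := lt_trans (by linarith) hs.1
    obtain ⟨-, -, -, -, -, -, h1, -⟩ := hA.exists_potential_eq hm hν hlam (hk0 y)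
    have h2 : HasDerivAt (fun t => 1 - k y * potential P A (k y) t)
        (-(k y * potentialDensity P A (k y) s)) s :=
      ((h1 s hs0).const_mul (k y)).const_sub 1
    have h3 := h2.ofReal_comp.const_mul (g y)
    have h4 : g y * ((-(k y * potentialDensity P A (k y) s) : ℝ) : ℂ)
        = -((k y : ℂ) * g y) * (potentialDensity P A (k y) s : ℂ) := by
      push_cast
      ring
    exact h4 ▸ h3

lemma exists_powerBounded_superposition (hA : IsSubordinatorWith (laplaceExponent ν lam) A P)
    (hm : 0 < m) (hν : ∀ j, 0 < ν j ∧ ν j ≤ 1) (hlam : ∀ j, 0 < lam j) (hk : Measurable k)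
    (hk0 : ∀ y, 0 ≤ k y) (hkg : Integrable (fun y => (k y : ℂ) * g y) ρ) :
    ∃ α : ℝ, 0 < α ∧ α ≤ 1 ∧ PowerBounded α
      (fun t => ∫ y, -((k y : ℂ) * g y) * (potentialDensity P A (k y) t : ℂ) ∂ρ) := by
  obtain ⟨α, hα, hα1, hbd⟩ := hA.exists_bound_potentialDensity hm hν hlam
  refine ⟨α, hα, hα1, fun t ht => ContinuousAt.continuousWithinAt ?_, fun T hT => ?_⟩
  · have ht : 0 < t := ht
    obtain ⟨B, hB0, hB⟩ := hbd (2 * t) (by linarith)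
    have hnear : ∀ᶠ s in 𝓝 t, s ∈ Ioo (t / 2) (2 * t) :=
      Ioo_mem_nhds (by linarith) (by linarith)
    refine continuousAt_of_dominated (bound := fun y => ‖(k y : ℂ) * g y‖ * (B * (t / 2) ^ (α - 1)))
      ?_ ?_ (hkg.norm.mul_const _) (ae_of_all _ fun y => ?_)
    · filter_upwards [hnear] with s hs
      have hs0 : 0 < s := lt_trans (by linarith) hs.1
      exact hkg.aestronglyMeasurable.neg.mul (Complex.continuous_ofReal.comp_aestronglyMeasurable
        (hA.aestronglyMeasurable_potentialDensity hm hν hlam hk hk0 measurable_const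
          (ae_of_all _ fun _ => hs0)))
    · filter_upwards [hnear] with s hs
      refine ae_of_all _ fun y => ?_
      have hs0 : 0 < s := lt_trans (by linarith) hs.1
      rw [norm_mul, norm_neg, Complex.norm_real]
      have h1 : s ^ (α - 1) ≤ (t / 2) ^ (α - 1) :=
        Real.rpow_le_rpow_of_nonpos (by linarith) hs.1.le (by linarith)
      have h2 := hB (k y) (hk0 y) s hs0 hs.2.le
      gcongr
      exact h2.trans (by gcongr)
    · obtain ⟨_, _, -, -, -, h1, -⟩ := hA.exists_potential_eq hm hν hlam (hk0 y)
      exact continuousAt_const.mul (h1.continuousOn.continuousAt (Ioi_mem_nhds ht))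
  · obtain ⟨B, hB0, hB⟩ := hbd T hT
    have hI : 0 ≤ ∫ y, ‖(k y : ℂ) * g y‖ ∂ρ := integral_nonneg fun _ => norm_nonneg _
    refine ⟨(∫ y, ‖(k y : ℂ) * g y‖ ∂ρ) * B, by positivity, fun t ht htT => ?_⟩
    rw [mul_assoc, ← integral_mul_const]
    refine norm_integral_le_of_norm_le (hkg.norm.mul_const _) (ae_of_all _ fun y => ?_)
    rw [norm_mul, norm_neg, Complex.norm_real]
    exact mul_le_mul_of_nonneg_left (hB (k y) (hk0 y) t ht htT) (norm_nonneg _)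

variable [SFinite ρ]

lemma caputoIntegral_superposition (hA : IsSubordinatorWith (laplaceExponent ν lam) A P)
    (hm : 0 < m) (hν : ∀ j, 0 < ν j ∧ ν j ≤ 1) (hlam : ∀ j, 0 < lam j) (hk : Measurable k)
    (hk0 : ∀ y, 0 ≤ k y) (hkg : Integrable (fun y => (k y : ℂ) * g y) ρ) {a : ℝ} (ha : 0 ≤ a)
    (ha1 : a ≤ 1) {t : ℝ} (ht : 0 < t) :
    Integrable (fun y => -((k y : ℂ) * g y) *
        caputoIntegral a (fun t => (potentialDensity P A (k y) t : ℂ)) t) ρ ∧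
    caputoIntegral a (fun t => ∫ y, -((k y : ℂ) * g y) * (potentialDensity P A (k y) t : ℂ) ∂ρ) t
      = ∫ y, -((k y : ℂ) * g y) *
        caputoIntegral a (fun t => (potentialDensity P A (k y) t : ℂ)) t ∂ρ := by
  obtain ⟨α, hα, hα1, hbd⟩ := hA.exists_bound_potentialDensity hm hν hlam
  obtain ⟨B, hB0, hB⟩ := hbd t ht
  rcases eq_or_ne a 1 with rfl | hne
  · simp only [caputoIntegral_one, and_true]
    refine Integrable.mono' (hkg.norm.mul_const (B * t ^ (α - 1))) ?_ (ae_of_all _ fun y => ?_)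
    · exact hkg.aestronglyMeasurable.neg.mul (Complex.continuous_ofReal.comp_aestronglyMeasurable
        (hA.aestronglyMeasurable_potentialDensity hm hν hlam hk hk0 measurable_const
          (ae_of_all _ fun _ => ht)))
    · rw [norm_mul, norm_neg, Complex.norm_real]
      exact mul_le_mul_of_nonneg_left (hB (k y) (hk0 y) t ht le_rfl) (norm_nonneg _)
  have ha1 : a < 1 := lt_of_le_of_ne ha1 hne
  -- Fubini's theorem for the time and the parameter
  set F : Y → ℝ → ℂ := fun y s =>
    -((k y : ℂ) * g y) * ((t - s) ^ (-a) • (potentialDensity P A (k y) s : ℂ))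
  have hF : Integrable (Function.uncurry F) (ρ.prod (volume.restrict (Ioo 0 t))) := by
    have hbeta : IntegrableOn (fun s => (t - s) ^ (-a) * s ^ (α - 1)) (Ioo 0 t) := by
      have := intervalIntegrable_beta hα hα1 ha ha1 ht
      rw [intervalIntegrable_iff_integrableOn_Ioo_of_le ht.le] at this
      exact this
    have hdom := hkg.norm.mul_prod (hbeta.const_mul B)
    have h2 : ∀ᵐ p ∂(ρ.prod (volume.restrict (Ioo 0 t))), p.2 ∈ Ioo 0 t :=
      Measure.quasiMeasurePreserving_snd.ae (ae_restrict_mem measurableSet_Ioo)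
    refine hdom.mono' ?_ ?_
    · have m1 : AEStronglyMeasurable (fun p : Y × ℝ => (k p.1 : ℂ) * g p.1)
        (ρ.prod (volume.restrict (Ioo 0 t))) := hkg.aestronglyMeasurable.comp_fst
      have m2 : Measurable fun p : Y × ℝ => (t - p.2) ^ (-a) := by fun_prop
      have m3 : AEStronglyMeasurable (fun p : Y × ℝ => potentialDensity P A (k p.1) p.2)
          (ρ.prod (volume.restrict (Ioo 0 t))) :=
        hA.aestronglyMeasurable_potentialDensity hm hν hlam (hk.comp measurable_fst)
          (fun p => hk0 p.1) measurable_snd (h2.mono fun p hp => hp.1)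
      exact m1.neg.mul (m2.aestronglyMeasurable.smul
        (Complex.continuous_ofReal.comp_aestronglyMeasurable m3))
    · filter_upwards [h2] with p hp
      have hp1 : 0 ≤ (t - p.2) ^ (-a) := Real.rpow_nonneg (sub_nonneg.2 hp.2.le) _
      simp only [Function.uncurry, F]
      rw [norm_mul, norm_neg, norm_smul, Real.norm_of_nonneg hp1, Complex.norm_real,
        Real.norm_eq_abs]
      have := hB (k p.1) (hk0 p.1) p.2 hp.1 hp.2.le
      calc _ ≤ ‖(k p.1 : ℂ) * g p.1‖ * ((t - p.2) ^ (-a) * (B * p.2 ^ (α - 1))) := by gcongr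
        _ = _ := by ring
  have e1 : ∀ y, -((k y : ℂ) * g y) *
      caputoIntegral a (fun t => (potentialDensity P A (k y) t : ℂ)) t
        = (Real.Gamma (1 - a))⁻¹ • ∫ s in Ioo 0 t, F y s := fun y => by
    rw [caputoIntegral, if_neg hne, intervalIntegral.integral_of_le ht.le,
      integral_Ioc_eq_integral_Ioo, integral_const_mul, mul_smul_comm]
  refine ⟨?_, ?_⟩
  · simp only [e1]
    exact Integrable.smul (Real.Gamma (1 - a))⁻¹ hF.integral_prod_left
  · simp only [e1]
    rw [integral_smul, integral_integral_swap hF, caputoIntegral, if_neg hne,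
      intervalIntegral.integral_of_le ht.le, integral_Ioc_eq_integral_Ioo]
    congr 1
    refine integral_congr_ae (ae_of_all _ fun s => ?_)
    simp only [F]
    rw [← integral_smul]
    congr 1
    ext y
    rw [mul_smul_comm]

/-- Superpositions of the modes `1 - κ V(κ, t)` have classical Caputo derivatives and solve the
relaxation equation mode by mode. -/
theorem superposition_solves (hA : IsSubordinatorWith (laplaceExponent ν lam) A P)
    (hm : 0 < m) (hν : ∀ j, 0 < ν j ∧ ν j ≤ 1) (hlam : ∀ j, 0 < lam j) (hk : Measurable k)
    (hk0 : ∀ y, 0 ≤ k y) (hg : Integrable g ρ) (hkg : Integrable (fun y => (k y : ℂ) * g y) ρ)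
    {u : ℝ → ℂ}
    (hu : ∀ t, u t = ∫ y, g y * ((1 - k y * potential P A (k y) t : ℝ) : ℂ) ∂ρ) :
    (∀ j, CaputoDifferentiable (ν j) u) ∧ ∀ t, 0 < t →
      ∑ j, (lam j : ℂ) * caputoDeriv (ν j) u t
        = -∫ y, ((k y : ℂ) * g y) * ((1 - k y * potential P A (k y) t : ℝ) : ℂ) ∂ρ := by
  obtain rfl : u = _ := funext hu
  have hder := fun t (ht : 0 < t) => hA.hasDerivAt_superposition hm hν hlam hk hk0 hg hkg ht
  obtain ⟨α, hα, hα1, hpb⟩ := hA.exists_powerBounded_superposition hm hν hlam hk hk0 hkg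
  have hpb' : PowerBounded α
      (deriv fun t => ∫ y, g y * ((1 - k y * potential P A (k y) t : ℝ) : ℂ) ∂ρ) := by
    refine ⟨hpb.continuousOn.congr fun t ht => (hder t ht).deriv, fun T hT => ?_⟩
    obtain ⟨B, hB0, hB⟩ := hpb.bound T hT
    exact ⟨B, hB0, fun t ht htT => (hder t ht).deriv ▸ hB t ht htT⟩
  refine ⟨fun j => ⟨hA.continuousOn_superposition hm hν hlam hk hk0 hg,
    fun t ht => (hder t ht).differentiableAt, fun t ht => hpb'.intervalIntegrable hα hα1 ht,
    fun hne t ht => hpb'.intervalIntegrable_kernel hα hα1 (hν j).1.le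
      (lt_of_le_of_ne (hν j).2 hne) ht⟩, fun t ht => ?_⟩
  have h1 := fun j => hA.caputoIntegral_superposition hm hν hlam hk hk0 hkg
    (hν j).1.le (hν j).2 ht
  calc _ = ∑ j, (lam j : ℂ) * ∫ y, -((k y : ℂ) * g y) *
        caputoIntegral (ν j) (fun t => (potentialDensity P A (k y) t : ℂ)) t ∂ρ := by
        refine Finset.sum_congr rfl fun j _ => ?_
        rw [caputoDeriv_eq, ← (h1 j).2]
        congr 1
        exact caputoIntegral_congr ht fun s hs _ => (hder s hs).deriv
    _ = ∫ y, -((k y : ℂ) * g y) * ∑ j, (lam j : ℂ) *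
        caputoIntegral (ν j) (fun t => (potentialDensity P A (k y) t : ℂ)) t ∂ρ := by
        simp only [Finset.mul_sum, ← integral_const_mul]
        rw [← integral_finsetSum _ fun j _ => (h1 j).1.const_mul _]
        refine integral_congr_ae (ae_of_all _ fun y => Finset.sum_congr rfl fun j _ => ?_)
        ring
    _ = _ := by
        rw [← integral_neg]
        refine integral_congr_ae (ae_of_all _ fun y => ?_)
        simp only [hA.sum_caputoIntegral_potentialDensity hm hν hlam (hk0 y) ht]
        ring

end IsSubordinatorWith

/-! ### Signed measures and their Fourier transforms -/

section SignedIntegral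

variable {n : ℕ}

lemma toJordanDecomposition_toSignedMeasure {α : Type*} [MeasurableSpace α] (μ : Measure α)
    [IsFiniteMeasure μ] : μ.toSignedMeasure.toJordanDecomposition.posPart = μ ∧
      μ.toSignedMeasure.toJordanDecomposition.negPart = 0 := by
  have h : (JordanDecomposition.mk μ 0 Measure.MutuallySingular.zero_right).toSignedMeasure
      = μ.toSignedMeasure := by
    simp [JordanDecomposition.toSignedMeasure]
  rw [← h, JordanDecomposition.toJordanDecomposition_toSignedMeasure]
  exact ⟨rfl, rfl⟩

lemma signedIntegral_toSignedMeasure (μ : Measure (EuclideanSpace ℝ (Fin n))) [IsFiniteMeasure μ]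
    (f : EuclideanSpace ℝ (Fin n) → ℂ) : signedIntegral μ.toSignedMeasure f = ∫ x, f x ∂μ := by
  rw [signedIntegral, (toJordanDecomposition_toSignedMeasure μ).1,
    (toJordanDecomposition_toSignedMeasure μ).2, integral_zero_measure, sub_zero]

lemma totalVariation_toSignedMeasure {α : Type*} [MeasurableSpace α] (μ : Measure α)
    [IsFiniteMeasure μ] : μ.toSignedMeasure.totalVariation = μ := by
  rw [SignedMeasure.totalVariation, (toJordanDecomposition_toSignedMeasure μ).1,
    (toJordanDecomposition_toSignedMeasure μ).2, add_zero]

/-- The characteristic function `∫ exp (i ξ · x) dw(x)` of a signed measure. -/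
def signedCharFun (w : SignedMeasure (EuclideanSpace ℝ (Fin n))) (ξ : EuclideanSpace ℝ (Fin n)) :
    ℂ :=
  signedIntegral w fun x => Complex.exp (inner ℝ x ξ * Complex.I)

lemma signedCharFun_eq (w : SignedMeasure (EuclideanSpace ℝ (Fin n)))
    (ξ : EuclideanSpace ℝ (Fin n)) : signedCharFun w ξ
      = charFun w.toJordanDecomposition.posPart ξ - charFun w.toJordanDecomposition.negPart ξ := by
  rw [charFun_apply, charFun_apply]
  rfl

lemma signedCharFun_toSignedMeasure (μ : Measure (EuclideanSpace ℝ (Fin n))) [IsFiniteMeasure μ]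
    (ξ : EuclideanSpace ℝ (Fin n)) : signedCharFun μ.toSignedMeasure ξ = charFun μ ξ := by
  rw [signedCharFun, signedIntegral_toSignedMeasure, charFun_apply]

/-- Parseval's formula. The factor `2π` is due to the different normalisations of the Fourier
transform `𝓕` and of characteristic functions. -/
lemma integral_fourierInv (μ : Measure (EuclideanSpace ℝ (Fin n))) [IsFiniteMeasure μ]
    {g : EuclideanSpace ℝ (Fin n) → ℂ} (hg : Integrable g) :
    Integrable (fun ξ => g ξ * charFun μ ((2 * Real.pi) • ξ)) ∧
    ∫ x, 𝓕⁻ g x ∂μ = ∫ ξ, g ξ * charFun μ ((2 * Real.pi) • ξ) := by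
  have e : ∀ ξ x : EuclideanSpace ℝ (Fin n), Complex.exp (↑(2 * Real.pi * inner ℝ ξ x) * Complex.I)
      = Complex.exp (inner ℝ x ((2 * Real.pi) • ξ) * Complex.I) := fun ξ x => by
    rw [real_inner_smul_right, real_inner_comm]
  have hi : Integrable (Function.uncurry fun (x ξ : EuclideanSpace ℝ (Fin n)) =>
      Complex.exp (↑(2 * Real.pi * inner ℝ ξ x) * Complex.I) • g ξ) (μ.prod volume) := by
    have h1 : Integrable (fun p : EuclideanSpace ℝ (Fin n) × EuclideanSpace ℝ (Fin n) =>
        (1 : ℂ) * g p.2) (μ.prod volume) := (integrable_const (1 : ℂ)).mul_prod hg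
    simp only [one_mul] at h1
    have hE : Continuous fun p : EuclideanSpace ℝ (Fin n) × EuclideanSpace ℝ (Fin n) =>
        Complex.exp (↑(2 * Real.pi * inner ℝ p.2 p.1) * Complex.I) := by fun_prop
    refine h1.bdd_smul 1 hE.aestronglyMeasurable (ae_of_all _ fun p => ?_)
    exact (Complex.norm_exp_ofReal_mul_I _).le
  have h2 : ∀ ξ, ∫ x, Complex.exp (↑(2 * Real.pi * inner ℝ ξ x) * Complex.I) • g ξ ∂μ
      = g ξ * charFun μ ((2 * Real.pi) • ξ) := fun ξ => by
    rw [integral_smul_const, charFun_apply, smul_eq_mul, mul_comm]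
    simp only [e]
  refine ⟨?_, ?_⟩
  · simp only [← h2]
    exact hi.integral_prod_right
  · simp only [Real.fourierInv_eq', ← h2]
    exact integral_integral_swap hi

lemma signedIntegral_fourierInv (w : SignedMeasure (EuclideanSpace ℝ (Fin n)))
    {g : EuclideanSpace ℝ (Fin n) → ℂ} (hg : Integrable g) :
    signedIntegral w (𝓕⁻ g) = ∫ ξ, g ξ * signedCharFun w ((2 * Real.pi) • ξ) := by
  have h1 := integral_fourierInv w.toJordanDecomposition.posPart hg
  have h2 := integral_fourierInv w.toJordanDecomposition.negPart hg
  simp only [signedCharFun_eq, mul_sub]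
  rw [signedIntegral, h1.2, h2.2, integral_sub h1.1 h2.1]

lemma signedIntegral_schwartz (w : SignedMeasure (EuclideanSpace ℝ (Fin n)))
    (φ : 𝓢(EuclideanSpace ℝ (Fin n), ℂ)) :
    signedIntegral w φ = ∫ ξ, (𝓕 φ) ξ * signedCharFun w ((2 * Real.pi) • ξ) := by
  rw [← signedIntegral_fourierInv w (SchwartzMap.integrable _), ← SchwartzMap.fourierInv_coe,
    FourierTransform.fourierInv_fourier_eq]

lemma integrable_rpow_norm_mul {β : ℝ} (hβ : 0 < β ∧ β ≤ 1)
    (g : 𝓢(EuclideanSpace ℝ (Fin n), ℂ)) :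
    Integrable (fun ξ => (((2 * Real.pi * ‖ξ‖) ^ (2 * β) : ℝ) : ℂ) * g ξ) := by
  have hc : Continuous fun ξ : EuclideanSpace ℝ (Fin n) =>
      (((2 * Real.pi * ‖ξ‖) ^ (2 * β) : ℝ) : ℂ) := by
    refine Complex.continuous_ofReal.comp (Continuous.rpow_const (by fun_prop) fun ξ => Or.inr ?_)
    linarith [hβ.1]
  refine ((g.integrable (μ := volume)).norm.add
    ((g.integrable_pow_mul volume 2).const_mul ((2 * Real.pi) ^ 2))).mono'
    (hc.mul g.continuous).aestronglyMeasurable (ae_of_all _ fun ξ => ?_)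
  have hx : 0 ≤ 2 * Real.pi * ‖ξ‖ := by positivity
  rw [norm_mul, Complex.norm_real, Real.norm_of_nonneg (by positivity)]
  have h1 : (2 * Real.pi * ‖ξ‖) ^ (2 * β) ≤ 1 + (2 * Real.pi * ‖ξ‖) ^ 2 := by
    rcases le_total (2 * Real.pi * ‖ξ‖) 1 with h | h
    · have := Real.rpow_le_one hx h (show 0 ≤ 2 * β by linarith [hβ.1])
      nlinarith [sq_nonneg (2 * Real.pi * ‖ξ‖)]
    · have := Real.rpow_le_rpow_of_exponent_le h
        (show 2 * β ≤ (2 : ℕ) by push_cast; linarith [hβ.2])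
      rw [Real.rpow_natCast] at this
      linarith
  calc _ ≤ (1 + (2 * Real.pi * ‖ξ‖) ^ 2) * ‖g ξ‖ := by gcongr
    _ = _ := by simp only [Pi.add_apply]; ring

lemma signedIntegral_fracLaplacian {β : ℝ} (hβ : 0 < β ∧ β ≤ 1)
    (w : SignedMeasure (EuclideanSpace ℝ (Fin n))) (φ : 𝓢(EuclideanSpace ℝ (Fin n), ℂ)) :
    signedIntegral w (fracLaplacian β φ) = ∫ ξ, (((2 * Real.pi * ‖ξ‖) ^ (2 * β) : ℝ) : ℂ) *
      (𝓕 φ) ξ * signedCharFun w ((2 * Real.pi) • ξ) :=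
  signedIntegral_fourierInv w (integrable_rpow_norm_mul hβ _)

end SignedIntegral

/-! ### The law of the time-changed process solves the Cauchy problem -/

section Existence

variable {Ω : Type*} [MeasurableSpace Ω] {P : Measure Ω} [IsProbabilityMeasure P] {n m : ℕ}
  {ν lam : Fin m → ℝ} {β c : ℝ} {S : ℝ≥0 → Ω → EuclideanSpace ℝ (Fin n)} {H : Fin m → ℝ≥0 → Ω → ℝ}

/-- In Fourier variables the law of `W(t)` is the mode `1 - κ V(κ, t)` with `κ = c² ‖ξ‖ ^ (2β)`, so
that its integrals against Schwartz functions are superpositions of modes. -/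
theorem isCauchySolution_timeChanged (hm : 0 < m) (hν : ∀ j, 0 < ν j ∧ ν j ≤ 1)
    (hlam : ∀ j, 0 < lam j) (hβ : 0 < β ∧ β ≤ 1)
    (hA : IsSubordinatorWith (laplaceExponent ν lam) (weightedSum ν lam H) P)
    (hS : IsIsotropicStableProcess β S P)
    (hSH : IndepFun (fun (ω : Ω) (s : ℝ≥0) => S s ω)
      (fun (ω : Ω) (j : Fin m) (s : ℝ≥0) => H j s ω) P) :
    IsCauchySolution ν lam β c
      (fun t => (P.map (timeChanged ν lam c S H t)).toSignedMeasure) := by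
  have hprob : ∀ t, IsProbabilityMeasure (P.map (timeChanged ν lam c S H t)) := fun t =>
    Measure.isProbabilityMeasure_map (aemeasurable_timeChanged hA hS t)
  set k : EuclideanSpace ℝ (Fin n) → ℝ := fun ξ => c ^ 2 * (2 * Real.pi * ‖ξ‖) ^ (2 * β) with hk
  have hk0 : ∀ ξ, 0 ≤ k ξ := fun ξ => by positivity
  have hkm : Measurable k := by fun_prop
  have hchar : ∀ t ξ, signedCharFun (P.map (timeChanged ν lam c S H t)).toSignedMeasure
      ((2 * Real.pi) • ξ) = ((1 - k ξ * potential P (weightedSum ν lam H) (k ξ) t : ℝ) : ℂ) := by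
    intro t ξ
    rw [signedCharFun_toSignedMeasure, charFun_timeChanged hA hS hSH, norm_smul,
      Real.norm_of_nonneg (by positivity)]
  have hsol := fun φ : 𝓢(EuclideanSpace ℝ (Fin n), ℂ) => hA.superposition_solves (ρ := volume)
    (g := ⇑(𝓕 φ : 𝓢(EuclideanSpace ℝ (Fin n), ℂ))) (k := k) hm hν hlam hkm hk0
    (SchwartzMap.integrable _) (by
      refine ((integrable_rpow_norm_mul hβ (𝓕 φ)).const_mul ((c : ℂ) ^ 2)).congr
        (ae_of_all _ fun ξ => ?_)
      simp only [hk]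
      push_cast
      ring)
    (u := fun t => signedIntegral (P.map (timeChanged ν lam c S H t)).toSignedMeasure φ)
    (fun t => by simp only [signedIntegral_schwartz, hchar])
  refine ⟨Measure.toSignedMeasure_congr (Measure.ext_of_charFun (funext fun ξ => ?_)),
    ⟨1, 0, fun t _ => ?_⟩, fun φ => (hsol φ).1, fun φ t ht => ?_⟩
  · rw [charFun_timeChanged hA hS hSH, hA.potential_of_nonpos _ le_rfl]
    simp
  · rw [totalVariation_toSignedMeasure, measure_univ]
    simp
  · rw [(hsol φ).2 t ht, signedIntegral_fracLaplacian hβ, neg_mul, ← integral_const_mul]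
    congr 2
    ext ξ
    rw [hchar]
    simp only [hk]
    push_cast
    ring

end Existence

/-! ### Uniqueness -/

section Determination

variable {n : ℕ}

lemma norm_signedIntegral_le (w : SignedMeasure (EuclideanSpace ℝ (Fin n)))
    {f : EuclideanSpace ℝ (Fin n) → ℂ} {b : ℝ} (hf : ∀ x, ‖f x‖ ≤ b) :
    ‖signedIntegral w f‖ ≤ b * w.totalVariation.real univ := by
  have h : w.totalVariation.real univ = w.toJordanDecomposition.posPart.real univ
      + w.toJordanDecomposition.negPart.real univ := by
    rw [SignedMeasure.totalVariation, measureReal_add_apply]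
  rw [h, mul_add]
  refine (norm_sub_le _ _).trans (add_le_add ?_ ?_)
  · exact norm_integral_le_of_norm_le_const (ae_of_all _ hf)
  · exact norm_integral_le_of_norm_le_const (ae_of_all _ hf)

lemma norm_signedCharFun_le (w : SignedMeasure (EuclideanSpace ℝ (Fin n)))
    (ξ : EuclideanSpace ℝ (Fin n)) : ‖signedCharFun w ξ‖ ≤ w.totalVariation.real univ := by
  refine (norm_signedIntegral_le w (b := 1) fun x => ?_).trans_eq (one_mul _)
  exact (Complex.norm_exp_ofReal_mul_I _).le

lemma continuous_signedCharFun (w : SignedMeasure (EuclideanSpace ℝ (Fin n))) :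
    Continuous (signedCharFun w) := by
  have : signedCharFun w = fun ξ => charFun w.toJordanDecomposition.posPart ξ
      - charFun w.toJordanDecomposition.negPart ξ := funext (signedCharFun_eq w)
  rw [this]
  exact continuous_charFun.sub continuous_charFun

/-- Schwartz functions approximate a character boundedly: cut it off by smooth bump functions of
radius `k + 2`. -/
lemma exists_schwartz_tendsto (ξ : EuclideanSpace ℝ (Fin n)) :
    ∃ φ : ℕ → 𝓢(EuclideanSpace ℝ (Fin n), ℂ), ∀ w : SignedMeasure (EuclideanSpace ℝ (Fin n)),
      Tendsto (fun k => signedIntegral w (φ k)) atTop (𝓝 (signedCharFun w ξ)) := by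
  let b : ℕ → ContDiffBump (0 : EuclideanSpace ℝ (Fin n)) := fun k =>
    ⟨k + 1, k + 2, by positivity, by linarith⟩
  let e : EuclideanSpace ℝ (Fin n) → ℂ := fun x => Complex.exp (inner ℝ x ξ * Complex.I)
  have he : ContDiff ℝ (⊤ : ℕ∞) e := by
    have h1 : ContDiff ℝ (⊤ : ℕ∞) fun x : EuclideanSpace ℝ (Fin n) => ((inner ℝ x ξ : ℝ) : ℂ) :=
      Complex.ofRealCLM.contDiff.comp (contDiff_id.inner ℝ contDiff_const)
    exact (h1.mul contDiff_const).cexp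
  have hc : ∀ k, HasCompactSupport fun x => b k x • e x := fun k =>
    (b k).hasCompactSupport.smul_right
  have hs : ∀ k, ContDiff ℝ (⊤ : ℕ∞) fun x => b k x • e x := fun k => (b k).contDiff.smul he
  have hlim : ∀ (μ : Measure (EuclideanSpace ℝ (Fin n))) [IsFiniteMeasure μ],
      Tendsto (fun k => ∫ x, b k x • e x ∂μ) atTop (𝓝 (∫ x, e x ∂μ)) := by
    intro μ _
    refine tendsto_integral_of_dominated_convergence (fun _ => 1)
      (fun k => (hs k).continuous.aestronglyMeasurable) (integrable_const _)
      (fun k => ae_of_all _ fun x => ?_) (ae_of_all _ fun x => ?_)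
    · rw [norm_smul, Complex.norm_exp_ofReal_mul_I, mul_one, Real.norm_of_nonneg (b k).nonneg]
      exact (b k).le_one
    · refine tendsto_const_nhds.congr' ?_
      obtain ⟨N, hN⟩ := exists_nat_ge ‖x‖
      filter_upwards [eventually_ge_atTop N] with k hk
      have h1 : b k x = 1 := (b k).one_of_mem_closedBall (by
        rw [mem_closedBall_zero_iff]
        have : (N : ℝ) ≤ k := by exact_mod_cast hk
        change ‖x‖ ≤ (k : ℝ) + 1
        linarith)
      rw [h1, one_smul]
  refine ⟨fun k => (hc k).toSchwartzMap (hs k), fun w => ?_⟩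
  exact (hlim _).sub (hlim _)

/-- The characteristic function determines a signed measure: with the negative parts moved to the
other side, this is the statement for measures. -/
lemma signedMeasure_ext_of_signedCharFun {w w' : SignedMeasure (EuclideanSpace ℝ (Fin n))}
    (h : ∀ ξ, signedCharFun w ξ = signedCharFun w' ξ) : w = w' := by
  set p := w.toJordanDecomposition.posPart
  set q := w.toJordanDecomposition.negPart
  set p' := w'.toJordanDecomposition.posPart
  set q' := w'.toJordanDecomposition.negPart
  have hadd : ∀ (μ ν : Measure (EuclideanSpace ℝ (Fin n))) [IsFiniteMeasure μ] [IsFiniteMeasure ν]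
      (ξ : EuclideanSpace ℝ (Fin n)), charFun (μ + ν) ξ = charFun μ ξ + charFun ν ξ := by
    intro μ ν _ _ ξ
    have hi : ∀ (ρ : Measure (EuclideanSpace ℝ (Fin n))) [IsFiniteMeasure ρ],
        Integrable (fun x : EuclideanSpace ℝ (Fin n) => Complex.exp (inner ℝ x ξ * Complex.I)) ρ :=
      fun ρ _ => Integrable.of_bound
        (show Continuous fun x : EuclideanSpace ℝ (Fin n) =>
          Complex.exp (inner ℝ x ξ * Complex.I) by fun_prop).aestronglyMeasurable 1
        (ae_of_all _ fun x => (Complex.norm_exp_ofReal_mul_I _).le)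
    rw [charFun_apply, charFun_apply, charFun_apply, integral_add_measure (hi μ) (hi ν)]
  have hm : p + q' = p' + q := by
    refine Measure.ext_of_charFun (funext fun ξ => ?_)
    have h1 := h ξ
    rw [signedCharFun_eq, signedCharFun_eq] at h1
    rw [hadd, hadd]
    linear_combination h1
  have hm2 : p.toSignedMeasure + q'.toSignedMeasure = p'.toSignedMeasure + q.toSignedMeasure := by
    rw [← Measure.toSignedMeasure_add, ← Measure.toSignedMeasure_add]
    exact Measure.toSignedMeasure_congr hm
  rw [← w.toSignedMeasure_toJordanDecomposition, ← w'.toSignedMeasure_toJordanDecomposition,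
    JordanDecomposition.toSignedMeasure, JordanDecomposition.toSignedMeasure]
  exact sub_eq_sub_iff_add_eq_add.2 hm2

end Determination

namespace IsCauchySolution

variable {n m : ℕ} {ν lam : Fin m → ℝ} {β c : ℝ}
  {w w' : ℝ → SignedMeasure (EuclideanSpace ℝ (Fin n))}

lemma exists_growth (hw : IsCauchySolution ν lam β c w) : ∃ C a : ℝ, 0 ≤ C ∧ 0 ≤ a ∧
    ∀ t, 0 ≤ t → (w t).totalVariation.real univ ≤ C * Real.exp (a * t) := by
  obtain ⟨C, a, h⟩ := hw.growth
  refine ⟨|C|, |a|, abs_nonneg _, abs_nonneg _, fun t ht => ?_⟩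
  have h1 := h t ht
  rw [measureReal_def]
  refine (ENNReal.toReal_le_of_le_ofReal (by positivity) (h1.trans (ENNReal.ofReal_le_ofReal ?_)))
  calc C * Real.exp (a * t) ≤ |C| * Real.exp (a * t) := by gcongr; exact le_abs_self C
    _ ≤ |C| * Real.exp (|a| * t) := by gcongr; exact le_abs_self a

/-- Joint measurability of the characteristic functions in time and frequency: they are continuous in
the frequency, and in time they are limits of integrals of Schwartz functions, which are continuous.
The time is extended by `max t 0`, as nothing is assumed about `w t` for `t < 0`. -/
lemma measurable_signedCharFun (hm : 0 < m) (hw : IsCauchySolution ν lam β c w) :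
    Measurable fun p : ℝ × EuclideanSpace ℝ (Fin n) => signedCharFun (w (max p.1 0)) p.2 := by
  let u : EuclideanSpace ℝ (Fin n) → ℝ → ℂ := fun ξ t => signedCharFun (w (max t 0)) ξ
  have hcont : ∀ t, Continuous fun ξ => u ξ t := fun t => continuous_signedCharFun _
  have hmeas : ∀ ξ, Measurable (u ξ) := fun ξ => by
    obtain ⟨φ, hφ⟩ := exists_schwartz_tendsto ξ
    refine measurable_of_tendsto_metrizable (f := fun k t => signedIntegral (w (max t 0)) (φ k))
      (fun k => Continuous.measurable ?_) (tendsto_pi_nhds.2 fun t => hφ _)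
    have := (hw.regular (φ k) ⟨0, hm⟩).continuousOn
    exact this.comp_continuous (by fun_prop) fun t => le_max_right t 0
  have h : Measurable (Function.uncurry u) :=
    measurable_uncurry_of_continuous_of_measurable (fun t => hcont t) hmeas
  have e : (fun p : ℝ × EuclideanSpace ℝ (Fin n) => signedCharFun (w (max p.1 0)) p.2)
      = Function.uncurry u ∘ Prod.swap := rfl
  rw [e]
  exact h.comp measurable_swap

/-- The Fourier-Laplace transform of a family of signed measures, in the normalisation of `𝓕`.
Writing `max t 0` for `t` makes the integrand measurable in `t` without restriction. -/
def fourierLaplace (w : ℝ → SignedMeasure (EuclideanSpace ℝ (Fin n))) (μ : ℝ)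
    (ξ : EuclideanSpace ℝ (Fin n)) : ℂ :=
  ∫ t in Ioi (0 : ℝ), Real.exp (-μ * t) • signedCharFun (w (max t 0)) ((2 * Real.pi) • ξ)

/-- Fubini's theorem for the integral over the frequencies and the Laplace transform in time. -/
lemma hasLaplace_integral (hm : 0 < m) (hw : IsCauchySolution ν lam β c w) {C a : ℝ}
    (hg : ∀ t, 0 ≤ t → (w t).totalVariation.real univ ≤ C * Real.exp (a * t)) {μ : ℝ} (hμ : a < μ)
    {G : EuclideanSpace ℝ (Fin n) → ℂ} (hG : Integrable G) :
    Integrable (fun ξ => G ξ * fourierLaplace w μ ξ) ∧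
    HasLaplace (fun t => ∫ ξ, G ξ * signedCharFun (w t) ((2 * Real.pi) • ξ)) μ
      (∫ ξ, G ξ * fourierLaplace w μ ξ) := by
  set F : ℝ → EuclideanSpace ℝ (Fin n) → ℂ := fun t ξ =>
    Real.exp (-μ * t) • (G ξ * signedCharFun (w (max t 0)) ((2 * Real.pi) • ξ))
  have hF : Integrable (Function.uncurry F) ((volume.restrict (Ioi 0)).prod volume) := by
    have hdom : Integrable (fun p : ℝ × EuclideanSpace ℝ (Fin n) =>
        (C * Real.exp (-(μ - a) * p.1)) * ‖G p.2‖) ((volume.restrict (Ioi 0)).prod volume) :=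
      ((integrableOn_exp_mul_Ioi (by linarith) 0).const_mul C).mul_prod hG.norm
    refine hdom.mono' ?_ ?_
    · have h1 : Measurable fun p : ℝ × EuclideanSpace ℝ (Fin n) =>
          signedCharFun (w (max p.1 0)) ((2 * Real.pi) • p.2) :=
        (measurable_signedCharFun hm hw).comp
          (f := fun p : ℝ × EuclideanSpace ℝ (Fin n) => (p.1, (2 * Real.pi) • p.2)) (by fun_prop)
      have h2 : Measurable fun p : ℝ × EuclideanSpace ℝ (Fin n) => Real.exp (-μ * p.1) := by
        fun_prop
      exact h2.aestronglyMeasurable.smul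
        (hG.aestronglyMeasurable.comp_snd.mul h1.aestronglyMeasurable)
    · filter_upwards [Measure.quasiMeasurePreserving_fst.ae (ae_restrict_mem measurableSet_Ioi)]
        with p hp
      have hp : 0 < p.1 := hp
      simp only [Function.uncurry, F]
      rw [norm_smul, norm_mul, Real.norm_of_nonneg (Real.exp_pos _).le, max_eq_left hp.le]
      have h3 := (norm_signedCharFun_le (w p.1) ((2 * Real.pi) • p.2)).trans (hg p.1 hp.le)
      have h4 : Real.exp (-(μ - a) * p.1) = Real.exp (-μ * p.1) * Real.exp (a * p.1) := by
        rw [← Real.exp_add]; congr 1; ring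
      calc _ ≤ Real.exp (-μ * p.1) * (‖G p.2‖ * (C * Real.exp (a * p.1))) := by gcongr
        _ = _ := by rw [h4]; ring
  have e1 : ∀ t ∈ Ioi (0 : ℝ), ∫ ξ, F t ξ
      = Real.exp (-μ * t) • ∫ ξ, G ξ * signedCharFun (w t) ((2 * Real.pi) • ξ) := fun t ht => by
    simp only [F, max_eq_left (le_of_lt (mem_Ioi.1 ht))]
    rw [integral_smul]
  have e2 : ∀ ξ, ∫ t in Ioi (0 : ℝ), F t ξ = G ξ * fourierLaplace w μ ξ := fun ξ => by
    rw [fourierLaplace, ← integral_const_mul]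
    simp only [F, mul_smul_comm]
  refine ⟨?_, ?_, ?_⟩
  · simp only [← e2]
    exact hF.integral_prod_right
  · have h5 : IntegrableOn (fun t => ∫ ξ, F t ξ) (Ioi 0) := hF.integral_prod_left
    exact h5.congr_fun e1 measurableSet_Ioi
  · rw [← setIntegral_congr_fun measurableSet_Ioi e1, integral_integral_swap hF]
    simp only [e2]

lemma continuous_fourierLaplace (hm : 0 < m) (hw : IsCauchySolution ν lam β c w) {C a : ℝ}
    (hg : ∀ t, 0 ≤ t → (w t).totalVariation.real univ ≤ C * Real.exp (a * t)) {μ : ℝ}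
    (hμ : a < μ) : Continuous (fourierLaplace w μ) := by
  refine continuous_of_dominated (bound := fun t => C * Real.exp (-(μ - a) * t)) (fun ξ => ?_)
    (fun ξ => ?_) ((integrableOn_exp_mul_Ioi (by linarith) 0).const_mul C) (ae_of_all _ fun t => ?_)
  · have h1 : Measurable fun t : ℝ => signedCharFun (w (max t 0)) ((2 * Real.pi) • ξ) :=
      (measurable_signedCharFun hm hw).comp
        (f := fun t : ℝ => (t, (2 * Real.pi) • ξ)) (by fun_prop)
    have h2 : Measurable fun t : ℝ => Real.exp (-μ * t) := by fun_prop
    exact (h2.smul h1).aestronglyMeasurable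
  · filter_upwards [ae_restrict_mem measurableSet_Ioi] with t ht
    have ht : 0 < t := ht
    rw [norm_smul, Real.norm_of_nonneg (Real.exp_pos _).le, max_eq_left ht.le]
    have h3 := (norm_signedCharFun_le (w t) ((2 * Real.pi) • ξ)).trans (hg t ht.le)
    have h4 : Real.exp (-(μ - a) * t) = Real.exp (-μ * t) * Real.exp (a * t) := by
      rw [← Real.exp_add]; congr 1; ring
    calc _ ≤ Real.exp (-μ * t) * (C * Real.exp (a * t)) := by gcongr
      _ = _ := by rw [h4]; ring
  · exact ((continuous_signedCharFun _).comp (by fun_prop)).const_smul (Real.exp (-μ * t))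

/-- The Laplace transform of the equation. The derivative of `u` need not have a Laplace transform,
so that the equation is first integrated in time. -/
lemma fourierLaplace_equation (hm : 0 < m) (hν : ∀ j, 0 < ν j ∧ ν j ≤ 1) (hβ : 0 < β ∧ β ≤ 1)
    (hw : IsCauchySolution ν lam β c w) {C a : ℝ} (ha : 0 ≤ a)
    (hg : ∀ t, 0 ≤ t → (w t).totalVariation.real univ ≤ C * Real.exp (a * t)) {μ : ℝ} (hμ : a < μ)
    (φ : 𝓢(EuclideanSpace ℝ (Fin n), ℂ)) :
    ∫ ξ, ((laplaceExponent ν lam μ + c ^ 2 * (2 * Real.pi * ‖ξ‖) ^ (2 * β) : ℝ) : ℂ) *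
      (𝓕 φ) ξ * fourierLaplace w μ ξ = (laplaceExponent ν lam μ : ℂ) * φ 0 / μ := by
  have hμ0 : 0 < μ := by linarith
  set u : ℝ → ℂ := fun t => signedIntegral (w t) φ with hu
  set G : ℝ → ℂ := fun t => signedIntegral (w t) (fracLaplacian β φ) with hG
  obtain ⟨hi1, hL1⟩ := hw.hasLaplace_integral hm hg hμ
    (G := ⇑(𝓕 φ : 𝓢(EuclideanSpace ℝ (Fin n), ℂ))) (SchwartzMap.integrable _)
  obtain ⟨hi2, hL2⟩ := hw.hasLaplace_integral hm hg hμ (integrable_rpow_norm_mul hβ (𝓕 φ))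
  simp only [← signedIntegral_schwartz] at hL1
  simp only [← signedIntegral_fracLaplacian hβ] at hL2
  have hu0 : u 0 = φ 0 := by
    simp only [hu, hw.initial, signedIntegral_toSignedMeasure, integral_dirac]
  have hreg := hw.regular φ
  have hd : ∀ T, 0 < T → IntervalIntegrable (deriv u) volume 0 T := (hreg ⟨0, hm⟩).integrable_deriv
  have hprim : ∀ t, 0 < t → ∫ s in (0 : ℝ)..t, deriv u s = u t - φ 0 := fun t ht => by
    rw [← hu0]
    exact intervalIntegral.integral_eq_sub_of_hasDerivAt_of_le ht.le
      ((hreg ⟨0, hm⟩).continuousOn.mono Icc_subset_Ici_self)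
      (fun s hs => ((hreg ⟨0, hm⟩).differentiableAt s hs.1).hasDerivAt) (hd t ht)
  have hint : ∀ t, 0 < t → ∑ j, (lam j : ℂ) * caputoIntegral (ν j) (fun t => u t - φ 0) t
      = -(c : ℂ) ^ 2 * caputoIntegral 0 G t := by
    intro t ht
    have h1 := fun j => integral_caputoIntegral (hν j).1.le (hν j).2 hd ht
    calc _ = ∑ j, (lam j : ℂ) * ∫ s in (0 : ℝ)..t, caputoIntegral (ν j) (deriv u) s := by
          refine Finset.sum_congr rfl fun j _ => ?_
          rw [(h1 j).2, caputoIntegral_congr ht fun s hs _ => (hprim s hs).symm]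
      _ = ∫ s in (0 : ℝ)..t, ∑ j, (lam j : ℂ) * caputoIntegral (ν j) (deriv u) s := by
          rw [intervalIntegral.integral_finsetSum fun j _ => (h1 j).1.const_mul _]
          exact Finset.sum_congr rfl fun j _ => (intervalIntegral.integral_const_mul _ _).symm
      _ = ∫ s in (0 : ℝ)..t, -(c : ℂ) ^ 2 * G s := by
          refine intervalIntegral.integral_congr_uIoo fun s hs => ?_
          rw [uIoo_of_le ht.le] at hs
          exact hw.equation φ s hs.1
      _ = _ := by rw [intervalIntegral.integral_const_mul, caputoIntegral_zero]
  have hleft := HasLaplace.sum Finset.univ fun j (_ : j ∈ Finset.univ) =>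
    ((hL1.sub (HasLaplace.of_const (z := φ 0) hμ0)).caputoIntegral (hν j).2 hμ0).const_mul
      (lam j : ℂ)
  have hright := (hL2.caputoIntegral (ν := 0) zero_le_one hμ0).const_mul (-(c : ℂ) ^ 2)
  have key := (hleft.congr hint).2.symm.trans hright.2
  have hμc : (μ : ℂ) ≠ 0 := by exact_mod_cast hμ0.ne'
  have hsum : ∑ j, (lam j : ℂ) * (((μ ^ (ν j - 1) : ℝ) : ℂ) *
      ((∫ ξ, (𝓕 φ) ξ * fourierLaplace w μ ξ) - φ 0 / μ))
      = (laplaceExponent ν lam μ : ℂ) / μ * ((∫ ξ, (𝓕 φ) ξ * fourierLaplace w μ ξ) - φ 0 / μ) := by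
    rw [laplaceExponent]
    push_cast
    rw [Finset.sum_div, Finset.sum_mul]
    refine Finset.sum_congr rfl fun j _ => ?_
    rw [Real.rpow_sub_one hμ0.ne']
    push_cast
    ring
  rw [hsum, zero_sub, Real.rpow_neg_one] at key
  have e : ∀ ξ, ((laplaceExponent ν lam μ + c ^ 2 * (2 * Real.pi * ‖ξ‖) ^ (2 * β) : ℝ) : ℂ) *
      (𝓕 φ) ξ * fourierLaplace w μ ξ
      = (laplaceExponent ν lam μ : ℂ) * ((𝓕 φ) ξ * fourierLaplace w μ ξ) + (c : ℂ) ^ 2 *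
        ((((2 * Real.pi * ‖ξ‖) ^ (2 * β) : ℝ) : ℂ) * (𝓕 φ) ξ * fourierLaplace w μ ξ) := fun ξ => by
    push_cast
    ring
  simp only [e]
  rw [integral_add (hi1.const_mul _) (hi2.const_mul _), integral_const_mul, integral_const_mul]
  push_cast at key
  field_simp at key ⊢
  linear_combination key

/-- The equation determines the Fourier-Laplace transform. -/
lemma fourierLaplace_unique (hm : 0 < m) (hν : ∀ j, 0 < ν j ∧ ν j ≤ 1) (hlam : ∀ j, 0 < lam j)
    (hβ : 0 < β ∧ β ≤ 1) (hw : IsCauchySolution ν lam β c w) (hw' : IsCauchySolution ν lam β c w')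
    {C a C' : ℝ} (ha : 0 ≤ a)
    (hg : ∀ t, 0 ≤ t → (w t).totalVariation.real univ ≤ C * Real.exp (a * t))
    (hg' : ∀ t, 0 ≤ t → (w' t).totalVariation.real univ ≤ C' * Real.exp (a * t)) {μ : ℝ}
    (hμ : a < μ) : ∀ᵐ ξ, fourierLaplace w μ ξ = fourierLaplace w' μ ξ := by
  have hμ0 : 0 < μ := by linarith
  set q : EuclideanSpace ℝ (Fin n) → ℂ := fun ξ =>
    ((laplaceExponent ν lam μ + c ^ 2 * (2 * Real.pi * ‖ξ‖) ^ (2 * β) : ℝ) : ℂ) with hq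
  have hqc : Continuous q := by
    refine Complex.continuous_ofReal.comp (continuous_const.add (continuous_const.mul
      (Continuous.rpow_const (by fun_prop) fun ξ => Or.inr ?_)))
    linarith [hβ.1]
  have hq0 : ∀ ξ, q ξ ≠ 0 := fun ξ => by
    have := laplaceExponent_pos hm (ν := ν) hlam hμ0
    exact Complex.ofReal_ne_zero.2 (by positivity)
  have hcw := hw.continuous_fourierLaplace hm hg hμ
  have hcw' := hw'.continuous_fourierLaplace hm hg' hμ
  have hc : Continuous fun ξ => q ξ * (fourierLaplace w μ ξ - fourierLaplace w' μ ξ) :=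
    hqc.mul (hcw.sub hcw')
  have h0 : ∀ᵐ ξ, q ξ * (fourierLaplace w μ ξ - fourierLaplace w' μ ξ) = 0 := by
    refine ae_eq_zero_of_integral_contDiff_smul_eq_zero hc.locallyIntegrable fun g hgs hgc => ?_
    have hgc' : HasCompactSupport fun x => (g x : ℂ) := hgc.comp_left Complex.ofReal_zero
    have hgs' : ContDiff ℝ (⊤ : ℕ∞) fun x => (g x : ℂ) := Complex.ofRealCLM.contDiff.comp hgs
    set ψ : 𝓢(EuclideanSpace ℝ (Fin n), ℂ) := hgc'.toSchwartzMap hgs'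
    have hψ : ∀ x, ψ x = g x := fun x => rfl
    have h1 := hw.fourierLaplace_equation hm hν hβ ha hg hμ (𝓕⁻ ψ)
    have h2 := hw'.fourierLaplace_equation hm hν hβ ha hg' hμ (𝓕⁻ ψ)
    rw [FourierTransform.fourier_fourierInv_eq] at h1 h2
    have hi : ∀ F : EuclideanSpace ℝ (Fin n) → ℂ, Continuous F →
        Integrable fun ξ => q ξ * ψ ξ * F ξ := fun F hF =>
      ((hqc.mul ψ.continuous).mul hF).integrable_of_hasCompactSupport
        (HasCompactSupport.mul_right (HasCompactSupport.mul_left hgc'))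
    have h3 := integral_sub (hi _ hcw) (hi _ hcw')
    rw [h1, h2, sub_self] at h3
    rw [← h3]
    refine integral_congr_ae (ae_of_all _ fun ξ => ?_)
    simp only [hψ, Complex.real_smul]
    ring
  filter_upwards [h0] with ξ h
  exact sub_eq_zero.1 ((mul_eq_zero.1 h).resolve_left (hq0 ξ))

/-- **Uniqueness**: two solutions of exponential growth coincide. -/
theorem unique (hm : 0 < m) (hν : ∀ j, 0 < ν j ∧ ν j ≤ 1) (hlam : ∀ j, 0 < lam j)
    (hβ : 0 < β ∧ β ≤ 1) (hw : IsCauchySolution ν lam β c w) (hw' : IsCauchySolution ν lam β c w')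
    {t : ℝ} (ht : 0 ≤ t) : w t = w' t := by
  rcases ht.eq_or_lt with rfl | ht
  · rw [hw.initial, hw'.initial]
  obtain ⟨C, a₁, hC, -, hg₁⟩ := hw.exists_growth
  obtain ⟨C', a₂, hC', ha₂, hg₂⟩ := hw'.exists_growth
  set a := max a₁ a₂
  have ha : 0 ≤ a := ha₂.trans (le_max_right _ _)
  have hg : ∀ t, 0 ≤ t → (w t).totalVariation.real univ ≤ C * Real.exp (a * t) := fun t ht =>
    (hg₁ t ht).trans (by gcongr; exact le_max_left _ _)
  have hg' : ∀ t, 0 ≤ t → (w' t).totalVariation.real univ ≤ C' * Real.exp (a * t) := fun t ht =>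
    (hg₂ t ht).trans (by gcongr; exact le_max_right _ _)
  have hφ : ∀ φ : 𝓢(EuclideanSpace ℝ (Fin n), ℂ),
      signedIntegral (w t) φ = signedIntegral (w' t) φ := by
    intro φ
    refine eqOn_of_hasLaplace (a := a + 1)
      (z := fun μ => ∫ ξ, (𝓕 φ) ξ * fourierLaplace w μ ξ) (fun μ hμ => ?_) (fun μ hμ => ?_)
      ((hw.regular φ ⟨0, hm⟩).continuousOn.mono Ioi_subset_Ici_self)
      ((hw'.regular φ ⟨0, hm⟩).continuousOn.mono Ioi_subset_Ici_self) ht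
    · have h := (hw.hasLaplace_integral hm hg (μ := μ) (by linarith)
        (G := ⇑(𝓕 φ : 𝓢(EuclideanSpace ℝ (Fin n), ℂ))) (SchwartzMap.integrable _)).2
      simpa only [← signedIntegral_schwartz] using h
    · have h := (hw'.hasLaplace_integral hm hg' (μ := μ) (by linarith)
        (G := ⇑(𝓕 φ : 𝓢(EuclideanSpace ℝ (Fin n), ℂ))) (SchwartzMap.integrable _)).2
      have e : ∫ ξ, (𝓕 φ) ξ * fourierLaplace w μ ξ = ∫ ξ, (𝓕 φ) ξ * fourierLaplace w' μ ξ := by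
        refine integral_congr_ae ?_
        filter_upwards [hw.fourierLaplace_unique hm hν hlam hβ hw' ha hg hg' (μ := μ)
          (by linarith)] with ξ hξ
        rw [hξ]
      rw [e]
      simpa only [← signedIntegral_schwartz] using h
  refine signedMeasure_ext_of_signedCharFun fun ξ => ?_
  obtain ⟨φ, h⟩ := exists_schwartz_tendsto ξ
  refine tendsto_nhds_unique (h (w t)) ?_
  simp only [hφ]
  exact h (w' t)

end IsCauchySolution

end

theorem theorem2p2 {Ω : Type*} [MeasurableSpace Ω] (P : Measure Ω) [IsProbabilityMeasure P]
    (n m : ℕ) (hn : 0 < n) (hm : 0 < m)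
    (ν lam : Fin m → ℝ) (hν : ∀ j, 0 < ν j ∧ ν j ≤ 1) (hlam : ∀ j, 0 < lam j)
    (β c : ℝ) (hβ : 0 < β ∧ β ≤ 1) (hc : 0 < c)
    (S : ℝ≥0 → Ω → EuclideanSpace ℝ (Fin n)) (hS : IsIsotropicStableProcess β S P)
    (H : Fin m → ℝ≥0 → Ω → ℝ) (hH : ∀ j, IsStableSubordinator (ν j) (H j) P)
    (hHindep : iIndepFun (fun (j : Fin m) (ω : Ω) (s : ℝ≥0) => H j s ω) P)
    (hSH : IndepFun (fun (ω : Ω) (s : ℝ≥0) => S s ω)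
      (fun (ω : Ω) (j : Fin m) (s : ℝ≥0) => H j s ω) P) :
    -- `W(t) = S(c² L(t))` is a random vector
    (∀ t : ℝ, 0 ≤ t → AEMeasurable (timeChanged ν lam c S H t) P) ∧
    -- its law solves the Cauchy problem
    IsCauchySolution ν lam β c
      (fun t => (P.map (timeChanged ν lam c S H t)).toSignedMeasure) ∧
    -- and is the only solution
    (∀ w : ℝ → SignedMeasure (EuclideanSpace ℝ (Fin n)), IsCauchySolution ν lam β c w →
      ∀ t : ℝ, 0 ≤ t → w t = (P.map (timeChanged ν lam c S H t)).toSignedMeasure) ∧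
    -- the Fourier-Laplace transform of the solution
    (∀ (μ : ℝ) (ξ : EuclideanSpace ℝ (Fin n)), 0 < μ →
      IntegrableOn (fun t : ℝ => (Real.exp (-μ * t) : ℂ) *
        charFun (P.map (timeChanged ν lam c S H t)) ξ) (Ioi 0) ∧
      ∫ t in Ioi (0 : ℝ), (Real.exp (-μ * t) : ℂ) *
        charFun (P.map (timeChanged ν lam c S H t)) ξ
      = (((∑ j, lam j * μ ^ (ν j - 1)) /
          (∑ j, lam j * μ ^ ν j + c ^ 2 * ‖ξ‖ ^ (2 * β)) : ℝ) : ℂ)) := by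
  have hA := isSubordinatorWith_weightedSum hm hν hlam hH hHindep
  have hsol := isCauchySolution_timeChanged hm hν hlam hβ hA hS hSH (c := c)
  refine ⟨fun t _ => aemeasurable_timeChanged hA hS t, hsol,
    fun w hw t ht => hw.unique hm hν hlam hβ hsol ht, fun μ ξ hμ => ?_⟩
  have h := hasLaplace_charFun_timeChanged hm hlam hA hS hSH hμ ξ (c := c)
  simpa only [HasLaplace, Complex.real_smul] using h
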